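/- Let $J\subset\mathbb R$ be a bounded interval of positive length, write $\langle f\rangle_I=\frac1{|I|}\int_I f$, let $\varepsilon>0$ and $\lambda\ge 0$, and let $$\Omega=\Omega_\varepsilon=\{x=(x_1,x_2)\in\mathbb R^2: x_1^2\le x_2\le x_1^2+\varepsilon^2\}.$$ For $x\in\Omega$ let $S_\varepsilon(x)$ be the set of real functions $\varphi\in L^1(J)$ with $\langle\varphi\rangle_J=x_1$, $\langle\varphi^2\rangle_J=x_2$ and $\langle|\varphi-\langle\varphi\rangle_I|^2\rangle_I\le\varepsilon^2$ for every subinterval $I\subset J$ (that is, whose $L^2$-based BMO norm is at most $\varepsilon$), and let $$\mathbf B(x;\lambda,\varepsilon)=\frac1{|J|}\sup\big\{|\{s\in J:|\varphi(s)|\ge\lambda\}|:\varphi\in S_\varepsilon(x)\big\}.$$ Then $S_\varepsilon(x)\neq\emptyset$ for every $x\in\Omega$, and $\mathbf B$ is given as follows; in each regime the listed subdomains cover $\Omega$. (1) If $0\le\lambda\le\varepsilon$, put $\Omega_1=\{x\in\Omega: x_2\ge\lambda^2\}$, $\Omega_2=\{x\in\Omega:\lambda|x_1|\le x_2\le\lambda^2\}$,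 $\Omega_3=\{x\in\Omega: x_2<\lambda|x_1|\}$. Then $\mathbf B(x;\lambda,\varepsilon)=1$ on $\Omega_1$; $\mathbf B(x;\lambda,\varepsilon)=\frac{x_2}{\lambda^2}$ on $\Omega_2$ if $\lambda>0$ (if $\lambda=0$, then $\Omega_1=\Omega$); and $\mathbf B(x;\lambda,\varepsilon)=\frac{x_2-x_1^2}{x_2+\lambda^2-2\lambda|x_1|}$ on $\Omega_3$. (2) If $\varepsilon<\lambda\le2\varepsilon$, put $$\begin{aligned} \Omega_1&=\{x\in\Omega:|x_1|\ge\lambda,\text{ and }x_2\le2(\lambda+\varepsilon)|x_1|-\lambda^2-2\varepsilon\lambda\text{ if }|x_1|<\lambda+\varepsilon\},\\ \Omega_2&=\{x\in\Omega:\lambda-\varepsilon\le|x_1|\le\lambda+\varepsilon,\ x_2\ge2\lambda|x_1|-\lambda^2+2\varepsilon\big||x_1|-\lambda\big|\},\\ \Omega_3&=\{x\in\Omega:x_2<\lambda|x_1|\},\\ \Omega_4&=\{x\in\Omega:x_2\ge\lambda|x_1|,\text{ and }x_2\le2(\lambda-\varepsilon)|x_1|-\lambda^2+2\varepsilon\lambda\text{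 if }|x_1|>\lambda-\varepsilon\}. \end{aligned}$$ Then $$\mathbf B(x;\lambda,\varepsilon)=\begin{cases}1,&x\in\Omega_1,\\[2pt] \dfrac{2(\lambda^2-\varepsilon^2)|x_1|-(\lambda-\varepsilon)x_2+\lambda(2\varepsilon^2+\varepsilon\lambda-\lambda^2)}{2\varepsilon\lambda^2},&x\in\Omega_2,\\[4pt] \dfrac{x_2-x_1^2}{x_2+\lambda^2-2\lambda|x_1|},&x\in\Omega_3,\\[4pt] \dfrac{x_2}{\lambda^2},&x\in\Omega_4.\end{cases}$$ (3) If $\lambda>2\varepsilon$, let $\Omega_1,\Omega_2$ be given by the same formulas as in (2), and put $$\begin{aligned} \Omega_3&=\{x\in\Omega:x_2<2(\lambda-\varepsilon)|x_1|-\lambda^2+2\varepsilon\lambda\},\\ \Omega_4&=\{x\in\Omega:|x_1|\le\lambda-\varepsilon,\ x_2\ge2(\lambda-\varepsilon)|x_1|-\lambda^2+2\varepsilon\lambda,\text{ and }x_2\le2\varepsilon|x_1|\text{ if }|x_1|<\varepsilon\},\\ \Omega_5&=\{x\in\Omega:|x_1|\le\varepsilon,\ x_2\ge2\varepsilon|x_1|\}.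 \end{aligned}$$ Then $$\mathbf B(x;\lambda,\varepsilon)=\begin{cases}1,&x\in\Omega_1,\\[2pt] 1-\dfrac{x_2-2(\lambda+\varepsilon)|x_1|+\lambda^2+2\varepsilon\lambda}{8\varepsilon^2},&x\in\Omega_2,\\[4pt] \dfrac{x_2-x_1^2}{x_2+\lambda^2-2\lambda|x_1|},&x\in\Omega_3,\\[4pt] \dfrac e2\Big(1-\sqrt{1-\tfrac{x_2-x_1^2}{\varepsilon^2}}\Big)\exp\Big\{\dfrac{|x_1|-\lambda}{\varepsilon}+\sqrt{1-\tfrac{x_2-x_1^2}{\varepsilon^2}}\Big\},&x\in\Omega_4,\\[4pt] \dfrac{x_2}{4\varepsilon^2}\exp\Big\{2-\dfrac\lambda\varepsilon\Big\},&x\in\Omega_5.\end{cases}$$ -/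

import Mathlib

open MeasureTheory Set

noncomputable section

namespace WeakJN

/-- The mean square oscillation of `φ` over the interval `[c, d]`:
the average over `[c, d]` of `|φ - ⟨φ⟩|²`, where `⟨φ⟩` is the average of `φ` over `[c, d]`. -/
def meanSqOsc (φ : ℝ → ℝ) (c d : ℝ) : ℝ :=
  ⨍ s in c..d, |φ s - ⨍ t in c..d, φ t| ^ 2

/-- `φ` belongs to the ball of radius `ε` of the `L²`-based `BMO` space on `J = [a, b]`:
`φ` is integrable on `J`, and its mean square oscillation over every nondegenerate subinterval
of `J` is finite (the integrability condition) and at most `ε ^ 2`.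
Only the values of `φ` on `J` matter. -/
def MemBMOBall (a b ε : ℝ) (φ : ℝ → ℝ) : Prop :=
  IntervalIntegrable φ volume a b ∧
    ∀ c d : ℝ, a ≤ c → c < d → d ≤ b →
      IntervalIntegrable (fun s => |φ s - ⨍ t in c..d, φ t| ^ 2) volume c d ∧
        meanSqOsc φ c d ≤ ε ^ 2

/-- The parabolic strip `x₁² ≤ x₂ ≤ x₁² + ε²`. -/
def strip (ε : ℝ) : Set (ℝ × ℝ) :=
  {x | x.1 ^ 2 ≤ x.2 ∧ x.2 ≤ x.1 ^ 2 + ε ^ 2}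

/-- The test functions on `J = [a, b]` with Bellman point `x`. -/
def testFunctions (a b ε : ℝ) (x : ℝ × ℝ) : Set (ℝ → ℝ) :=
  {φ | MemBMOBall a b ε φ ∧ (⨍ s in a..b, φ s) = x.1 ∧ (⨍ s in a..b, φ s ^ 2) = x.2}

/-- The Bellman function `B(x; lam, ε)` of the weak John-Nirenberg inequality on `J = [a, b]`.
The set of which the supremum is taken lies in `[0, b - a]`. -/
def bellman (a b : ℝ) (x : ℝ × ℝ) (lam ε : ℝ) : ℝ :=
  1 / (b - a) *
    sSup {m : ℝ | ∃ φ ∈ testFunctions a b ε x,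
      m = volume.real {s : ℝ | s ∈ Icc a b ∧ lam ≤ |φ s|}}

/-! Subdomains for `0 ≤ lam ≤ ε`. -/

def small1 (lam ε : ℝ) : Set (ℝ × ℝ) := {x ∈ strip ε | lam ^ 2 ≤ x.2}

def small2 (lam ε : ℝ) : Set (ℝ × ℝ) := {x ∈ strip ε | lam * |x.1| ≤ x.2 ∧ x.2 ≤ lam ^ 2}

def small3 (lam ε : ℝ) : Set (ℝ × ℝ) := {x ∈ strip ε | x.2 < lam * |x.1|}

/-! Subdomains for `ε < lam`; the first two are the same for `lam ≤ 2 * ε` and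
for `2 * ε < lam`. -/

def outer1 (lam ε : ℝ) : Set (ℝ × ℝ) :=
  {x ∈ strip ε | lam ≤ |x.1| ∧
    (|x.1| < lam + ε → x.2 ≤ 2 * (lam + ε) * |x.1| - lam ^ 2 - 2 * ε * lam)}

def outer2 (lam ε : ℝ) : Set (ℝ × ℝ) :=
  {x ∈ strip ε | lam - ε ≤ |x.1| ∧ |x.1| ≤ lam + ε ∧
    max (2 * lam * |x.1| - lam ^ 2 + 2 * ε * (|x.1| - lam))
      (2 * lam * |x.1| - lam ^ 2 - 2 * ε * (|x.1| - lam)) ≤ x.2}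

/-! The remaining subdomains for `ε < lam ≤ 2 * ε`. -/

def medium3 (lam ε : ℝ) : Set (ℝ × ℝ) := {x ∈ strip ε | x.2 < lam * |x.1|}

def medium4 (lam ε : ℝ) : Set (ℝ × ℝ) :=
  {x ∈ strip ε | lam * |x.1| ≤ x.2 ∧
    (lam - ε < |x.1| → x.2 ≤ 2 * (lam - ε) * |x.1| - lam ^ 2 + 2 * ε * lam)}

/-! The remaining subdomains for `2 * ε < lam`. -/

def large3 (lam ε : ℝ) : Set (ℝ × ℝ) :=
  {x ∈ strip ε | x.2 < 2 * (lam - ε) * |x.1| - lam ^ 2 + 2 * ε * lam}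

def large4 (lam ε : ℝ) : Set (ℝ × ℝ) :=
  {x ∈ strip ε | |x.1| ≤ lam - ε ∧
    2 * (lam - ε) * |x.1| - lam ^ 2 + 2 * ε * lam ≤ x.2 ∧
    (|x.1| < ε → x.2 ≤ 2 * ε * |x.1|)}

def large5 (ε : ℝ) : Set (ℝ × ℝ) :=
  {x ∈ strip ε | |x.1| ≤ ε ∧ 2 * ε * |x.1| ≤ x.2}

end WeakJN

end

/-! To a subinterval corresponds its Bellman point, the pair of averages of `φ` and `φ ^ 2`. Apart
from integrability, the BMO condition says that all Bellman points lie in `strip ε`, and cutting an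
interval writes its point as the convex combination of the points of the two parts.

Upper bound. A nonnegative function `G`, concave along the segments inside the strip and at least
`1` near the lower boundary where `lam ≤ |x₁|`, majorizes the normalized measure of the superlevel
set: cut repeatedly and apply Lebesgue differentiation (`MemBMOBall.measure_le`). The segment
between the points of two parts may leave `strip ε`, so one works in `strip δ` with `ε < δ`, where
every interval has a cut of controlled ratio whose segment stays inside (`MemBMOBall.exists_split`).
The candidate `majorant` is on its left part the minimum over a one-parameter family of affine
functions of `(|x₁|, x₂)`, followed by one more affine piece and the constant `1`; the pieces
themselves serve as supports (`Admissible.hasSupports`). Then `δ` decreases to `ε` and the threshold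
increases to `lam`. Where the value is `1`, `x₂ / lam ^ 2` or the quotient, the trivial bound or
Markov's inequality for `(φ - k) ^ 2` with a suitable `k` suffices
(`measure_superlevel_le_quadratic`).

Lower bound. After an affine change of variable and a reflection, extremal functions are monotone on
`[0, 1]`: they take two values, or the values `-lam, 0, lam`, or are a constant with tails attached
to its ends. The typical tail is a logarithm, which moves the Bellman point along the upper
boundary, capped by a jump of height `2 * ε`. The oscillation is controlled by `∫ (φ - v) ^ 2 ≤ 2 *
ε * |∫ (φ - v)|` for a level `v` adapted to the subinterval (`variance_le_of_sq_le`,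
`twoSided_tail_mem`); the three-valued case needs `three_levels_variance`.

Throughout, `s` and `p` stand for the tangency abscissae `x₁ + radius` and `x₁ - radius`, with
`|x₁|` for `x₁` where the formulas are even in `x₁`. -/

noncomputable section

namespace WeakJN

open Filter Topology

/-! ### Geometry of the strip: visibility and local concavity -/

/-- Half the length of the interval of abscissae of the points at which the tangent lines from `x`
touch the upper boundary of `strip δ`. -/
def radius (δ : ℝ) (x : ℝ × ℝ) : ℝ := √(δ ^ 2 - (x.2 - x.1 ^ 2))

lemma radius_nonneg (δ : ℝ) (x : ℝ × ℝ) : 0 ≤ radius δ x := Real.sqrt_nonneg _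

lemma radius_sq {δ : ℝ} {x : ℝ × ℝ} (hx : x ∈ strip δ) :
    radius δ x ^ 2 = δ ^ 2 - (x.2 - x.1 ^ 2) :=
  Real.sq_sqrt (by linarith [hx.2])

lemma radius_le {δ : ℝ} (hδ : 0 ≤ δ) {x : ℝ × ℝ} (hx : x ∈ strip δ) : radius δ x ≤ δ := by
  have := hx.1
  exact Real.sqrt_le_iff.2 ⟨hδ, by linarith⟩

lemma strip_mono {ε δ : ℝ} (hε : 0 ≤ ε) (h : ε ≤ δ) : strip ε ⊆ strip δ := fun x hx =>
  ⟨hx.1, hx.2.trans (by nlinarith)⟩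

/-- Two points of the strip see each other inside `strip δ`. -/
def Visible (δ : ℝ) (x y : ℝ × ℝ) : Prop := |x.1 - y.1| ≤ radius δ x + radius δ y

lemma Visible.symm {δ : ℝ} {x y : ℝ × ℝ} (h : Visible δ x y) : Visible δ y x := by
  unfold Visible at *
  rw [abs_sub_comm]; linarith

/-- This quadratic in `θ` is nonnegative on `[0, 1]` exactly when the distance of the abscissae is
at most the sum of the radii. Hence `Visible` means that the segment stays below the upper boundary.
-/
lemma radius_sq_combo {δ θ : ℝ} {p q x : ℝ × ℝ} (hp : p ∈ strip δ) (hq : q ∈ strip δ)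
    (h1 : x.1 = θ * p.1 + (1 - θ) * q.1) (h2 : x.2 = θ * p.2 + (1 - θ) * q.2) :
    δ ^ 2 - (x.2 - x.1 ^ 2) = θ * radius δ p ^ 2 + (1 - θ) * radius δ q ^ 2
      - θ * (1 - θ) * (p.1 - q.1) ^ 2 := by
  rw [radius_sq hp, radius_sq hq, h1, h2]; ring

/-- The combination of two points of `strip δ` that see each other is in `strip δ` and sees both. -/
lemma Visible.combo {δ θ : ℝ} {p q x : ℝ × ℝ} (hp : p ∈ strip δ) (hq : q ∈ strip δ)
    (hpq : Visible δ p q) (h0 : 0 ≤ θ) (hθ : θ ≤ 1)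
    (h1 : x.1 = θ * p.1 + (1 - θ) * q.1) (h2 : x.2 = θ * p.2 + (1 - θ) * q.2) :
    x ∈ strip δ ∧ Visible δ x p ∧ Visible δ x q := by
  have hc := radius_sq_combo hp hq h1 h2
  have ha := radius_nonneg δ p
  have hb := radius_nonneg δ q
  unfold Visible at hpq
  have hk : (p.1 - q.1) ^ 2 ≤ (radius δ p + radius δ q) ^ 2 := by
    rw [← sq_abs]; gcongr
  have hθ' : 0 ≤ θ * (1 - θ) := mul_nonneg h0 (by linarith)
  -- Replacing the distance of the abscissae by its maximal value completes the square; the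
  -- resulting lower bound for the radius of `x` gives both visibilities.
  have hlow : (θ * radius δ p - (1 - θ) * radius δ q) ^ 2 ≤ δ ^ 2 - (x.2 - x.1 ^ 2) := by
    rw [hc]; nlinarith [mul_le_mul_of_nonneg_left hk hθ']
  have hx : x ∈ strip δ := by
    constructor
    · rw [h1, h2]
      have := hp.1
      have := hq.1
      have e1 := mul_le_mul_of_nonneg_left hp.1 h0
      have e2 := mul_le_mul_of_nonneg_left hq.1 (sub_nonneg.2 hθ)
      nlinarith [mul_nonneg hθ' (sq_nonneg (p.1 - q.1))]
    · nlinarith [sq_nonneg (θ * radius δ p - (1 - θ) * radius δ q)]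
  have hr : |θ * radius δ p - (1 - θ) * radius δ q| ≤ radius δ x := Real.abs_le_sqrt hlow
  obtain ⟨hr1, hr2⟩ := abs_le.1 hr
  refine ⟨hx, ?_, ?_⟩ <;> unfold Visible
  · have : x.1 - p.1 = -((1 - θ) * (p.1 - q.1)) := by rw [h1]; ring
    rw [this, abs_neg, abs_mul, abs_of_nonneg (sub_nonneg.2 hθ)]
    nlinarith [mul_le_mul_of_nonneg_left hpq (sub_nonneg.2 hθ)]
  · have : x.1 - q.1 = θ * (p.1 - q.1) := by rw [h1]; ring
    rw [this, abs_mul, abs_of_nonneg h0]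
    nlinarith [mul_le_mul_of_nonneg_left hpq h0]

/-- At every point of `strip δ` there is an affine function that agrees with `G` there and
majorizes `G` at all visible points. -/
def HasSupports (δ : ℝ) (G : ℝ × ℝ → ℝ) : Prop :=
  ∀ z ∈ strip δ, ∃ A B C : ℝ, A * z.1 + B * z.2 + C = G z ∧
    ∀ q ∈ strip δ, Visible δ z q → G q ≤ A * q.1 + B * q.2 + C

lemma HasSupports.concave {δ θ : ℝ} {G : ℝ × ℝ → ℝ} (hG : HasSupports δ G) {p q x : ℝ × ℝ}
    (hp : p ∈ strip δ) (hq : q ∈ strip δ) (hpq : Visible δ p q) (h0 : 0 ≤ θ) (hθ : θ ≤ 1)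
    (h1 : x.1 = θ * p.1 + (1 - θ) * q.1) (h2 : x.2 = θ * p.2 + (1 - θ) * q.2) :
    θ * G p + (1 - θ) * G q ≤ G x := by
  obtain ⟨hx, hxp, hxq⟩ := hpq.combo hp hq h0 hθ h1 h2
  obtain ⟨A, B, C, he, hle⟩ := hG x hx
  rw [← he, h1, h2]
  nlinarith [mul_le_mul_of_nonneg_left (hle p hp hxp) h0,
    mul_le_mul_of_nonneg_left (hle q hq hxq) (sub_nonneg.2 hθ)]

/-- Square the two visibility bounds, weight them by `θ` and `1 - θ`, and compare with
`radius_sq_combo`: what remains is the visibility of `p` and `q`. -/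
lemma visible_of_visible_combo {δ θ : ℝ} {p q x : ℝ × ℝ} (hp : p ∈ strip δ) (hq : q ∈ strip δ)
    (hx : x ∈ strip δ) (h0 : 0 < θ) (hθ : θ < 1)
    (h1 : x.1 = θ * p.1 + (1 - θ) * q.1) (h2 : x.2 = θ * p.2 + (1 - θ) * q.2)
    (hxp : Visible δ x p) (hxq : Visible δ x q) : Visible δ p q := by
  have hc := radius_sq_combo hp hq h1 h2
  rw [← radius_sq hx, ← sq_abs (p.1 - q.1)] at hc
  have e1 : x.1 - p.1 = -((1 - θ) * (p.1 - q.1)) := by rw [h1]; ring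
  have e2 : x.1 - q.1 = θ * (p.1 - q.1) := by rw [h1]; ring
  unfold Visible at *
  rw [e1, abs_neg, abs_mul, abs_of_pos (sub_pos.2 hθ)] at hxp
  rw [e2, abs_mul, abs_of_pos h0] at hxq
  have ha := radius_nonneg δ p
  have hb := radius_nonneg δ q
  have hg := radius_nonneg δ x
  generalize radius δ p = a at *
  generalize radius δ q = b at *
  generalize radius δ x = g at *
  generalize |p.1 - q.1| = K at *
  by_contra! hlt
  have hA : ((1 - θ) * K - a) ^ 2 ≤ g ^ 2 := sq_le_sq' (by linarith) (by linarith)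
  have hB : (θ * K - b) ^ 2 ≤ g ^ 2 := sq_le_sq' (by linarith) (by linarith)
  have hpos : 0 < θ * (1 - θ) * K * (K - a - b) := by
    have : 0 < K := by linarith
    have : 0 < K - a - b := by linarith
    have : 0 < 1 - θ := by linarith
    positivity
  nlinarith [mul_le_mul_of_nonneg_left hA h0.le,
    mul_le_mul_of_nonneg_left hB (sub_pos.2 hθ).le]

/-- Equality in the visibility bound means tangency to the upper boundary, and a tangent line never
crosses that boundary, however far it is continued. -/
lemma visible_of_tangent {δ θ : ℝ} {p q x : ℝ × ℝ} (hp : p ∈ strip δ) (hq : q ∈ strip δ)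
    (hx : x ∈ strip δ) (h0 : 0 < θ) (hθ : θ < 1)
    (h1 : x.1 = θ * p.1 + (1 - θ) * q.1) (h2 : x.2 = θ * p.2 + (1 - θ) * q.2)
    (hxp : |x.1 - p.1| = radius δ x + radius δ p) : Visible δ p q := by
  have hc := radius_sq_combo hp hq h1 h2
  rw [← radius_sq hx, ← sq_abs (p.1 - q.1)] at hc
  have e1 : x.1 - p.1 = -((1 - θ) * (p.1 - q.1)) := by rw [h1]; ring
  have h1θ := sub_pos.2 hθ
  rw [e1, abs_neg, abs_mul, abs_of_pos h1θ] at hxp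
  unfold Visible
  have ha := radius_nonneg δ p
  have hb := radius_nonneg δ q
  have hg := radius_nonneg δ x
  generalize radius δ p = a at *
  generalize radius δ q = b at *
  generalize radius δ x = g at *
  generalize |p.1 - q.1| = K at *
  have hsq : ((1 - θ) * b) ^ 2 = (g + θ * a) ^ 2 := by
    have : θ * ((1 - θ) * K) ^ 2 = θ * (g + a) ^ 2 := by rw [hxp]
    nlinarith
  have hb' : (1 - θ) * b = g + θ * a := by
    rwa [sq_eq_sq₀ (by positivity) (by positivity)] at hsq
  have : (1 - θ) * K = (1 - θ) * (a + b) := by linarith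
  exact (mul_left_cancel₀ h1θ.ne' this).le

lemma continuousOn_radius {δ : ℝ} {P : ℝ → ℝ × ℝ} {s : Set ℝ} (hP : ContinuousOn P s) :
    ContinuousOn (fun t => radius δ (P t)) s := by
  unfold radius
  fun_prop

/-- Enlarge the part `P` from half the interval until it is just visible from `x`; then tangency
applies. At that moment `x` and `P θ` are at least `2 * √(δ ^ 2 - ε ^ 2)` apart, while `x ∈ strip ε`
bounds `θ * (1 - θ)` times the squared distance of the abscissae of the parts, which keeps `θ` away
from `1`. -/
lemma exists_visible_of_not_visible {ε δ : ℝ} (hε : 0 < ε) (hδ : ε < δ) {P Q : ℝ → ℝ × ℝ}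
    {x : ℝ × ℝ} (hx : x ∈ strip ε) (hPc : ContinuousOn P (Icc (1 / 2) 1)) (hP1 : P 1 = x)
    (hP : ∀ θ ∈ Icc (1 / 2 : ℝ) 1, P θ ∈ strip ε)
    (hQ : ∀ θ ∈ Ico (1 / 2 : ℝ) 1, Q θ ∈ strip ε ∧
      x.1 = θ * (P θ).1 + (1 - θ) * (Q θ).1 ∧ x.2 = θ * (P θ).2 + (1 - θ) * (Q θ).2)
    (hbad : ¬ Visible δ x (P (1 / 2))) :
    ∃ θ, 1 / 2 ≤ θ ∧ θ < 1 ∧ 2 * (δ ^ 2 - ε ^ 2) / ε ^ 2 ≤ 1 - θ ∧ Visible δ (P θ) (Q θ) := by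
  have hsub := strip_mono hε.le hδ.le
  have hρ : ∀ y ∈ strip ε, √(δ ^ 2 - ε ^ 2) ≤ radius δ y := fun y hy =>
    Real.sqrt_le_sqrt (by linarith [hy.2])
  have hd : 0 < δ ^ 2 - ε ^ 2 := by nlinarith
  have hρ0 : 0 < √(δ ^ 2 - ε ^ 2) := Real.sqrt_pos.2 hd
  have hρ2 : √(δ ^ 2 - ε ^ 2) ^ 2 = δ ^ 2 - ε ^ 2 := Real.sq_sqrt hd.le
  generalize √(δ ^ 2 - ε ^ 2) = ρ at *
  have hcont : ContinuousOn (fun θ => |x.1 - (P θ).1| - (radius δ x + radius δ (P θ)))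
      (Icc (1 / 2) 1) := by
    have := continuousOn_radius (δ := δ) hPc
    fun_prop
  have hmem : (0 : ℝ) ∈ Icc (|x.1 - (P 1).1| - (radius δ x + radius δ (P 1)))
      (|x.1 - (P (1 / 2)).1| - (radius δ x + radius δ (P (1 / 2)))) := by
    constructor
    · rw [hP1, sub_self, abs_zero]
      linarith [radius_nonneg δ x]
    · unfold Visible at hbad
      linarith
  obtain ⟨θ, hθ, hzero⟩ := intermediate_value_Icc' (by norm_num) hcont hmem
  have hθ1 : θ < 1 := by
    rcases hθ.2.lt_or_eq with h | h
    · exact h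
    · simp only [h, hP1, sub_self, abs_zero] at hzero
      linarith [hρ x hx]
  obtain ⟨hQs, e1, e2⟩ := hQ θ ⟨hθ.1, hθ1⟩
  have hPs := hP θ hθ
  have hθ0 : 0 < θ := by linarith [hθ.1]
  have heq : |x.1 - (P θ).1| = radius δ x + radius δ (P θ) := by
    simpa [sub_eq_zero] using hzero
  refine ⟨θ, hθ.1, hθ1, ?_,
    visible_of_tangent (hsub hPs) (hsub hQs) (hsub hx) hθ0 hθ1 e1 e2 heq⟩
  have h1θ := sub_pos.2 hθ1
  have hk : (x.1 - (P θ).1) ^ 2 = (1 - θ) ^ 2 * ((P θ).1 - (Q θ).1) ^ 2 := by rw [e1]; ring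
  have hge : 4 * (δ ^ 2 - ε ^ 2) ≤ (1 - θ) ^ 2 * ((P θ).1 - (Q θ).1) ^ 2 := by
    rw [← hk, ← sq_abs (x.1 - _), heq, ← hρ2]
    nlinarith [hρ x hx, hρ _ hPs]
  have hvar : θ * (1 - θ) * ((P θ).1 - (Q θ).1) ^ 2 ≤ ε ^ 2 := by
    have h := hx.2
    rw [e1, e2] at h
    nlinarith [mul_nonneg hθ0.le (sub_nonneg.2 hPs.1), mul_nonneg h1θ.le (sub_nonneg.2 hQs.1)]
  rw [div_le_iff₀ (by positivity)]
  have : (1 - θ) * (2 * (θ * (1 - θ) * ((P θ).1 - (Q θ).1) ^ 2)) ≤ (1 - θ) * (2 * ε ^ 2) := by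
    gcongr
  nlinarith [mul_nonneg (mul_nonneg (sq_nonneg (1 - θ)) (sq_nonneg ((P θ).1 - (Q θ).1)))
    (sub_nonneg.2 hθ.1)]

/-! ### Bellman points of subintervals and the splitting of intervals -/

/-- The Bellman point of `φ` on `[c, d]`. -/
def bellmanPoint (φ : ℝ → ℝ) (c d : ℝ) : ℝ × ℝ := (⨍ s in c..d, φ s, ⨍ s in c..d, φ s ^ 2)

lemma integral_sub_const_sq {φ : ℝ → ℝ} {c d : ℝ} (h1 : IntervalIntegrable φ volume c d)
    (h2 : IntervalIntegrable (fun s => φ s ^ 2) volume c d) (k : ℝ) :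
    ∫ s in c..d, (φ s - k) ^ 2 =
      (∫ s in c..d, φ s ^ 2) - 2 * k * (∫ s in c..d, φ s) + k ^ 2 * (d - c) := by
  have : ∀ s, (φ s - k) ^ 2 = φ s ^ 2 - 2 * k * φ s + k ^ 2 := fun s => by ring
  simp_rw [this]
  rw [intervalIntegral.integral_add (h2.sub (h1.const_mul _)) intervalIntegrable_const,
    intervalIntegral.integral_sub h2 (h1.const_mul _), intervalIntegral.integral_const_mul,
    intervalIntegral.integral_const, smul_eq_mul, mul_comm (d - c)]

lemma intervalIntegrable_sub_const_sq {φ : ℝ → ℝ} {c d : ℝ} (h1 : IntervalIntegrable φ volume c d)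
    (h2 : IntervalIntegrable (fun s => φ s ^ 2) volume c d) (k : ℝ) :
    IntervalIntegrable (fun s => (φ s - k) ^ 2) volume c d := by
  have : (fun s => (φ s - k) ^ 2) = fun s => φ s ^ 2 - 2 * k * φ s + k ^ 2 := by
    funext s; ring
  rw [this]
  exact (h2.sub (h1.const_mul _)).add intervalIntegrable_const

lemma meanSqOsc_eq {φ : ℝ → ℝ} {c d : ℝ} (hcd : c < d) (h1 : IntervalIntegrable φ volume c d)
    (h2 : IntervalIntegrable (fun s => φ s ^ 2) volume c d) :
    meanSqOsc φ c d = (bellmanPoint φ c d).2 - (bellmanPoint φ c d).1 ^ 2 := by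
  have h0 : d - c ≠ 0 := (sub_pos.2 hcd).ne'
  simp only [meanSqOsc, bellmanPoint, sq_abs]
  rw [interval_average_eq_div, integral_sub_const_sq h1 h2, interval_average_eq_div,
    interval_average_eq_div]
  field_simp
  ring

lemma meanSqOsc_nonneg (φ : ℝ → ℝ) {c d : ℝ} (hcd : c < d) : 0 ≤ meanSqOsc φ c d := by
  rw [meanSqOsc, interval_average_eq_div]
  exact div_nonneg (intervalIntegral.integral_nonneg hcd.le fun _ _ => sq_nonneg _)
    (sub_pos.2 hcd).le

lemma MemBMOBall.sq_intervalIntegrable {a b ε : ℝ} {φ : ℝ → ℝ} (h : MemBMOBall a b ε φ)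
    (hab : a < b) : IntervalIntegrable (fun s => φ s ^ 2) volume a b := by
  have h2 := (h.2 a b le_rfl hab le_rfl).1
  simp only [sq_abs] at h2
  have : (fun s => φ s ^ 2) = fun s => (φ s - ⨍ t in a..b, φ t) ^ 2
      + 2 * (⨍ t in a..b, φ t) * φ s - (⨍ t in a..b, φ t) ^ 2 := by
    funext s; ring
  rw [this]
  exact (h2.add (h.1.const_mul _)).sub intervalIntegrable_const

section Subinterval

variable {a b ε : ℝ} {φ : ℝ → ℝ}

lemma _root_.IntervalIntegrable.sub_interval {f : ℝ → ℝ} {a b c d : ℝ}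
    (h : IntervalIntegrable f volume a b) (hac : a ≤ c) (hcd : c ≤ d) (hdb : d ≤ b) :
    IntervalIntegrable f volume c d := by
  refine h.mono_set ?_
  rw [uIcc_of_le hcd, uIcc_of_le (hac.trans (hcd.trans hdb))]
  exact Icc_subset_Icc hac hdb

lemma MemBMOBall.bellmanPoint_mem_strip (h : MemBMOBall a b ε φ) (hab : a < b) {c d : ℝ}
    (hac : a ≤ c) (hcd : c < d) (hdb : d ≤ b) : bellmanPoint φ c d ∈ strip ε := by
  have e := meanSqOsc_eq hcd (h.1.sub_interval hac hcd.le hdb)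
    ((h.sq_intervalIntegrable hab).sub_interval hac hcd.le hdb)
  have e1 := meanSqOsc_nonneg φ hcd
  have e2 := (h.2 c d hac hcd hdb).2
  exact ⟨by linarith, by linarith⟩

lemma average_combo {f : ℝ → ℝ} {c m d θ : ℝ} (h : IntervalIntegrable f volume c d)
    (hcm : c < m) (hmd : m < d) (hθ : θ * (d - c) = m - c) :
    (⨍ s in c..d, f s) = θ * (⨍ s in c..m, f s) + (1 - θ) * ⨍ s in m..d, f s := by
  simp only [interval_average_eq_div]
  rw [← intervalIntegral.integral_add_adjacent_intervals (h.sub_interval le_rfl hcm.le hmd.le)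
    (h.sub_interval hcm.le hmd.le le_rfl)]
  have h1 : m - c ≠ 0 := (sub_pos.2 hcm).ne'
  have h2 : d - m ≠ 0 := (sub_pos.2 hmd).ne'
  have h3 : d - c ≠ 0 := (sub_pos.2 (hcm.trans hmd)).ne'
  have e1 : θ = (m - c) / (d - c) := by rw [← hθ]; field_simp
  have e2 : 1 - θ = (d - m) / (d - c) := by rw [e1]; field_simp; ring
  rw [e2, e1]
  field_simp

lemma continuousOn_average_right {f : ℝ → ℝ} {c d : ℝ} (hcd : c < d)
    (h : IntervalIntegrable f volume c d) :
    ContinuousOn (fun θ => ⨍ s in c..(c + θ * (d - c)), f s) (Icc (1 / 2) 1) := by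
  simp only [interval_average_eq_div]
  have hF := intervalIntegral.continuousOn_primitive_interval
    ((intervalIntegrable_iff_integrableOn_Icc_of_le hcd.le).1 h |>.mono_set
      (by rw [uIcc_of_le hcd.le]))
  rw [uIcc_of_le hcd.le] at hF
  refine ContinuousOn.div ?_ (by fun_prop) fun θ hθ => ?_
  · refine hF.comp (f := fun θ => c + θ * (d - c)) (by fun_prop) fun θ hθ => ⟨?_, ?_⟩
    · nlinarith [hθ.1]
    · nlinarith [hθ.2]
  · have : 0 < θ * (d - c) := mul_pos (by linarith [hθ.1]) (sub_pos.2 hcd)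
    linarith

lemma continuousOn_average_left {f : ℝ → ℝ} {c d : ℝ} (hcd : c < d)
    (h : IntervalIntegrable f volume c d) :
    ContinuousOn (fun θ => ⨍ s in (d - θ * (d - c))..d, f s) (Icc (1 / 2) 1) := by
  simp only [interval_average_eq_div]
  have hF := intervalIntegral.continuousOn_primitive_interval_left
    ((intervalIntegrable_iff_integrableOn_Icc_of_le hcd.le).1 h |>.mono_set
      (by rw [uIcc_of_le hcd.le]))
  rw [uIcc_of_le hcd.le] at hF
  refine ContinuousOn.div ?_ (by fun_prop) fun θ hθ => ?_
  · refine hF.comp (f := fun θ => d - θ * (d - c)) (by fun_prop) fun θ hθ => ⟨?_, ?_⟩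
    · nlinarith [hθ.2]
    · nlinarith [hθ.1]
  · have : 0 < θ * (d - c) := mul_pos (by linarith [hθ.1]) (sub_pos.2 hcd)
    linarith

/-- Every interval can be split so that the Bellman points of the two parts see each other in a
slightly larger strip, with control of the ratio of the lengths. -/
lemma MemBMOBall.exists_split (h : MemBMOBall a b ε φ) (hab : a < b) (hε : 0 < ε) {δ : ℝ}
    (hδ : ε < δ) :
    ∃ κ > 0, ∀ c d, a ≤ c → c < d → d ≤ b → ∃ m, c < m ∧ m < d ∧
      m - c ≤ (1 - κ) * (d - c) ∧ d - m ≤ (1 - κ) * (d - c) ∧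
      Visible δ (bellmanPoint φ c m) (bellmanPoint φ m d) := by
  have hκ : 0 < 2 * (δ ^ 2 - ε ^ 2) / ε ^ 2 := by
    have : 0 < δ ^ 2 - ε ^ 2 := by nlinarith
    positivity
  refine ⟨min (1 / 2) (2 * (δ ^ 2 - ε ^ 2) / ε ^ 2), by positivity, fun c d hac hcd hdb => ?_⟩
  have h1 := h.1.sub_interval hac hcd.le hdb
  have h2 := (h.sq_intervalIntegrable hab).sub_interval hac hcd.le hdb
  have hx := h.bellmanPoint_mem_strip hab hac hcd hdb
  have hdc := sub_pos.2 hcd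
  have hκ1 := min_le_left (1 / 2) (2 * (δ ^ 2 - ε ^ 2) / ε ^ 2)
  have hκ2 := min_le_right (1 / 2) (2 * (δ ^ 2 - ε ^ 2) / ε ^ 2)
  generalize min (1 / 2) (2 * (δ ^ 2 - ε ^ 2) / ε ^ 2) = κ at *
  have key : ∀ θ, 0 < θ → θ < 1 → ∀ m, m = c + θ * (d - c) → c < m ∧ m < d ∧
      bellmanPoint φ c m ∈ strip ε ∧ bellmanPoint φ m d ∈ strip ε ∧
      (bellmanPoint φ c d).1 = θ * (bellmanPoint φ c m).1 + (1 - θ) * (bellmanPoint φ m d).1 ∧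
      (bellmanPoint φ c d).2 = θ * (bellmanPoint φ c m).2 + (1 - θ) * (bellmanPoint φ m d).2 := by
    intro θ h0 hθ m hm
    have hcm : c < m := by nlinarith
    have hmd : m < d := by nlinarith
    exact ⟨hcm, hmd, h.bellmanPoint_mem_strip hab hac hcm (hmd.le.trans hdb),
      h.bellmanPoint_mem_strip hab (hac.trans hcm.le) hmd hdb,
      average_combo h1 hcm hmd (by rw [hm]; ring), average_combo h2 hcm hmd (by rw [hm]; ring)⟩
  -- The midpoint works if both halves are visible from the whole; otherwise an invisible half is
  -- enlarged until it is just visible.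
  by_cases hL : Visible δ (bellmanPoint φ c d) (bellmanPoint φ c (c + 1 / 2 * (d - c)))
  · by_cases hR : Visible δ (bellmanPoint φ c d) (bellmanPoint φ (d - 1 / 2 * (d - c)) d)
    · obtain ⟨hcm, hmd, hp, hq, e1, e2⟩ := key (1 / 2) (by norm_num) (by norm_num) _ rfl
      have hm : d - 1 / 2 * (d - c) = c + 1 / 2 * (d - c) := by ring
      rw [hm] at hR
      have hs := strip_mono hε.le hδ.le
      refine ⟨_, hcm, hmd, ?_, ?_, visible_of_visible_combo (hs hp) (hs hq) (hs hx)
        (by norm_num) (by norm_num) e1 e2 hL hR⟩ <;> nlinarith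
    · obtain ⟨θ, hθ0, hθ1, hθκ, hv⟩ := exists_visible_of_not_visible hε hδ
        (P := fun θ => bellmanPoint φ (d - θ * (d - c)) d)
        (Q := fun θ => bellmanPoint φ c (d - θ * (d - c))) hx
        ((continuousOn_average_left hcd h1).prodMk (continuousOn_average_left hcd h2))
        (by simp)
        (fun θ hθ => h.bellmanPoint_mem_strip hab (by nlinarith [hθ.2]) (by nlinarith [hθ.1]) hdb)
        (fun θ hθ => by
          obtain ⟨-, -, -, hq, e1, e2⟩ := key (1 - θ) (by linarith [hθ.2]) (by linarith [hθ.1])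
            (d - θ * (d - c)) (by ring)
          obtain ⟨-, -, hp, -, -, -⟩ := key (1 - θ) (by linarith [hθ.2]) (by linarith [hθ.1])
            (d - θ * (d - c)) (by ring)
          refine ⟨hp, ?_, ?_⟩ <;> linarith) hR
      obtain ⟨hcm, hmd, -⟩ := key (1 - θ) (by linarith) (by linarith)
            (d - θ * (d - c)) (by ring)
      refine ⟨_, hcm, hmd, ?_, ?_, hv.symm⟩ <;> nlinarith
  · obtain ⟨θ, hθ0, hθ1, hθκ, hv⟩ := exists_visible_of_not_visible hε hδ
        (P := fun θ => bellmanPoint φ c (c + θ * (d - c)))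
        (Q := fun θ => bellmanPoint φ (c + θ * (d - c)) d) hx
        ((continuousOn_average_right hcd h1).prodMk (continuousOn_average_right hcd h2))
        (by simp)
        (fun θ hθ => h.bellmanPoint_mem_strip hab hac (by nlinarith [hθ.1]) (by nlinarith [hθ.2]))
        (fun θ hθ => by
          obtain ⟨-, -, -, hq, e1, e2⟩ := key θ (by linarith [hθ.1]) hθ.2 _ rfl
          exact ⟨hq, e1, e2⟩) hL
    obtain ⟨hcm, hmd, -⟩ := key θ (by linarith) (by linarith) _ rfl
    refine ⟨_, hcm, hmd, ?_, ?_, hv⟩ <;> nlinarith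

/-! ### The Bellman induction -/

/-- The points all of whose short interval neighbourhoods in `[a, b]` have a Bellman point at which
`G` is at least `1`. -/
def goodSet (a b : ℝ) (φ : ℝ → ℝ) (G : ℝ × ℝ → ℝ) (η : ℝ) : Set ℝ :=
  {s | ∀ c d, a ≤ c → c < d → d ≤ b → d - c ≤ η → s ∈ Icc c d → 1 ≤ G (bellmanPoint φ c d)}

/-- Induction on the number of cuts that bring the length below `η`. A short interval meeting the
good set has `G ≥ 1`, one missing it contributes nothing; no continuity of `G` is needed. -/
lemma MemBMOBall.measure_goodSet_le (h : MemBMOBall a b ε φ) (hab : a < b) (hε : 0 < ε) {δ : ℝ}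
    (hδ : ε < δ) {G : ℝ × ℝ → ℝ} (hG : HasSupports δ G) (hG0 : ∀ x ∈ strip δ, 0 ≤ G x) {η : ℝ}
    (hη : 0 < η) :
    volume.real (goodSet a b φ G η ∩ Icc a b) ≤ (b - a) * G (bellmanPoint φ a b) := by
  obtain ⟨κ, hκ, hsplit⟩ := h.exists_split hab hε hδ
  have hs := strip_mono hε.le hδ.le
  have hfin : ∀ c d, volume (goodSet a b φ G η ∩ Icc c d) ≠ ⊤ := fun c d =>
    ((measure_mono inter_subset_right).trans_lt (by simp)).ne
  have hbase : ∀ c d, a ≤ c → c < d → d ≤ b → d - c ≤ η →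
      volume.real (goodSet a b φ G η ∩ Icc c d) ≤ (d - c) * G (bellmanPoint φ c d) := by
    intro c d hac hcd hdb hlen
    have hdc := sub_pos.2 hcd
    rcases (goodSet a b φ G η ∩ Icc c d).eq_empty_or_nonempty with he | ⟨s, hs1, hs2⟩
    · rw [he, measureReal_empty]
      exact mul_nonneg hdc.le (hG0 _ (hs (h.bellmanPoint_mem_strip hab hac hcd hdb)))
    · have h1 := hs1 c d hac hcd hdb hlen hs2
      calc volume.real (goodSet a b φ G η ∩ Icc c d) ≤ volume.real (Icc c d) :=
            measureReal_mono inter_subset_right (by simp)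
        _ = d - c := by rw [Real.volume_real_Icc_of_le hcd.le]
        _ ≤ _ := by nlinarith
  have hind : ∀ n : ℕ, ∀ c d, a ≤ c → c < d → d ≤ b → (1 - κ) ^ n * (d - c) ≤ η →
      volume.real (goodSet a b φ G η ∩ Icc c d) ≤ (d - c) * G (bellmanPoint φ c d) := by
    intro n
    induction n with
    | zero => intro c d hac hcd hdb hlen; exact hbase c d hac hcd hdb (by simpa using hlen)
    | succ n ih =>
      intro c d hac hcd hdb hlen
      obtain ⟨m, hcm, hmd, hl1, hl2, hv⟩ := hsplit c d hac hcd hdb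
      have hκ1 : 0 ≤ 1 - κ := by
        by_contra! hneg
        nlinarith [sub_pos.2 hcd, sub_pos.2 hcm]
      have hstep : ∀ l, l ≤ (1 - κ) * (d - c) → (1 - κ) ^ n * l ≤ η := fun l hl =>
        (mul_le_mul_of_nonneg_left hl (pow_nonneg hκ1 n)).trans (by rw [pow_succ] at hlen; linarith)
      have i1 := ih c m hac hcm (hmd.le.trans hdb) (hstep _ hl1)
      have i2 := ih m d (hac.trans hcm.le) hmd hdb (hstep _ hl2)
      have hdc := sub_pos.2 hcd
      have hconc := hG.concave (θ := (m - c) / (d - c)) (x := bellmanPoint φ c d)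
        (hs (h.bellmanPoint_mem_strip hab hac hcm (hmd.le.trans hdb)))
        (hs (h.bellmanPoint_mem_strip hab (hac.trans hcm.le) hmd hdb)) hv
        (div_nonneg (sub_pos.2 hcm).le hdc.le) ((div_le_one hdc).2 (by linarith))
        (average_combo (h.1.sub_interval hac hcd.le hdb) hcm hmd (by field_simp))
        (average_combo ((h.sq_intervalIntegrable hab).sub_interval hac hcd.le hdb) hcm hmd
          (by field_simp))
      have hsub : goodSet a b φ G η ∩ Icc c d ⊆
          (goodSet a b φ G η ∩ Icc c m) ∪ (goodSet a b φ G η ∩ Icc m d) := by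
        rw [← inter_union_distrib_left, Icc_union_Icc_eq_Icc hcm.le hmd.le]
      calc volume.real (goodSet a b φ G η ∩ Icc c d)
          ≤ volume.real (goodSet a b φ G η ∩ Icc c m)
            + volume.real (goodSet a b φ G η ∩ Icc m d) :=
            (measureReal_mono hsub (measure_union_lt_top (hfin _ _).lt_top
              (hfin _ _).lt_top).ne).trans (measureReal_union_le _ _)
        _ ≤ (m - c) * G (bellmanPoint φ c m) + (d - m) * G (bellmanPoint φ m d) := by gcongr
        _ = (d - c) * ((m - c) / (d - c) * G (bellmanPoint φ c m)
            + (1 - (m - c) / (d - c)) * G (bellmanPoint φ m d)) := by field_simp; ring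
        _ ≤ _ := by gcongr
  have hκ1 : κ < 1 := by
    obtain ⟨m, hcm, hmd, hl1, hl2, hv⟩ := hsplit a b le_rfl hab le_rfl
    by_contra! hneg
    nlinarith [sub_pos.2 hab, sub_pos.2 hcm]
  obtain ⟨n, hn⟩ := exists_pow_lt_of_lt_one (div_pos hη (sub_pos.2 hab))
    (show 1 - κ < 1 by linarith)
  exact hind n a b le_rfl hab le_rfl ((lt_div_iff₀ (sub_pos.2 hab)).1 hn).le

end Subinterval

/-- Brings interval averages into the form of the differentiation theorem; the cutoff is there
because `f` is controlled on `[a, b]` only. -/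
lemma setAverage_closedBall_indicator {f : ℝ → ℝ} {a b c d : ℝ} (hac : a ≤ c) (hcd : c < d)
    (hdb : d ≤ b) :
    (⨍ y in Metric.closedBall ((c + d) / 2) ((d - c) / 2), (Icc a b).indicator f y)
      = ⨍ s in c..d, f s := by
  have hball : Metric.closedBall ((c + d) / 2) ((d - c) / 2) = Icc c d := by
    rw [Real.closedBall_eq_Icc]
    congr 1 <;> ring
  rw [hball, setAverage_eq, interval_average_eq, integral_Icc_eq_integral_Ioc,
    ← intervalIntegral.integral_of_le hcd.le, Real.volume_real_Icc_of_le hcd.le]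
  congr 1
  refine intervalIntegral.integral_congr fun s hs => ?_
  rw [uIcc_of_le hcd.le] at hs
  exact indicator_of_mem (show s ∈ Icc a b from ⟨hac.trans hs.1, hs.2.trans hdb⟩) _

lemma locallyIntegrable_indicator_Icc {f : ℝ → ℝ} {a b : ℝ} (hab : a ≤ b)
    (hf : IntervalIntegrable f volume a b) : LocallyIntegrable ((Icc a b).indicator f) volume :=
  ((integrable_indicator_iff measurableSet_Icc).2
    ((intervalIntegrable_iff_integrableOn_Icc_of_le hab).1 hf)).locallyIntegrable

/-- If every scale had a bad interval containing `s`, the Bellman points of these not necessarily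
centred intervals would tend to `(φ s, φ s ^ 2)` for almost every `s`, and `G ≥ 1` near that point.
-/
lemma ae_mem_goodSet {a b δ lam : ℝ} {φ : ℝ → ℝ} {G : ℝ × ℝ → ℝ} (hab : a < b)
    (h1 : IntervalIntegrable φ volume a b)
    (h2 : IntervalIntegrable (fun s => φ s ^ 2) volume a b)
    (hst : ∀ c d, a ≤ c → c < d → d ≤ b → bellmanPoint φ c d ∈ strip δ)
    (hG : ∀ u, lam ≤ |u| → ∀ᶠ x in 𝓝 (u, u ^ 2), x ∈ strip δ → 1 ≤ G x) :
    ∀ᵐ s, s ∈ Icc a b → lam ≤ |φ s| → ∃ n : ℕ, s ∈ goodSet a b φ G (1 / (n + 1)) := by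
  filter_upwards [IsUnifLocDoublingMeasure.ae_tendsto_average volume
      (locallyIntegrable_indicator_Icc hab.le h1) 1,
    IsUnifLocDoublingMeasure.ae_tendsto_average volume
      (locallyIntegrable_indicator_Icc hab.le h2) 1] with s hs1 hs2 hsJ hlam
  by_contra! hno
  simp only [goodSet, mem_ofPred_eq, not_forall, not_le] at hno
  choose c d hac hcd hdb hlen hmem hlt using hno
  have hlim : Tendsto (fun n => (d n - c n) / 2) atTop (𝓝[>] 0) := by
    refine tendsto_nhdsWithin_iff.2 ⟨?_, Eventually.of_forall fun n => ?_⟩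
    · refine squeeze_zero (fun n => ?_) (fun n => ?_) tendsto_one_div_add_atTop_nhds_zero_nat
      · linarith [hcd n]
      · linarith [hcd n, hlen n]
    · have := hcd n
      simp only [mem_Ioi]; linarith
  have hball : ∀ᶠ n in atTop,
      s ∈ Metric.closedBall ((c n + d n) / 2) (1 * ((d n - c n) / 2)) := by
    refine Eventually.of_forall fun n => ?_
    rw [one_mul, Real.closedBall_eq_Icc]
    exact ⟨by linarith [(hmem n).1], by linarith [(hmem n).2]⟩
  have t1 := hs1 _ _ hlim hball
  have t2 := hs2 _ _ hlim hball
  rw [indicator_of_mem hsJ] at t1 t2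
  have t := t1.prodMk_nhds t2
  obtain ⟨n, hn⟩ := (t.eventually (hG (φ s) hlam)).exists
  simp only [setAverage_closedBall_indicator (hac n) (hcd n) (hdb n)] at hn
  exact (hlt n).not_ge (hn (hst _ _ (hac n) (hcd n) (hdb n)))

/-- The Bellman induction: a locally concave function on a slightly larger strip that is at
least `1` near the points of the lower boundary with `lam ≤ |x₁|` is a majorant. -/
theorem MemBMOBall.measure_le {a b ε δ lam : ℝ} {φ : ℝ → ℝ} (h : MemBMOBall a b ε φ) (hab : a < b)
    (hε : 0 < ε) (hδ : ε < δ) {G : ℝ × ℝ → ℝ} (hG : HasSupports δ G)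
    (hG0 : ∀ x ∈ strip δ, 0 ≤ G x)
    (hG1 : ∀ u, lam ≤ |u| → ∀ᶠ x in 𝓝 (u, u ^ 2), x ∈ strip δ → 1 ≤ G x) :
    volume.real {s : ℝ | s ∈ Icc a b ∧ lam ≤ |φ s|} ≤ (b - a) * G (bellmanPoint φ a b) := by
  have hs := strip_mono hε.le hδ.le
  have hst : ∀ c d, a ≤ c → c < d → d ≤ b → bellmanPoint φ c d ∈ strip δ :=
    fun c d hac hcd hdb => hs (h.bellmanPoint_mem_strip hab hac hcd hdb)
  have hae := ae_mem_goodSet hab h.1 (h.sq_intervalIntegrable hab) hst hG1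
  have hbound : 0 ≤ (b - a) * G (bellmanPoint φ a b) :=
    mul_nonneg (sub_pos.2 hab).le (hG0 _ (hst a b le_rfl hab le_rfl))
  have hmono : Monotone fun n : ℕ => goodSet a b φ G (1 / (n + 1)) ∩ Icc a b := by
    intro n k hnk s hs
    refine ⟨fun c d hac hcd hdb hlen hmem => hs.1 c d hac hcd hdb (hlen.trans ?_) hmem, hs.2⟩
    exact one_div_le_one_div_of_le (by positivity) (by gcongr)
  refine ENNReal.toReal_le_of_le_ofReal hbound ?_
  calc volume {s : ℝ | s ∈ Icc a b ∧ lam ≤ |φ s|}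
      ≤ volume (⋃ n : ℕ, goodSet a b φ G (1 / (n + 1)) ∩ Icc a b) := by
        refine measure_mono_ae ?_
        filter_upwards [hae] with s hs hmem
        obtain ⟨n, hn⟩ := hs hmem.1 hmem.2
        exact mem_iUnion.2 ⟨n, hn, hmem.1⟩
    _ = ⨆ n : ℕ, volume (goodSet a b φ G (1 / (n + 1)) ∩ Icc a b) := hmono.measure_iUnion
    _ ≤ _ := by
        refine iSup_le fun n => ?_
        rw [← ENNReal.ofReal_toReal (a := volume (goodSet a b φ G (1 / (n + 1)) ∩ Icc a b))]
        · exact ENNReal.ofReal_le_ofReal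
            (h.measure_goodSet_le hab hε hδ hG hG0 (by positivity))
        · exact ((measure_mono inter_subset_right).trans_lt (by simp)).ne

/-! ### The locally concave majorant -/

/-- The affine function that vanishes at `(u, u ^ 2)` and is the tangent plane along the tangent
line to the upper boundary of `strip δ` starting there; `m = lam - c`. -/
def tangentFn (δ m c u : ℝ) (x : ℝ × ℝ) : ℝ :=
  Real.exp ((u - c) / δ) / m ^ 2 * (x.2 - 2 * u * x.1 + u ^ 2)

/-- A locally concave majorant on `strip δ`; the parameter `c` is `max 0 (lam - 2 * δ)`. -/
def majorant (δ lam c : ℝ) (x : ℝ × ℝ) : ℝ :=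
  if |x.1| - radius δ x < lam - δ then
    tangentFn δ (lam - c) c (min (max (|x.1| + radius δ x - δ) 0) c) (|x.1|, x.2)
  else if |x.1| + radius δ x ≤ lam + δ then
    1 - (lam - c - δ) / (2 * δ * (lam - c) ^ 2) *
      (x.2 - 2 * (lam + δ) * |x.1| + lam ^ 2 + 2 * δ * lam)
  else 1

section Tangent

/-- The exponential weight of the family is chosen for this factorization: for fixed `x` the value
decreases in `u` between `p - δ` and `s - δ` and increases beyond, so `u = s - δ` is the minimizer.
-/
lemma hasDerivAt_exp_mul_quadratic {δ : ℝ} (hδ : δ ≠ 0) (p s u : ℝ) :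
    HasDerivAt (fun u => Real.exp (u / δ) * ((s - u) * (p - u) + δ ^ 2))
      (Real.exp (u / δ) / δ * ((u + δ - s) * (u + δ - p))) u := by
  have h1 : HasDerivAt (fun u => Real.exp (u / δ)) (Real.exp (u / δ) * (1 / δ)) u :=
    ((hasDerivAt_id u).div_const δ).exp
  have h2 : HasDerivAt (fun u => (s - u) * (p - u) + δ ^ 2)
      (-1 * (p - u) + (s - u) * -1) u :=
    (((hasDerivAt_id u).const_sub s).mul ((hasDerivAt_id u).const_sub p)).add_const _
  refine (h1.mul h2).congr_deriv ?_
  field_simp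
  ring

lemma exp_mul_quadratic_antitone {δ p s u v : ℝ} (hδ : 0 < δ) (h1 : p - δ ≤ u) (h2 : u ≤ v)
    (h3 : v ≤ s - δ) :
    Real.exp (v / δ) * ((s - v) * (p - v) + δ ^ 2) ≤
      Real.exp (u / δ) * ((s - u) * (p - u) + δ ^ 2) := by
  refine antitoneOn_of_deriv_nonpos (convex_Icc (p - δ) (s - δ))
    (f := fun u => Real.exp (u / δ) * ((s - u) * (p - u) + δ ^ 2)) (by fun_prop) ?_ ?_
    ⟨h1, h2.trans h3⟩ ⟨h1.trans h2, h3⟩ h2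
  · exact fun w _ => (hasDerivAt_exp_mul_quadratic hδ.ne' p s w).differentiableAt.differentiableWithinAt
  · intro w hw
    rw [interior_Icc] at hw
    rw [(hasDerivAt_exp_mul_quadratic hδ.ne' p s w).deriv]
    exact mul_nonpos_of_nonneg_of_nonpos (by positivity)
      (mul_nonpos_of_nonpos_of_nonneg (by linarith [hw.2]) (by linarith [hw.1]))

lemma exp_mul_quadratic_monotone {δ p s u v : ℝ} (hδ : 0 < δ) (hps : p ≤ s) (h1 : s - δ ≤ u)
    (h2 : u ≤ v) :
    Real.exp (u / δ) * ((s - u) * (p - u) + δ ^ 2) ≤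
      Real.exp (v / δ) * ((s - v) * (p - v) + δ ^ 2) := by
  refine monotoneOn_of_deriv_nonneg (convex_Ici (s - δ))
    (f := fun u => Real.exp (u / δ) * ((s - u) * (p - u) + δ ^ 2)) (by fun_prop) ?_ ?_
    h1 (h1.trans h2) h2
  · exact fun w _ => (hasDerivAt_exp_mul_quadratic hδ.ne' p s w).differentiableAt.differentiableWithinAt
  · intro w hw
    rw [interior_Ici] at hw
    have hw := mem_Ioi.1 hw
    rw [(hasDerivAt_exp_mul_quadratic hδ.ne' p s w).deriv]
    exact mul_nonneg (by positivity) (mul_nonneg (by linarith) (by linarith))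

/-- The minimizer `s - δ`, clamped to `[0, c]`, beats every `u` in `[0, c]` to the right of the
other critical point `p - δ`. -/
lemma exp_mul_quadratic_clamp_le {δ p s c u : ℝ} (hδ : 0 < δ) (hps : p ≤ s) (hu0 : 0 ≤ u)
    (huc : u ≤ c) (hp : p ≤ u + δ) :
    Real.exp (min (max (s - δ) 0) c / δ) *
        ((s - min (max (s - δ) 0) c) * (p - min (max (s - δ) 0) c) + δ ^ 2) ≤
      Real.exp (u / δ) * ((s - u) * (p - u) + δ ^ 2) := by
  rcases le_total (s - δ) 0 with h | h
  · rw [max_eq_right h, min_eq_left (hu0.trans huc)]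
    exact exp_mul_quadratic_monotone hδ hps h hu0
  · rw [max_eq_left h]
    rcases le_total (s - δ) c with h' | h'
    · rw [min_eq_left h']
      rcases le_total u (s - δ) with h2 | h2
      · exact exp_mul_quadratic_antitone hδ (by linarith) h2 le_rfl
      · exact exp_mul_quadratic_monotone hδ hps le_rfl h2
    · rw [min_eq_right h']
      exact exp_mul_quadratic_antitone hδ (by linarith) huc h'

end Tangent

/-- The relations between the parameters of `majorant`. -/
structure Admissible (δ lam c : ℝ) : Prop where
  pos : 0 < δ
  lt : δ < lam
  nonneg : 0 ≤ c
  lt_sub : δ < lam - c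
  sub_le : lam - c ≤ 2 * δ
  eq_of_pos : 0 < c → lam - c = 2 * δ

lemma admissible_max {δ lam : ℝ} (hδ : 0 < δ) (h : δ < lam) :
    Admissible δ lam (max 0 (lam - 2 * δ)) := by
  rcases le_total (lam - 2 * δ) 0 with h' | h'
  · rw [max_eq_left h']
    exact ⟨hδ, h, le_rfl, by linarith, by linarith, fun h => absurd h (lt_irrefl _)⟩
  · rw [max_eq_right h']
    exact ⟨hδ, h, h', by linarith, by linarith, fun _ => by ring⟩

section Majorant

variable {δ lam c : ℝ}

lemma snd_eq_mul_add {x : ℝ × ℝ} (hx : x ∈ strip δ) :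
    x.2 = (|x.1| + radius δ x) * (|x.1| - radius δ x) + δ ^ 2 := by
  have h := radius_sq hx
  have h2 := sq_abs x.1
  linear_combination h - h2

lemma tangentFn_eq {x : ℝ × ℝ} (hx : x ∈ strip δ) (m c u : ℝ) :
    tangentFn δ m c u (|x.1|, x.2) = Real.exp (-c / δ) / m ^ 2 * (Real.exp (u / δ) *
      ((|x.1| + radius δ x - u) * (|x.1| - radius δ x - u) + δ ^ 2)) := by
  unfold tangentFn
  rw [show (u - c) / δ = -c / δ + u / δ by ring, Real.exp_add]
  linear_combination (Real.exp (-c / δ) * Real.exp (u / δ) / m ^ 2) * snd_eq_mul_add hx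

lemma tangentFn_self (m c : ℝ) (x : ℝ × ℝ) :
    tangentFn δ m c c x = (x.2 - 2 * c * x.1 + c ^ 2) / m ^ 2 := by
  simp [tangentFn]; ring

lemma tangentFn_nonneg (m c u : ℝ) {x : ℝ × ℝ} (hx : x.1 ^ 2 ≤ x.2) :
    0 ≤ tangentFn δ m c u x :=
  mul_nonneg (by positivity) (by nlinarith [sq_nonneg (x.1 - u)])

lemma tangentFn_clamp_le (hδ : 0 < δ) {x : ℝ × ℝ} (hx : x ∈ strip δ) {m u : ℝ} (hu0 : 0 ≤ u)
    (huc : u ≤ c) (hp : |x.1| - radius δ x ≤ u + δ) :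
    tangentFn δ m c (min (max (|x.1| + radius δ x - δ) 0) c) (|x.1|, x.2) ≤
      tangentFn δ m c u (|x.1|, x.2) := by
  rw [tangentFn_eq hx, tangentFn_eq hx]
  have := radius_nonneg δ x
  exact mul_le_mul_of_nonneg_left
    (exp_mul_quadratic_clamp_le hδ (by linarith) hu0 huc hp) (by positivity)

lemma tangentFn_abs_le {m u : ℝ} (hu : 0 ≤ u) (x : ℝ × ℝ) :
    tangentFn δ m c u (|x.1|, x.2) ≤ tangentFn δ m c u x := by
  unfold tangentFn
  refine mul_le_mul_of_nonneg_left ?_ (by positivity)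
  have := mul_le_mul_of_nonneg_left (le_abs_self x.1) hu
  simp only; linarith

/-- The middle piece agrees with the member `u = c` of the family along the tangent at abscissa `lam
- δ`, and by `middle_eq'` with `1` along the tangent at `lam + δ`. Off these lines the signs of the
factors decide which is larger. -/
lemma Admissible.middle_eq (h : Admissible δ lam c) {x : ℝ × ℝ} (hx : x ∈ strip δ) :
    1 - (lam - c - δ) / (2 * δ * (lam - c) ^ 2) *
        (x.2 - 2 * (lam + δ) * |x.1| + lam ^ 2 + 2 * δ * lam) =
      tangentFn δ (lam - c) c c (|x.1|, x.2) - (lam - c + δ) / (2 * δ * (lam - c) ^ 2) *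
        ((|x.1| + radius δ x - (lam - δ)) * (|x.1| - radius δ x - (lam - δ))) := by
  have h1 : lam - c ≠ 0 := by linarith [h.lt_sub, h.pos]
  have h2 := h.pos.ne'
  rw [tangentFn_self, snd_eq_mul_add hx]
  obtain ⟨m, rfl⟩ : ∃ m, lam = m + c := ⟨lam - c, by ring⟩
  simp only [add_sub_cancel_right] at *
  field_simp
  ring

lemma middle_eq' {x : ℝ × ℝ} (hx : x ∈ strip δ) :
    x.2 - 2 * (lam + δ) * |x.1| + lam ^ 2 + 2 * δ * lam =
      (|x.1| + radius δ x - (lam + δ)) * (|x.1| - radius δ x - (lam + δ)) := by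
  rw [snd_eq_mul_add hx]; ring

/-- The member `u = c` dominates every piece: by minimality on the left, by the sign of the product
in the middle, and on the right because there `lam ≤ |x.1|`. -/
lemma Admissible.majorant_le (h : Admissible δ lam c) {x : ℝ × ℝ} (hx : x ∈ strip δ) :
    majorant δ lam c x ≤ tangentFn δ (lam - c) c c (|x.1|, x.2) := by
  have hr := radius_nonneg δ x
  have hr' := radius_le h.pos.le hx
  have hm : 0 < lam - c := h.pos.trans h.lt_sub
  unfold majorant
  split_ifs with h1 h2
  · exact tangentFn_clamp_le h.pos hx h.nonneg le_rfl (by linarith [h.sub_le])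
  · rw [h.middle_eq hx]
    have : 0 ≤ (lam - c + δ) / (2 * δ * (lam - c) ^ 2) :=
      div_nonneg (by linarith [h.pos]) (by have := h.pos; positivity)
    have := mul_nonneg this (mul_nonneg (show 0 ≤ |x.1| + radius δ x - (lam - δ) by linarith)
      (show 0 ≤ |x.1| - radius δ x - (lam - δ) by linarith))
    linarith
  · rw [tangentFn_self, le_div_iff₀ (by positivity), one_mul]
    have h3 : lam - c ≤ |x.1| - c := by linarith
    have h4 : |x.1| ^ 2 ≤ x.2 := by rw [sq_abs]; exact hx.1
    simp only
    nlinarith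

lemma Admissible.majorant_nonneg (h : Admissible δ lam c) {x : ℝ × ℝ} (hx : x ∈ strip δ) :
    0 ≤ majorant δ lam c x := by
  have hr := radius_nonneg δ x
  have hr' := radius_le h.pos.le hx
  have hm : 0 < lam - c := h.pos.trans h.lt_sub
  have hδ := h.pos
  unfold majorant
  split_ifs with h1 h2
  · exact tangentFn_nonneg _ _ _ (by simpa using hx.1)
  · rw [middle_eq' hx, sub_nonneg, div_mul_eq_mul_div, div_le_one (by positivity)]
    have e1 : 0 ≤ lam + δ - (|x.1| + radius δ x) := by linarith
    have e2 : lam + δ - (|x.1| - radius δ x) ≤ 2 * δ := by linarith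
    have e3 : (lam + δ - (|x.1| + radius δ x)) * (lam + δ - (|x.1| - radius δ x))
        ≤ (2 * δ) * (2 * δ) := by
      apply mul_le_mul <;> linarith
    have e4 : (lam - c - δ) * ((lam + δ - (|x.1| + radius δ x)) *
        (lam + δ - (|x.1| - radius δ x))) ≤ (lam - c - δ) * ((2 * δ) * (2 * δ)) :=
      mul_le_mul_of_nonneg_left e3 (by linarith [h.lt_sub])
    nlinarith [mul_nonneg hδ.le (sq_nonneg (lam - c - δ)), mul_nonneg hδ.le (sq_nonneg δ)]
  · exact zero_le_one

lemma Admissible.majorant_le_one (h : Admissible δ lam c) {x : ℝ × ℝ} (hx : x ∈ strip δ) :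
    majorant δ lam c x ≤ 1 := by
  have hr := radius_nonneg δ x
  have hr' := radius_le h.pos.le hx
  have hm : 0 < lam - c := h.pos.trans h.lt_sub
  have hδ := h.pos
  have hN := h.majorant_le hx
  have hc := h.nonneg
  have hy := abs_nonneg x.1
  by_cases h1 : |x.1| - radius δ x < lam - δ
  -- For `s < c` one has `c > 0`, hence `lam - c = 2 * δ`, and the quadratic factor at the clamped
  -- `u` is at most `2 * δ ^ 2`. Otherwise the member `u = c` is already at most `1`.
  · by_cases h2 : |x.1| + radius δ x < c
    · have hmc := h.eq_of_pos (by linarith)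
      unfold majorant
      rw [if_pos h1]
      have hexp : ∀ u ≤ c, Real.exp ((u - c) / δ) ≤ 1 := fun u hu =>
        Real.exp_le_one_iff.2 (div_nonpos_of_nonpos_of_nonneg (by linarith) hδ.le)
      have hfin : ∀ u ≤ c, (|x.1| + radius δ x - u) * (|x.1| - radius δ x - u) + δ ^ 2
          ≤ 2 * δ ^ 2 → tangentFn δ (lam - c) c u (|x.1|, x.2) ≤ 1 := by
        intro u hu hle
        have e : x.2 - 2 * u * |x.1| + u ^ 2 =
          (|x.1| + radius δ x - u) * (|x.1| - radius δ x - u) + δ ^ 2 := by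
          rw [snd_eq_mul_add hx]; ring
        unfold tangentFn
        simp only
        rw [e, div_mul_eq_mul_div, div_le_one (by positivity), hmc]
        have h0 : 0 ≤ (|x.1| + radius δ x - u) * (|x.1| - radius δ x - u) + δ ^ 2 := by
          rw [← e]
          have := hx.1
          nlinarith [sq_nonneg (|x.1| - u), sq_abs x.1]
        nlinarith [mul_le_mul_of_nonneg_right (hexp u hu) h0]
      rcases le_total (|x.1| + radius δ x - δ) 0 with h3 | h3
      · rw [max_eq_right h3, min_eq_left hc]
        exact hfin 0 hc (by nlinarith)
      · rw [max_eq_left h3, min_eq_left (by linarith)]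
        exact hfin _ (by linarith) (by nlinarith)
    · refine hN.trans ?_
      rw [tangentFn_self, div_le_one (by positivity)]
      simp only
      rw [snd_eq_mul_add hx]
      push Not at h2
      -- With `m = lam - c` this gives `(s - c) * (p - c) + δ ^ 2 ≤ (m + δ) * (m - δ) + δ ^ 2 = m ^
      -- 2`.
      have e1 : |x.1| - radius δ x - c ≤ lam - c - δ := by linarith
      have e2 : |x.1| + radius δ x - c ≤ lam - c + δ := by linarith
      have e3 := mul_le_mul_of_nonneg_left e1 (sub_nonneg.2 h2)
      have e4 := mul_le_mul_of_nonneg_right e2 (show 0 ≤ lam - c - δ by linarith [h.lt_sub])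
      nlinarith
  · unfold majorant
    rw [if_neg h1]
    split_ifs with h2
    · rw [middle_eq' hx]
      have h3 : 0 ≤ (lam - c - δ) / (2 * δ * (lam - c) ^ 2) :=
        div_nonneg (by linarith [h.lt_sub]) (by positivity)
      have := mul_nonneg h3 (mul_nonneg_of_nonpos_of_nonpos
        (show |x.1| + radius δ x - (lam + δ) ≤ 0 by linarith)
        (show |x.1| - radius δ x - (lam + δ) ≤ 0 by linarith))
      linarith
    · exact le_rfl

end Majorant

/-! ### Affine supports of the majorant -/

section Supports

variable {δ lam c : ℝ}

lemma Visible.sub_le {x y : ℝ × ℝ} (h : Visible δ x y) :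
    y.1 - radius δ y ≤ x.1 + radius δ x := by
  unfold Visible at h
  linarith [neg_le_of_abs_le h]

lemma snd_sub_tangent {x : ℝ × ℝ} (hx : x ∈ strip δ) (w : ℝ) :
    x.2 - 2 * w * x.1 + w ^ 2 - δ ^ 2 = (x.1 + radius δ x - w) * (x.1 - radius δ x - w) := by
  linear_combination radius_sq hx

lemma Admissible.middle_eq_sub (h : Admissible δ lam c) (y t : ℝ) :
    1 - (lam - c - δ) / (2 * δ * (lam - c) ^ 2) *
        (t - 2 * (lam + δ) * y + lam ^ 2 + 2 * δ * lam) =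
      (t - 2 * c * y + c ^ 2) / (lam - c) ^ 2 - (lam - c + δ) / (2 * δ * (lam - c) ^ 2) *
        (t - 2 * (lam - δ) * y + (lam - δ) ^ 2 - δ ^ 2) := by
  have h1 : lam - c ≠ 0 := by linarith [h.lt_sub, h.pos]
  have h2 := h.pos.ne'
  obtain ⟨m, rfl⟩ : ∃ m, lam = m + c := ⟨lam - c, by ring⟩
  simp only [add_sub_cancel_right] at *
  field_simp
  ring

lemma exists_support_of_affine {G H : ℝ × ℝ → ℝ} {z : ℝ × ℝ}
    (hH : ∃ A B C : ℝ, ∀ x : ℝ × ℝ, H x = A * x.1 + B * x.2 + C) (hz : H z = G z)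
    (hle : ∀ q ∈ strip δ, Visible δ z q → G q ≤ H q) :
    ∃ A B C : ℝ, A * z.1 + B * z.2 + C = G z ∧
      ∀ q ∈ strip δ, Visible δ z q → G q ≤ A * q.1 + B * q.2 + C := by
  obtain ⟨A, B, C, hH⟩ := hH
  exact ⟨A, B, C, by rw [← hH, hz], fun q hq hv => by rw [← hH]; exact hle q hq hv⟩

/-- The affine piece active at `z` is the support. Visibility of `q` says that `p` at each of the
two points is at most `s` at the other, and this fixes the signs in the comparison of pieces. -/
lemma Admissible.exists_support (h : Admissible δ lam c) {z : ℝ × ℝ} (hz : z ∈ strip δ)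
    (hz1 : 0 ≤ z.1) : ∃ A B C : ℝ, A * z.1 + B * z.2 + C = majorant δ lam c z ∧
    ∀ q ∈ strip δ, Visible δ z q → majorant δ lam c q ≤ A * q.1 + B * q.2 + C := by
  have hδ := h.pos
  have hm : 0 < lam - c := h.pos.trans h.lt_sub
  have hrz := radius_nonneg δ z
  have hrz' := radius_le hδ.le hz
  by_cases h1 : |z.1| - radius δ z < lam - δ
  · generalize hu : min (max (|z.1| + radius δ z - δ) 0) c = u
    have haff : ∀ x : ℝ × ℝ, tangentFn δ (lam - c) c u x =
        (-2 * u * (Real.exp ((u - c) / δ) / (lam - c) ^ 2)) * x.1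
        + (Real.exp ((u - c) / δ) / (lam - c) ^ 2) * x.2
        + u ^ 2 * (Real.exp ((u - c) / δ) / (lam - c) ^ 2) := fun x => by
      unfold tangentFn; ring
    have hu0 : 0 ≤ u := by rw [← hu]; exact le_min (le_max_right _ _) h.nonneg
    have huc : u ≤ c := by rw [← hu]; exact min_le_right _ _
    refine exists_support_of_affine ⟨_, _, _, haff⟩ ?_ fun q hq hv => ?_
    rotate_left
    · refine le_trans ?_ (tangentFn_abs_le hu0 q)
      rcases huc.eq_or_lt with he | hlt
      · rw [he]
        exact h.majorant_le hq
      · have hmax : max (|z.1| + radius δ z - δ) 0 = u := by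
          rcases min_choice (max (|z.1| + radius δ z - δ) 0) c with e | e <;> rw [hu] at e
          · exact e.symm
          · exact absurd e hlt.ne
        have hs : z.1 + radius δ z - δ ≤ u := by
          rw [← hmax, abs_of_nonneg hz1]; exact le_max_left _ _
        -- For negative `q.1` the other half of visibility bounds `-q.1 - radius δ q` by `radius δ z
        -- - z.1`, and `z.1 ≥ 0` finishes.
        have hp : |q.1| - radius δ q ≤ u + δ := by
          rcases abs_cases q.1 with ⟨e, -⟩ | ⟨e, -⟩ <;> rw [e]
          · linarith [hv.sub_le]
          · linarith [hv.symm.sub_le]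
        have hleft : |q.1| - radius δ q < lam - δ := by
          linarith [h.eq_of_pos (by linarith)]
        unfold majorant
        rw [if_pos hleft]
        exact tangentFn_clamp_le hδ hq hu0 huc hp
    · unfold majorant
      rw [if_pos h1, hu, abs_of_nonneg hz1]
  · by_cases h2 : |z.1| + radius δ z ≤ lam + δ
    · have hk' : 0 ≤ (lam - c - δ) / (2 * δ * (lam - c) ^ 2) :=
        div_nonneg (by linarith [h.lt_sub]) (by positivity)
      have hk : 0 ≤ (lam - c + δ) / (2 * δ * (lam - c) ^ 2) :=
        div_nonneg (by linarith) (by positivity)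
      have haff : ∀ x : ℝ × ℝ, 1 - (lam - c - δ) / (2 * δ * (lam - c) ^ 2) *
          (x.2 - 2 * (lam + δ) * x.1 + lam ^ 2 + 2 * δ * lam) =
          ((lam - c - δ) / (2 * δ * (lam - c) ^ 2) * (2 * (lam + δ))) * x.1
          + (-((lam - c - δ) / (2 * δ * (lam - c) ^ 2))) * x.2
          + (1 - (lam - c - δ) / (2 * δ * (lam - c) ^ 2) * (lam ^ 2 + 2 * δ * lam)) :=
        fun x => by ring
      refine exists_support_of_affine (H := fun x : ℝ × ℝ => 1 - (lam - c - δ) /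
          (2 * δ * (lam - c) ^ 2) * (x.2 - 2 * (lam + δ) * x.1 + lam ^ 2 + 2 * δ * lam))
        ⟨_, _, _, haff⟩ ?_ fun q hq hv => ?_
      rotate_left
      · rw [abs_of_nonneg hz1] at h1 h2
        have hv1 := hv.sub_le
        have hv2 := hv.symm.sub_le
        have hrq := radius_nonneg δ q
        -- Visibility gives `s ≥ lam - δ` at `q`, so beyond the tangent at `lam - δ` the product in
        -- `middle_eq_sub` is nonpositive.
        have hlow : q.1 - radius δ q ≤ lam - δ → tangentFn δ (lam - c) c c q ≤
            1 - (lam - c - δ) / (2 * δ * (lam - c) ^ 2) *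
              (q.2 - 2 * (lam + δ) * q.1 + lam ^ 2 + 2 * δ * lam) := by
          intro hp
          rw [h.middle_eq_sub, tangentFn_self, snd_sub_tangent hq]
          have := mul_nonneg hk (mul_nonneg
            (show 0 ≤ q.1 + radius δ q - (lam - δ) by linarith)
            (show 0 ≤ -(q.1 - radius δ q - (lam - δ)) by linarith))
          linarith
        rcases le_total 0 q.1 with hq1 | hq1
        · have habs := abs_of_nonneg hq1
          by_cases h3 : q.1 - radius δ q < lam - δ
          · refine le_trans ?_ (hlow h3.le)
            have := h.majorant_le hq
            rwa [habs] at this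
          · unfold majorant
            rw [habs, if_neg h3]
            split_ifs with h4
            · exact le_rfl
            · have e := snd_sub_tangent hq (lam + δ)
              have := mul_nonneg hk' (mul_nonneg
                (show 0 ≤ q.1 + radius δ q - (lam + δ) by linarith)
                (show 0 ≤ -(q.1 - radius δ q - (lam + δ)) by linarith))
              have e' : q.2 - 2 * (lam + δ) * q.1 + lam ^ 2 + 2 * δ * lam =
                (q.1 + radius δ q - (lam + δ)) * (q.1 - radius δ q - (lam + δ)) := by
                rw [← e]; ring
              rw [e']
              linarith
        · exact ((h.majorant_le hq).trans (tangentFn_abs_le h.nonneg q)).trans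
            (hlow (by linarith [h.lt]))
      · unfold majorant
        rw [if_neg h1, if_pos h2, abs_of_nonneg hz1]
    · refine ⟨0, 0, 1, ?_, fun q hq _ => by linarith [h.majorant_le_one hq]⟩
      unfold majorant
      rw [if_neg h1, if_neg h2]
      ring

lemma radius_neg_fst (x : ℝ × ℝ) : radius δ (-x.1, x.2) = radius δ x := by
  simp [radius]

lemma majorant_neg_fst (x : ℝ × ℝ) : majorant δ lam c (-x.1, x.2) = majorant δ lam c x := by
  simp [majorant, radius_neg_fst]

lemma neg_fst_mem_strip {x : ℝ × ℝ} (hx : x ∈ strip δ) : (-x.1, x.2) ∈ strip δ := by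
  simpa [strip] using hx

lemma Admissible.hasSupports (h : Admissible δ lam c) : HasSupports δ (majorant δ lam c) := by
  intro z hz
  rcases le_total 0 z.1 with h0 | h0
  · exact h.exists_support hz h0
  · obtain ⟨A, B, C, he, hle⟩ := h.exists_support (neg_fst_mem_strip hz) (by simpa using h0)
    refine ⟨-A, B, C, ?_, fun q hq hv => ?_⟩
    · rw [← majorant_neg_fst, ← he]; ring
    · have := hle (-q.1, q.2) (neg_fst_mem_strip hq) (by
        unfold Visible at hv ⊢
        rw [radius_neg_fst, radius_neg_fst]
        simpa [abs_sub_comm, neg_add_eq_sub] using hv)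
      rw [majorant_neg_fst] at this
      simp only at this
      linarith

lemma continuous_radius (δ : ℝ) : Continuous (radius δ) := by unfold radius; fun_prop

/-- At `(u, u ^ 2)` the radius is `δ`, so a strict inequality places the point inside the region
where the majorant is `1`. This is why the threshold has to be perturbed as well. -/
lemma eventually_one_le_majorant (hδ : 0 < δ) {u : ℝ} (hu : lam < |u|) :
    ∀ᶠ x in 𝓝 (u, u ^ 2), x ∈ strip δ → 1 ≤ majorant δ lam c x := by
  have hr : radius δ (u, u ^ 2) = δ := by
    simp [radius, Real.sqrt_sq hδ.le]
  have c1 : ContinuousAt (fun x : ℝ × ℝ => |x.1| - radius δ x) (u, u ^ 2) := by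
    have := continuous_radius δ
    fun_prop
  have c2 : ContinuousAt (fun x : ℝ × ℝ => |x.1| + radius δ x) (u, u ^ 2) := by
    have := continuous_radius δ
    fun_prop
  have e1 := c1.eventually (lt_mem_nhds (show lam - δ < |u| - radius δ (u, u ^ 2) by
    rw [hr]; linarith))
  have e2 := c2.eventually (lt_mem_nhds (show lam + δ < |u| + radius δ (u, u ^ 2) by
    rw [hr]; linarith))
  filter_upwards [e1, e2] with x h1 h2 _
  unfold majorant
  rw [if_neg h1.not_gt, if_neg h2.not_ge]

end Supports

/-! ### Upper bounds for the measure of the superlevel set -/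

/-- The measure of the superlevel set is bounded by the majorant for slightly perturbed
parameters. -/
lemma MemBMOBall.measure_le_majorant {a b ε δ lam lam' : ℝ} {φ : ℝ → ℝ} (h : MemBMOBall a b ε φ)
    (hab : a < b) (hε : 0 < ε) (hδ : ε < δ) (hδl : δ < lam') (hl : lam' < lam) :
    volume.real {s : ℝ | s ∈ Icc a b ∧ lam ≤ |φ s|} ≤
      (b - a) * majorant δ lam' (max 0 (lam' - 2 * δ)) (bellmanPoint φ a b) := by
  have hadm := admissible_max (hε.trans hδ) hδl
  exact h.measure_le hab hε hδ hadm.hasSupports (fun x hx => hadm.majorant_nonneg hx)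
    fun u hu => eventually_one_le_majorant hadm.pos (hl.trans_le hu)

section UpperBounds

variable {a b ε lam : ℝ} {x : ℝ × ℝ} {φ : ℝ → ℝ}

lemma bellmanPoint_eq (h : φ ∈ testFunctions a b ε x) : bellmanPoint φ a b = x :=
  Prod.ext h.2.1 h.2.2

lemma mem_strip_of_mem_testFunctions (hab : a < b) (h : φ ∈ testFunctions a b ε x) :
    x ∈ strip ε := by
  rw [← bellmanPoint_eq h]
  exact h.1.bellmanPoint_mem_strip hab le_rfl hab le_rfl

lemma measure_superlevel_le_one (hab : a < b) (φ : ℝ → ℝ) (lam : ℝ) :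
    volume.real {s : ℝ | s ∈ Icc a b ∧ lam ≤ |φ s|} ≤ b - a := by
  rw [← Real.volume_real_Icc_of_le hab.le]
  exact measureReal_mono (fun s hs => hs.1) (by simp)

/-- The Chebyshev and Cantelli inequalities. -/
lemma measure_superlevel_le_quadratic (hab : a < b) (h : φ ∈ testFunctions a b ε x) {c : ℝ}
    (hc : 0 ≤ c) (hcl : c < lam) :
    volume.real {s : ℝ | s ∈ Icc a b ∧ lam ≤ |φ s|} ≤
      (b - a) * ((x.2 - 2 * c * |x.1| + c ^ 2) / (lam - c) ^ 2) := by
  -- `k` is `c` with the sign of `x.1`; every value with `lam ≤ |φ s|` is at distance at least `lam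
  -- - c` from it.
  obtain ⟨k, hk, hkx⟩ : ∃ k : ℝ, |k| = c ∧ k * x.1 = c * |x.1| := by
    rcases abs_cases x.1 with ⟨e, -⟩ | ⟨e, -⟩
    · exact ⟨c, abs_of_nonneg hc, by rw [e]⟩
    · exact ⟨-c, by rw [abs_neg, abs_of_nonneg hc], by rw [e]; ring⟩
  have h2 := h.1.sq_intervalIntegrable hab
  have hint := intervalIntegrable_sub_const_sq h.1.1 h2 k
  have hba := sub_pos.2 hab
  have hI : ∫ s in a..b, (φ s - k) ^ 2 = (b - a) * (x.2 - 2 * c * |x.1| + c ^ 2) := by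
    rw [integral_sub_const_sq h.1.1 h2 k]
    have e1 := h.2.1
    have e2 := h.2.2
    rw [interval_average_eq_div, div_eq_iff hba.ne'] at e1 e2
    rw [e1, e2, ← hk, sq_abs, hk]
    linear_combination (-2 * (b - a)) * hkx
  rw [intervalIntegrable_iff_integrableOn_Icc_of_le hab.le] at hint
  have hM := mul_meas_ge_le_integral_of_nonneg (μ := volume.restrict (Icc a b))
    (f := fun s => (φ s - k) ^ 2) (Eventually.of_forall fun s => sq_nonneg _) hint ((lam - c) ^ 2)
  rw [integral_Icc_eq_integral_Ioc, ← intervalIntegral.integral_of_le hab.le, hI] at hM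
  have hpos : 0 < (lam - c) ^ 2 := by
    have := sub_pos.2 hcl
    positivity
  rw [← mul_div_assoc, le_div_iff₀ hpos, mul_comm]
  refine (mul_le_mul_of_nonneg_left ?_ hpos.le).trans hM
  -- The superlevel set need not be measurable; the inequality for the restricted measure used here
  -- holds for all sets.
  refine (measureReal_mono (μ := volume) (s₂ := {s | (lam - c) ^ 2 ≤ (φ s - k) ^ 2} ∩ Icc a b)
    (fun s hs => ⟨?_, hs.1⟩) ((measure_mono inter_subset_right).trans_lt (by simp)).ne).trans
    (ENNReal.toReal_mono ?_ (Measure.le_restrict_apply _ _))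
  · show (lam - c) ^ 2 ≤ (φ s - k) ^ 2
    rw [← sq_abs (φ s - k)]
    have := abs_sub_abs_le_abs_sub (φ s) k
    have := hs.2
    exact pow_le_pow_left₀ (sub_pos.2 hcl).le (by linarith) 2
  · exact ((measure_mono (subset_univ _)).trans_lt (by simp)).ne

lemma eventually_measure_le_majorant (hab : a < b) (hε : 0 < ε) (hl : ε < lam)
    (h : φ ∈ testFunctions a b ε x) :
    ∀ᶠ t in 𝓝[>] (0 : ℝ), Admissible (ε + t) (lam - t) (max 0 (lam - t - 2 * (ε + t))) ∧
      x ∈ strip (ε + t) ∧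
      volume.real {s : ℝ | s ∈ Icc a b ∧ lam ≤ |φ s|} ≤
      (b - a) * majorant (ε + t) (lam - t) (max 0 (lam - t - 2 * (ε + t))) x := by
  have hpos : 0 < (lam - ε) / 2 := by linarith
  filter_upwards [self_mem_nhdsWithin, nhdsWithin_le_nhds (gt_mem_nhds hpos)] with t ht0 ht
  have ht0 : 0 < t := ht0
  refine ⟨admissible_max (by linarith) (by linarith),
    strip_mono hε.le (by linarith) (mem_strip_of_mem_testFunctions hab h), ?_⟩
  have := h.1.measure_le_majorant hab hε (δ := ε + t) (lam' := lam - t) (lam := lam)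
    (by linarith) (by linarith) (by linarith)
  rwa [bellmanPoint_eq h] at this

/-- The strict inequalities keep `x` in the middle piece of the perturbed majorant for small `t`, so
its formula passes to the limit. -/
lemma measure_superlevel_le_middle (hab : a < b) (hε : 0 < ε) (hl : ε < lam)
    (h : φ ∈ testFunctions a b ε x) {c : ℝ} (hc : c = max 0 (lam - 2 * ε))
    (hp : lam - ε < |x.1| - radius ε x) (hs : |x.1| + radius ε x < lam + ε) :
    volume.real {s : ℝ | s ∈ Icc a b ∧ lam ≤ |φ s|} ≤
      (b - a) * (1 - (lam - c - ε) / (2 * ε * (lam - c) ^ 2) *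
        (x.2 - 2 * (lam + ε) * |x.1| + lam ^ 2 + 2 * ε * lam)) := by
  set f : ℝ → ℝ := fun t => (b - a) * (1 - (lam - t - max 0 (lam - t - 2 * (ε + t)) - (ε + t)) /
    (2 * (ε + t) * (lam - t - max 0 (lam - t - 2 * (ε + t))) ^ 2) *
    (x.2 - 2 * (lam - t + (ε + t)) * |x.1| + (lam - t) ^ 2 + 2 * (ε + t) * (lam - t))) with hf
  have hm : 0 < lam - max 0 (lam - 2 * ε) := hε.trans (admissible_max hε hl).lt_sub
  have hcont : ContinuousAt f 0 := by
    have hne : 2 * (ε + 0) * (lam - 0 - max 0 (lam - 0 - 2 * (ε + 0))) ^ 2 ≠ 0 := by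
      simp only [add_zero, sub_zero]
      positivity
    simp only [hf]
    fun_prop (disch := exact hne)
  have hlim : Tendsto f (𝓝[>] 0) (𝓝 (f 0)) := hcont.tendsto.mono_left nhdsWithin_le_nhds
  have hf0 : f 0 = (b - a) * (1 - (lam - c - ε) / (2 * ε * (lam - c) ^ 2) *
        (x.2 - 2 * (lam + ε) * |x.1| + lam ^ 2 + 2 * ε * lam)) := by
    simp [hf, hc]
  rw [← hf0]
  refine ge_of_tendsto hlim ?_
  have hr : ContinuousAt (fun t : ℝ => radius (ε + t) x) 0 := by
    unfold radius; fun_prop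
  have e1 : ∀ᶠ t in 𝓝 (0 : ℝ), 0 < |x.1| - radius (ε + t) x - (lam - t - (ε + t)) := by
    have : ContinuousAt (fun t : ℝ => |x.1| - radius (ε + t) x - (lam - t - (ε + t))) 0 := by
      fun_prop
    exact this.eventually (lt_mem_nhds (by simp only [add_zero, sub_zero]; linarith))
  have e2 : ∀ᶠ t in 𝓝 (0 : ℝ), 0 < lam - t + (ε + t) - (|x.1| + radius (ε + t) x) := by
    have : ContinuousAt (fun t : ℝ => lam - t + (ε + t) - (|x.1| + radius (ε + t) x)) 0 := by
      fun_prop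
    exact this.eventually (lt_mem_nhds (by simp only [add_zero, sub_zero]; linarith))
  filter_upwards [eventually_measure_le_majorant hab hε hl h, nhdsWithin_le_nhds e1,
    nhdsWithin_le_nhds e2] with t ⟨_, _, ht⟩ h1 h2
  unfold majorant at ht
  rwa [if_neg (by linarith), if_pos (by linarith)] at ht

/-- This bound holds in all regions and its right side is continuous in the parameters, so the limit
needs no case distinction. Off the left region the clamp returns `c`. -/
lemma Admissible.majorant_le_tangentFn {δ lam : ℝ}
    (h : Admissible δ lam (max 0 (lam - 2 * δ))) (hx : x ∈ strip δ) :
    majorant δ lam (max 0 (lam - 2 * δ)) x ≤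
      tangentFn δ (lam - max 0 (lam - 2 * δ)) (max 0 (lam - 2 * δ))
        (min (max (|x.1| + radius δ x - δ) 0) (max 0 (lam - 2 * δ))) (|x.1|, x.2) := by
  have hr := radius_nonneg δ x
  have hr' := radius_le h.pos.le hx
  by_cases h1 : |x.1| - radius δ x < lam - δ
  · unfold majorant
    rw [if_pos h1]
  · have hmin : min (max (|x.1| + radius δ x - δ) 0) (max 0 (lam - 2 * δ)) =
        max 0 (lam - 2 * δ) := by
      refine min_eq_right (max_le (le_max_right _ _) (le_trans ?_ (le_max_left _ _)))
      linarith
    rw [hmin]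
    exact h.majorant_le hx

lemma measure_superlevel_le_left (hab : a < b) (hε : 0 < ε) (hl : 2 * ε < lam)
    (h : φ ∈ testFunctions a b ε x) :
    volume.real {s : ℝ | s ∈ Icc a b ∧ lam ≤ |φ s|} ≤
      (b - a) * tangentFn ε (2 * ε) (lam - 2 * ε)
        (min (max (|x.1| + radius ε x - ε) 0) (lam - 2 * ε)) (|x.1|, x.2) := by
  set f : ℝ → ℝ := fun t => (b - a) * tangentFn (ε + t)
    (lam - t - max 0 (lam - t - 2 * (ε + t))) (max 0 (lam - t - 2 * (ε + t)))
    (min (max (|x.1| + radius (ε + t) x - (ε + t)) 0) (max 0 (lam - t - 2 * (ε + t))))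
    (|x.1|, x.2) with hf
  have hmax : max 0 (lam - 2 * ε) = lam - 2 * ε := max_eq_right (by linarith)
  have hr : ContinuousAt (fun t : ℝ => radius (ε + t) x) 0 := by
    unfold radius; fun_prop
  have hcont : ContinuousAt f 0 := by
    have hne : ε + 0 ≠ 0 := by simpa using hε.ne'
    have hne2 : (lam - 0 - max 0 (lam - 0 - 2 * (ε + 0))) ^ 2 ≠ 0 := by
      simp only [add_zero, sub_zero, hmax]
      ring_nf
      positivity
    simp only [hf, tangentFn]
    fun_prop (disch := first | exact hne | exact hne2)
  have hlim : Tendsto f (𝓝[>] 0) (𝓝 (f 0)) := hcont.tendsto.mono_left nhdsWithin_le_nhds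
  have hf0 : f 0 = (b - a) * tangentFn ε (2 * ε) (lam - 2 * ε)
        (min (max (|x.1| + radius ε x - ε) 0) (lam - 2 * ε)) (|x.1|, x.2) := by
    simp only [hf, add_zero, sub_zero, hmax]
    rw [sub_sub_cancel]
  rw [← hf0]
  refine ge_of_tendsto hlim ?_
  filter_upwards [eventually_measure_le_majorant hab hε (show ε < lam by linarith) h] with t ⟨hadm, hx, ht⟩
  exact ht.trans (mul_le_mul_of_nonneg_left (hadm.majorant_le_tangentFn hx)
    (sub_pos.2 hab).le)

end UpperBounds

/-! ### Criteria for small oscillation -/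

section Criterion

variable {ε c d : ℝ} {φ : ℝ → ℝ}

lemma integral_sub_const' (h1 : IntervalIntegrable φ volume c d) (k : ℝ) :
    ∫ s in c..d, (φ s - k) = (∫ s in c..d, φ s) - k * (d - c) := by
  rw [intervalIntegral.integral_sub h1 intervalIntegrable_const, intervalIntegral.integral_const,
    smul_eq_mul, mul_comm k]

/-- The variance is invariant under subtracting a constant, so each subinterval may use its own
convenient level. -/
lemma memBMOBall_of_forall {a b : ℝ} (h1 : IntervalIntegrable φ volume a b)
    (h2 : IntervalIntegrable (fun s => φ s ^ 2) volume a b)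
    (h : ∀ c d, a ≤ c → c < d → d ≤ b → ∃ v,
      (d - c) * (∫ s in c..d, (φ s - v) ^ 2) - (∫ s in c..d, (φ s - v)) ^ 2
        ≤ ε ^ 2 * (d - c) ^ 2) : MemBMOBall a b ε φ := by
  refine ⟨h1, fun c d hac hcd hdb => ?_⟩
  have h1' := h1.sub_interval hac hcd.le hdb
  have h2' := h2.sub_interval hac hcd.le hdb
  simp only [sq_abs]
  refine ⟨intervalIntegrable_sub_const_sq h1' h2' _, ?_⟩
  obtain ⟨v, hv⟩ := h c d hac hcd hdb
  rw [integral_sub_const_sq h1' h2', integral_sub_const' h1'] at hv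
  have h0 : 0 < d - c := sub_pos.2 hcd
  rw [meanSqOsc_eq hcd h1' h2']
  simp only [bellmanPoint, interval_average_eq_div]
  rw [div_pow, div_sub_div _ _ h0.ne' (by positivity), div_le_iff₀ (by positivity)]
  have := mul_le_mul_of_nonneg_left hv h0.le
  linarith

/-- `T * D2 - D1 ^ 2 ≤ 2 * ε * T * |D1| - D1 ^ 2`, and the square of `ε * T - |D1|` is nonnegative.
Here `T` is a length and `D1`, `D2` are the moments of `φ - v`. -/
lemma variance_le_of_sq_le {T D1 D2 : ℝ} (hT : 0 ≤ T) (h : D2 ≤ 2 * ε * |D1|) :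
    T * D2 - D1 ^ 2 ≤ ε ^ 2 * T ^ 2 := by
  nlinarith [mul_le_mul_of_nonneg_left h hT, sq_nonneg (ε * T - |D1|), sq_abs D1]

/-- A function with values in an interval of length `2 * ε` has small oscillation. -/
lemma variance_le_of_range (hcd : c ≤ d) (hε : 0 ≤ ε) {v : ℝ} (h1 : IntervalIntegrable φ volume c d)
    (h2 : IntervalIntegrable (fun s => φ s ^ 2) volume c d)
    (h : ∀ s ∈ Icc c d, v ≤ φ s ∧ φ s ≤ v + 2 * ε) :
    (d - c) * (∫ s in c..d, (φ s - v) ^ 2) - (∫ s in c..d, (φ s - v)) ^ 2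
        ≤ ε ^ 2 * (d - c) ^ 2 := by
  refine variance_le_of_sq_le (sub_nonneg.2 hcd) ?_
  have i1 : IntervalIntegrable (fun s => φ s - v) volume c d := h1.sub intervalIntegrable_const
  have : ∫ s in c..d, (φ s - v) ^ 2 ≤ ∫ s in c..d, 2 * ε * (φ s - v) := by
    refine intervalIntegral.integral_mono_on hcd (intervalIntegrable_sub_const_sq h1 h2 v)
      (i1.const_mul _) fun s hs => ?_
    obtain ⟨e1, e2⟩ := h s hs
    nlinarith
  rw [intervalIntegral.integral_const_mul] at this
  exact this.trans (mul_le_mul_of_nonneg_left (le_abs_self _) (by positivity))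

end Criterion

/-! ### Profiles and two-sided monotone functions -/

/-- A nonincreasing function that vanishes on `[b, ∞)`. -/
structure IsProfile (b : ℝ) (g : ℝ → ℝ) : Prop where
  nonneg : 0 ≤ b
  anti : Antitone g
  zero : ∀ t, b ≤ t → g t = 0

namespace IsProfile

variable {b : ℝ} {g : ℝ → ℝ} (h : IsProfile b g)
include h

lemma apply_nonneg (t : ℝ) : 0 ≤ g t := by
  rw [← h.zero (max t b) (le_max_right _ _)]
  exact h.anti (le_max_left _ _)

lemma sq_antitone : Antitone fun t => g t ^ 2 := fun _ t hst =>
  pow_le_pow_left₀ (h.apply_nonneg t) (h.anti hst) 2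

lemma integrable (c d : ℝ) : IntervalIntegrable g volume c d := h.anti.intervalIntegrable

lemma sq_integrable (c d : ℝ) : IntervalIntegrable (fun t => g t ^ 2) volume c d :=
  h.sq_antitone.intervalIntegrable

lemma integral_zero {d : ℝ} (hd : b ≤ d) : ∫ t in b..d, g t = 0 := by
  rw [intervalIntegral.integral_congr (g := fun _ => (0 : ℝ)), intervalIntegral.integral_zero]
  intro t ht
  rw [uIcc_of_le hd] at ht
  exact h.zero t ht.1

lemma integral_sq_zero {d : ℝ} (hd : b ≤ d) : ∫ t in b..d, g t ^ 2 = 0 := by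
  rw [intervalIntegral.integral_congr (g := fun _ => (0 : ℝ)), intervalIntegral.integral_zero]
  intro t ht
  rw [uIcc_of_le hd] at ht
  simp [h.zero t ht.1]

lemma integral_eq (c : ℝ) {d : ℝ} (hd : b ≤ d) : ∫ t in c..d, g t = ∫ t in c..b, g t := by
  rw [← intervalIntegral.integral_add_adjacent_intervals (h.integrable c b) (h.integrable b d),
    h.integral_zero hd, add_zero]

lemma integral_sq_eq (c : ℝ) {d : ℝ} (hd : b ≤ d) :
    ∫ t in c..d, g t ^ 2 = ∫ t in c..b, g t ^ 2 := by
  rw [← intervalIntegral.integral_add_adjacent_intervals (h.sq_integrable c b)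
    (h.sq_integrable b d), h.integral_sq_zero hd, add_zero]

end IsProfile

/-- The nondecreasing function that equals `v` in the middle of `[0, 1]` and deviates from it
according to `gL` on the left and `gR` on the right. -/
def twoSided (v : ℝ) (gL gR : ℝ → ℝ) (t : ℝ) : ℝ := v - gL t + gR (1 - t)

section TwoSided

variable {α β v : ℝ} {gL gR : ℝ → ℝ} (hL : IsProfile α gL) (hR : IsProfile β gR)
include hL hR

lemma monotone_twoSided : Monotone (twoSided v gL gR) := fun s t hst => by
  unfold twoSided
  linarith [hL.anti hst, hR.anti (show 1 - t ≤ 1 - s by linarith)]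

lemma twoSided_sub_sq (hαβ : α + β ≤ 1) (t : ℝ) :
    (twoSided v gL gR t - v) ^ 2 = gL t ^ 2 + gR (1 - t) ^ 2 := by
  unfold twoSided
  rcases le_total α t with h | h
  · rw [hL.zero t h]; ring
  · rw [hR.zero (1 - t) (by linarith)]; ring

lemma integral_twoSided (c d : ℝ) : ∫ t in c..d, (twoSided v gL gR t - v) =
    (∫ t in (1 - d)..(1 - c), gR t) - ∫ t in c..d, gL t := by
  have : ∀ t, twoSided v gL gR t - v = gR (1 - t) - gL t := fun t => by unfold twoSided; ring
  simp_rw [this]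
  have i2 : IntervalIntegrable (fun t => gR (1 - t)) volume c d :=
    Monotone.intervalIntegrable fun s t hst => hR.anti (by linarith)
  rw [intervalIntegral.integral_sub i2 (hL.integrable c d),
    intervalIntegral.integral_comp_sub_left]

lemma integral_twoSided_sq (hαβ : α + β ≤ 1) (c d : ℝ) :
    ∫ t in c..d, (twoSided v gL gR t - v) ^ 2 =
      (∫ t in (1 - d)..(1 - c), gR t ^ 2) + ∫ t in c..d, gL t ^ 2 := by
  simp_rw [twoSided_sub_sq hL hR hαβ]
  have i2 : IntervalIntegrable (fun t => gR (1 - t) ^ 2) volume c d :=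
    Monotone.intervalIntegrable fun s t hst => hR.sq_antitone (by linarith)
  rw [intervalIntegral.integral_add (hL.sq_integrable c d) i2,
    intervalIntegral.integral_comp_sub_left (fun t => gR t ^ 2), add_comm]

lemma intervalIntegrable_twoSided (c d : ℝ) :
    IntervalIntegrable (twoSided v gL gR) volume c d :=
  (monotone_twoSided hL hR).intervalIntegrable

lemma intervalIntegrable_twoSided_sq (hαβ : α + β ≤ 1) (c d : ℝ) :
    IntervalIntegrable (fun t => twoSided v gL gR t ^ 2) volume c d := by
  have : (fun t => twoSided v gL gR t ^ 2) = fun t => gL t ^ 2 + gR (1 - t) ^ 2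
      + 2 * v * twoSided v gL gR t - v ^ 2 := by
    funext t
    rw [← twoSided_sub_sq (v := v) hL hR hαβ]; ring
  rw [this]
  have i2 : IntervalIntegrable (fun t => gR (1 - t) ^ 2) volume c d :=
    Monotone.intervalIntegrable fun s t hst => hR.sq_antitone (by linarith)
  exact (((hL.sq_integrable c d).add i2).add
    ((intervalIntegrable_twoSided hL hR c d).const_mul _)).sub intervalIntegrable_const

/-- `twoSided` has the expected averages, so that only its oscillations have to be checked. -/
lemma twoSided_mem_testFunctions (hαβ : α + β ≤ 1) {ε : ℝ} {x : ℝ × ℝ}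
    (h1 : x.1 = v + ((∫ t in (0 : ℝ)..β, gR t) - ∫ t in (0 : ℝ)..α, gL t))
    (h2 : x.2 = 2 * v * x.1 - v ^ 2
      + ((∫ t in (0 : ℝ)..β, gR t ^ 2) + ∫ t in (0 : ℝ)..α, gL t ^ 2))
    (h : ∀ c d, 0 ≤ c → c < d → d ≤ 1 → ∃ w,
      (d - c) * (∫ s in c..d, (twoSided v gL gR s - w) ^ 2)
        - (∫ s in c..d, (twoSided v gL gR s - w)) ^ 2 ≤ ε ^ 2 * (d - c) ^ 2) :
    twoSided v gL gR ∈ testFunctions 0 1 ε x := by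
  have i1 := intervalIntegrable_twoSided (v := v) hL hR 0 1
  have i2 := intervalIntegrable_twoSided_sq (v := v) hL hR hαβ 0 1
  have hα := hL.nonneg
  have hβ := hR.nonneg
  have e1 := integral_twoSided (v := v) hL hR 0 1
  have e2 := integral_twoSided_sq (v := v) hL hR hαβ 0 1
  rw [integral_sub_const' i1, sub_self, sub_zero, hL.integral_eq 0 (by linarith),
    hR.integral_eq 0 (by linarith)] at e1
  rw [integral_sub_const_sq i1 i2, sub_self, sub_zero, hL.integral_sq_eq 0 (by linarith),
    hR.integral_sq_eq 0 (by linarith)] at e2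
  refine ⟨memBMOBall_of_forall i1 i2 h, ?_, ?_⟩ <;> rw [interval_average_eq_div]
  · linarith
  · have e3 : ∫ s in (0 : ℝ)..1, twoSided v gL gR s = x.1 := by linarith
    rw [e3] at e2
    linarith

end TwoSided

/-! ### Tails and their gluing -/

/-- A profile on `[0, b]` with average `ε`, all of whose truncations have Bellman point on the
upper boundary of the strip or below the tangent line from the truncation level. -/
structure IsTail (ε b : ℝ) (g : ℝ → ℝ) : Prop extends IsProfile b g where
  integral : ∫ t in (0 : ℝ)..b, g t = ε * b
  integral_sq : ∫ t in (0 : ℝ)..b, g t ^ 2 = 2 * ε ^ 2 * b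
  truncation : ∀ d, 0 < d → d < b →
    ∫ t in (0 : ℝ)..d, (g t - g d) ^ 2 ≤ 2 * ε * ∫ t in (0 : ℝ)..d, (g t - g d)

namespace IsTail

variable {ε b : ℝ} {g : ℝ → ℝ} (h : IsTail ε b g)
include h

lemma truncation' (d : ℝ) (hd : 0 < d) :
    ∫ t in (0 : ℝ)..d, (g t - g d) ^ 2 ≤ 2 * ε * ∫ t in (0 : ℝ)..d, (g t - g d) := by
  rcases lt_or_ge d b with h1 | h1
  · exact h.truncation d hd h1
  · rw [h.zero d h1]
    simp only [sub_zero]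
    rw [h.toIsProfile.integral_eq 0 h1, h.toIsProfile.integral_sq_eq 0 h1, h.integral,
      h.integral_sq]
    exact le_of_eq (by ring)

/-- With `y = g t - g d` the inequality is pointwise where `y ≤ 2 * ε`. If `y` starts above `2 * ε`,
the reverse pointwise inequality holds on all of `[0, c]`, so deleting that part from the bound on
`[0, d]` only helps. -/
lemma integral_truncation_le {c d : ℝ} (hc : 0 ≤ c) (hcd : c < d) :
    ∫ t in c..d, (g t - g d) ^ 2 ≤ 2 * ε * ∫ t in c..d, (g t - g d) := by
  have hp := h.toIsProfile
  have i1 : ∀ c d' : ℝ, IntervalIntegrable (fun t => g t - g d) volume c d' :=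
    fun c d' => (hp.integrable c d').sub intervalIntegrable_const
  have i2 : ∀ c d' : ℝ, IntervalIntegrable (fun t => (g t - g d) ^ 2) volume c d' :=
    fun c d' => intervalIntegrable_sub_const_sq (hp.integrable c d') (hp.sq_integrable c d') _
  rw [← intervalIntegral.integral_const_mul]
  rcases le_total (g c - g d) (2 * ε) with hle | hle
  · refine intervalIntegral.integral_mono_on hcd.le (i2 c d) ((i1 c d).const_mul _) fun t ht => ?_
    have e1 := h.anti ht.1
    have e2 := h.anti ht.2
    nlinarith
  · have hfull := h.truncation' d (hc.trans_lt hcd)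
    rw [← intervalIntegral.integral_const_mul,
      ← intervalIntegral.integral_add_adjacent_intervals (i2 0 c) (i2 c d),
      ← intervalIntegral.integral_add_adjacent_intervals ((i1 0 c).const_mul _)
        ((i1 c d).const_mul _)] at hfull
    have : ∫ t in (0 : ℝ)..c, 2 * ε * (g t - g d) ≤ ∫ t in (0 : ℝ)..c, (g t - g d) ^ 2 := by
      refine intervalIntegral.integral_mono_on hc ((i1 0 c).const_mul _) (i2 0 c) fun t ht => ?_
      have e1 := h.anti ht.2
      have e2 := h.anti (ht.2.trans hcd.le)
      nlinarith
    linarith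

lemma integral_le {c d : ℝ} (hc : 0 ≤ c) (hcb : c ≤ b) (hbd : b ≤ d) :
    ∫ t in c..d, g t ≤ ε * (b - c) := by
  have hp := h.toIsProfile
  rw [hp.integral_eq c hbd]
  rcases le_total (g c) ε with hle | hle
  · have : ∫ t in c..b, g t ≤ ∫ t in c..b, ε :=
      intervalIntegral.integral_mono_on hcb (hp.integrable c b) intervalIntegrable_const
        fun t ht => (h.anti ht.1).trans hle
    rw [intervalIntegral.integral_const, smul_eq_mul] at this
    linarith
  · have h1 : ∫ t in (0 : ℝ)..c, ε ≤ ∫ t in (0 : ℝ)..c, g t :=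
      intervalIntegral.integral_mono_on hc intervalIntegrable_const (hp.integrable 0 c)
        fun t ht => hle.trans (h.anti ht.2)
    have h2 := intervalIntegral.integral_add_adjacent_intervals (hp.integrable 0 c)
      (hp.integrable c b)
    rw [intervalIntegral.integral_const, smul_eq_mul] at h1
    rw [h.integral] at h2
    linarith

lemma integral_sq_le {c d : ℝ} (hc : 0 ≤ c) (hcd : c < d) (hbd : b ≤ d) :
    ∫ t in c..d, g t ^ 2 ≤ 2 * ε * ∫ t in c..d, g t := by
  have := h.integral_truncation_le hc hcd
  simpa [h.zero d hbd] using this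

lemma integral_nonneg {c d : ℝ} (hcd : c ≤ d) : 0 ≤ ∫ t in c..d, g t :=
  intervalIntegral.integral_nonneg hcd fun t _ => h.toIsProfile.apply_nonneg t

end IsTail

/-- Two tails can be joined through a constant if the resulting Bellman point is in the strip. -/
lemma twoSided_tail_mem {ε α β v : ℝ} (hε : 0 < ε) {gL gR : ℝ → ℝ} (hL : IsTail ε α gL)
    (hR : IsTail ε β gR) (hαβ : α + β ≤ 1) (hstrip : 4 * α * β ≤ (1 - α - β) ^ 2) :
    twoSided v gL gR ∈ testFunctions 0 1 ε
      (v + ε * (β - α), v ^ 2 + 2 * v * ε * (β - α) + 2 * ε ^ 2 * (α + β)) := by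
  have pL := hL.toIsProfile
  have pR := hR.toIsProfile
  have hα := pL.nonneg
  have hβ := pR.nonneg
  refine twoSided_mem_testFunctions pL pR hαβ ?_ ?_ fun c d hc hcd hd => ?_
  · rw [hL.integral, hR.integral]; ring
  · rw [hL.integral_sq, hR.integral_sq]; ring
  rcases le_or_gt α c with h1 | h1
  · refine ⟨v + gR (1 - c), variance_le_of_sq_le (sub_nonneg.2 hcd.le) ?_⟩
    have e : ∀ t ∈ uIcc c d, twoSided v gL gR t - (v + gR (1 - c)) = gR (1 - t) - gR (1 - c) := by
      intro t ht
      rw [uIcc_of_le hcd.le] at ht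
      unfold twoSided
      rw [hL.zero t (h1.trans ht.1)]; ring
    rw [intervalIntegral.integral_congr e, intervalIntegral.integral_congr
      (g := fun t => (gR (1 - t) - gR (1 - c)) ^ 2) (fun t ht => by simp only [e t ht]),
      intervalIntegral.integral_comp_sub_left (fun t => gR t - gR (1 - c)),
      intervalIntegral.integral_comp_sub_left (fun t => (gR t - gR (1 - c)) ^ 2)]
    exact (hR.integral_truncation_le (by linarith) (by linarith)).trans
      (mul_le_mul_of_nonneg_left (le_abs_self _) (by positivity))
  rcases le_or_gt d (1 - β) with h2 | h2
  · refine ⟨v - gL d, variance_le_of_sq_le (sub_nonneg.2 hcd.le) ?_⟩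
    have e : ∀ t ∈ uIcc c d, twoSided v gL gR t - (v - gL d) = -(gL t - gL d) := by
      intro t ht
      rw [uIcc_of_le hcd.le] at ht
      unfold twoSided
      rw [hR.zero (1 - t) (by linarith [ht.2])]; ring
    rw [intervalIntegral.integral_congr e, intervalIntegral.integral_congr
      (g := fun t => (gL t - gL d) ^ 2) (fun t ht => by simp only [e t ht, neg_sq]),
      intervalIntegral.integral_neg, abs_neg]
    exact (hL.integral_truncation_le hc hcd).trans
      (mul_le_mul_of_nonneg_left (le_abs_self _) (by positivity))
  -- The interval meets both tails, with first moments `S` and `R`. Bounding the second moments by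
  -- `2 * ε * S` and `2 * ε * R` leaves `4 * S * R ≤ (ε * (d - c) - S - R) ^ 2`, which follows from
  -- `hstrip` since the mean of a tail over its remaining part is at most `ε`.
  refine ⟨v, ?_⟩
  rw [integral_twoSided pL pR, integral_twoSided_sq pL pR hαβ]
  have a1 := hL.integral_le hc h1.le (show α ≤ d by linarith)
  have a2 := hL.integral_sq_le hc hcd (show α ≤ d by linarith)
  have a3 := hL.integral_nonneg hcd.le
  have b1 := hR.integral_le (show 0 ≤ 1 - d by linarith) (by linarith)
    (show β ≤ 1 - c by linarith)
  have b2 := hR.integral_sq_le (show 0 ≤ 1 - d by linarith) (by linarith)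
    (show β ≤ 1 - c by linarith)
  have b3 := hR.integral_nonneg (show 1 - d ≤ 1 - c by linarith)
  generalize (∫ t in c..d, gL t) = S at *
  generalize (∫ t in c..d, gL t ^ 2) = S2 at *
  generalize (∫ t in (1 - d)..(1 - c), gR t) = R at *
  generalize (∫ t in (1 - d)..(1 - c), gR t ^ 2) = R2 at *
  have hT : 0 < d - c := sub_pos.2 hcd
  have p1 : S * R ≤ (ε * α) * (ε * β) := by
    apply mul_le_mul _ _ b3 (by positivity) <;> nlinarith
  have p2 : ε * (1 - α - β) ≤ ε * (d - c) - S - R := by linarith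
  have p3 : 0 ≤ ε * (1 - α - β) := mul_nonneg hε.le (by linarith)
  have p4 : (ε * (1 - α - β)) ^ 2 ≤ (ε * (d - c) - S - R) ^ 2 := pow_le_pow_left₀ p3 p2 2
  have p5 : 4 * (S * R) ≤ (ε * (1 - α - β)) ^ 2 := by
    nlinarith [mul_le_mul_of_nonneg_left hstrip (sq_nonneg ε)]
  have p6 : (d - c) * (R2 + S2) ≤ (d - c) * (2 * ε * (S + R)) :=
    mul_le_mul_of_nonneg_left (by linarith) hT.le
  nlinarith

lemma integral_congr_Ioo {f g : ℝ → ℝ} {c d : ℝ} (hcd : c ≤ d) (h : ∀ t ∈ Ioo c d, f t = g t) :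
    ∫ t in c..d, f t = ∫ t in c..d, g t := by
  rw [intervalIntegral.integral_of_le hcd, intervalIntegral.integral_of_le hcd,
    integral_Ioc_eq_integral_Ioo, integral_Ioc_eq_integral_Ioo]
  exact setIntegral_congr_fun measurableSet_Ioo h

/-- The profile of height `h` on `(-∞, p)`. -/
def step (h p t : ℝ) : ℝ := if t < p then h else 0

lemma step_of_lt {h p t : ℝ} (ht : t < p) : step h p t = h := if_pos ht

lemma step_of_le {h p t : ℝ} (ht : p ≤ t) : step h p t = 0 := if_neg ht.not_gt

lemma step_sq (h p t : ℝ) : step h p t ^ 2 = step (h ^ 2) p t := by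
  unfold step; split_ifs <;> simp

lemma step_antitone {h : ℝ} (hh : 0 ≤ h) (p : ℝ) : Antitone (step h p) := by
  intro s t hst
  unfold step
  split_ifs <;> linarith

lemma isProfile_step {h p : ℝ} (hh : 0 ≤ h) (hp : 0 ≤ p) : IsProfile p (step h p) :=
  ⟨hp, step_antitone hh p, fun _ ht => step_of_le ht⟩

lemma integral_step_self {h c p : ℝ} (hcp : c ≤ p) : ∫ t in c..p, step h p t = h * (p - c) := by
  rw [integral_congr_Ioo hcp (g := fun _ => h) fun t ht => step_of_lt ht.2,
    intervalIntegral.integral_const, smul_eq_mul, mul_comm]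

lemma integral_step {h c p d : ℝ} (hh : 0 ≤ h) (hp : 0 ≤ p) (hcp : c ≤ p) (hpd : p ≤ d) :
    ∫ t in c..d, step h p t = h * (p - c) := by
  rw [(isProfile_step hh hp).integral_eq c hpd, integral_step_self hcp]

lemma integral_step_sq {h c p d : ℝ} (hp : 0 ≤ p) (hcp : c ≤ p) (hpd : p ≤ d) :
    ∫ t in c..d, step h p t ^ 2 = h ^ 2 * (p - c) := by
  simp_rw [step_sq]
  exact integral_step (sq_nonneg h) hp hcp hpd

lemma isTail_zero (ε : ℝ) : IsTail ε 0 fun _ => 0 where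
  nonneg := le_rfl
  anti := antitone_const
  zero _ _ := rfl
  integral := by simp
  integral_sq := by simp
  truncation d h1 h2 := by linarith

/-! ### The logarithmic tail with a jump -/

section JumpTail

variable {ε b τ : ℝ}

/-- The capped logarithm with a jump of height `2 * ε` on top. -/
def jumpLog (ε b τ t : ℝ) : ℝ := step (2 * ε) (τ / 2) t + ε * Real.log (b / max τ (min t b))

lemma hasDerivAt_log_div (hb : b ≠ 0) {t : ℝ} (ht : t ≠ 0) :
    HasDerivAt (fun t => ε * Real.log (b / t)) (-ε / t) t := by
  have h1 : HasDerivAt (fun t => b / t) (-b / t ^ 2) t := by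
    have := (hasDerivAt_inv ht).const_mul b
    simpa [div_eq_mul_inv] using this
  refine ((h1.log (div_ne_zero hb ht)).const_mul ε).congr_deriv ?_
  field_simp

lemma continuousOn_log_div (hb : 0 < b) {c d : ℝ} (hc : 0 < c) :
    ContinuousOn (fun t => ε * Real.log (b / t)) (Icc c d) := fun _ ht =>
  (hasDerivAt_log_div hb.ne' (hc.trans_le ht.1).ne').continuousAt.continuousWithinAt

lemma integral_log_div (hb : 0 < b) {c d : ℝ} (hc : 0 < c) (hcd : c ≤ d) :
    ∫ t in c..d, ε * Real.log (b / t) =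
      d * (ε * Real.log (b / d) + ε) - c * (ε * Real.log (b / c) + ε) := by
  refine intervalIntegral.integral_eq_sub_of_hasDerivAt
    (f := fun t => t * (ε * Real.log (b / t) + ε)) (fun t ht => ?_) ?_
  · rw [uIcc_of_le hcd] at ht
    have ht0 : t ≠ 0 := (hc.trans_le ht.1).ne'
    refine ((hasDerivAt_id t).mul ((hasDerivAt_log_div hb.ne' ht0).add_const ε)).congr_deriv ?_
    simp only [id]
    field_simp
    ring
  · refine ContinuousOn.intervalIntegrable ?_
    rw [uIcc_of_le hcd]
    exact continuousOn_log_div hb hc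

lemma integral_log_div_sq (hb : 0 < b) {c d : ℝ} (hc : 0 < c) (hcd : c ≤ d) :
    ∫ t in c..d, (ε * Real.log (b / t)) ^ 2 =
      d * ((ε * Real.log (b / d) + ε) ^ 2 + ε ^ 2)
        - c * ((ε * Real.log (b / c) + ε) ^ 2 + ε ^ 2) := by
  refine intervalIntegral.integral_eq_sub_of_hasDerivAt
    (f := fun t => t * ((ε * Real.log (b / t) + ε) ^ 2 + ε ^ 2)) (fun t ht => ?_) ?_
  · rw [uIcc_of_le hcd] at ht
    have ht0 : t ≠ 0 := (hc.trans_le ht.1).ne'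
    refine ((hasDerivAt_id t).mul ((((hasDerivAt_log_div hb.ne' ht0).add_const ε).pow 2).add_const
      (ε ^ 2))).congr_deriv ?_
    simp only [id, Pi.pow_apply]
    field_simp
    ring
  · refine ContinuousOn.intervalIntegrable ?_
    rw [uIcc_of_le hcd]
    exact (continuousOn_log_div hb hc).pow 2

lemma jumpLog_of_le {t : ℝ} (ht : t ≤ τ) :
    jumpLog ε b τ t = step (2 * ε) (τ / 2) t + ε * Real.log (b / τ) := by
  unfold jumpLog
  rw [max_eq_left ((min_le_left _ _).trans ht)]

lemma jumpLog_of_ge (hτ : 0 < τ) {t : ℝ} (ht : τ ≤ t) (htb : t ≤ b) :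
    jumpLog ε b τ t = ε * Real.log (b / t) := by
  unfold jumpLog
  rw [step_of_le (by linarith), min_eq_left htb, max_eq_right ht, zero_add]

variable (hε : 0 < ε) (hτ : 0 < τ) (hτb : τ ≤ b)
include hε hτ hτb

lemma jumpLog_isProfile : IsProfile b (jumpLog ε b τ) where
  nonneg := by linarith
  anti s t hst := by
    have h1 := step_antitone (show 0 ≤ 2 * ε by linarith) (τ / 2) hst
    have h2 : 0 < max τ (min s b) := lt_max_of_lt_left hτ
    have h3 : max τ (min s b) ≤ max τ (min t b) := max_le_max_left _ (min_le_min_right _ hst)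
    have hb : 0 < b := hτ.trans_le hτb
    have h4 : Real.log (b / max τ (min t b)) ≤ Real.log (b / max τ (min s b)) :=
      Real.log_le_log (div_pos hb (h2.trans_le h3)) (div_le_div_of_nonneg_left hb.le h2 h3)
    have h5 := mul_le_mul_of_nonneg_left h4 hε.le
    unfold jumpLog
    linarith
  zero t ht := by
    unfold jumpLog
    rw [step_of_le (by linarith), min_eq_right ht, max_eq_right hτb,
      div_self (hτ.trans_le hτb).ne']
    simp

/-- Over `[0, τ]` a jump of `2 * ε` on half the length has the same first and second moments as the
uncapped logarithm, so `τ` disappears from the result here and in `integral_jumpLog_sq`. -/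
lemma integral_jumpLog {d : ℝ} (hd : τ ≤ d) (hdb : d ≤ b) :
    ∫ t in (0 : ℝ)..d, jumpLog ε b τ t = d * (ε * Real.log (b / d) + ε) := by
  have hp := jumpLog_isProfile hε hτ hτb
  rw [← intervalIntegral.integral_add_adjacent_intervals (hp.integrable 0 τ) (hp.integrable τ d),
    integral_congr_Ioo hd (fun t ht => jumpLog_of_ge hτ ht.1.le (ht.2.le.trans hdb)),
    integral_congr_Ioo hτ.le (fun t ht => jumpLog_of_le ht.2.le),
    integral_log_div (hτ.trans_le hτb) hτ hd,
    intervalIntegral.integral_add ((step_antitone (by linarith) _).intervalIntegrable)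
      intervalIntegrable_const,
    integral_step (by linarith) (by linarith) (by linarith) (by linarith),
    intervalIntegral.integral_const, smul_eq_mul]
  ring

lemma integral_jumpLog_sq {d : ℝ} (hd : τ ≤ d) (hdb : d ≤ b) :
    ∫ t in (0 : ℝ)..d, jumpLog ε b τ t ^ 2 = d * ((ε * Real.log (b / d) + ε) ^ 2 + ε ^ 2) := by
  have hp := jumpLog_isProfile hε hτ hτb
  have hs : IntervalIntegrable (step (2 * ε) (τ / 2)) volume 0 τ :=
    (step_antitone (by linarith) _).intervalIntegrable
  rw [← intervalIntegral.integral_add_adjacent_intervals (hp.sq_integrable 0 τ)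
      (hp.sq_integrable τ d),
    integral_congr_Ioo hd (g := fun t => (ε * Real.log (b / t)) ^ 2)
      (fun t ht => by rw [jumpLog_of_ge hτ ht.1.le (ht.2.le.trans hdb)]),
    integral_congr_Ioo hτ.le (g := fun t => (2 * ε + 2 * (ε * Real.log (b / τ)))
      * step (2 * ε) (τ / 2) t + (ε * Real.log (b / τ)) ^ 2)
      (fun t ht => by
        rw [jumpLog_of_le ht.2.le]
        unfold step
        split_ifs <;> ring),
    integral_log_div_sq (hτ.trans_le hτb) hτ hd,
    intervalIntegral.integral_add (hs.const_mul _) intervalIntegrable_const,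
    intervalIntegral.integral_const_mul,
    integral_step (by linarith) (by linarith) (by linarith) (by linarith),
    intervalIntegral.integral_const, smul_eq_mul]
  ring

lemma isTail_jumpLog : IsTail ε b (jumpLog ε b τ) where
  toIsProfile := jumpLog_isProfile hε hτ hτb
  integral := by
    rw [integral_jumpLog hε hτ hτb hτb le_rfl, div_self (hτ.trans_le hτb).ne', Real.log_one]
    ring
  integral_sq := by
    rw [integral_jumpLog_sq hε hτ hτb hτb le_rfl, div_self (hτ.trans_le hτb).ne', Real.log_one]
    ring
  truncation d hd hdb := by
    have hp := jumpLog_isProfile hε hτ hτb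
    rcases le_total τ d with h | h
    · rw [integral_sub_const_sq (hp.integrable 0 d) (hp.sq_integrable 0 d),
        integral_sub_const' (hp.integrable 0 d), integral_jumpLog hε hτ hτb h hdb.le,
        integral_jumpLog_sq hε hτ hτb h hdb.le, jumpLog_of_ge hτ h hdb.le]
      exact le_of_eq (by ring)
    -- For `d ≤ τ` the truncated function takes only the values `0` and `2 * ε`.
    · rw [← intervalIntegral.integral_const_mul]
      refine le_of_eq (intervalIntegral.integral_congr fun t ht => ?_)
      rw [uIcc_of_le hd.le] at ht
      rw [jumpLog_of_le h, jumpLog_of_le (ht.2.trans h)]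
      have := ht.2
      unfold step
      split_ifs <;> first | (exfalso; linarith) | ring

end JumpTail

/-- The cap `τ = b * exp (-q / ε)` solves `ε * log (b / τ) = q`, so the jump goes from `q` to `q + 2
* ε`. -/
lemma exists_jump_tail {ε b q : ℝ} (hε : 0 < ε) (hb : 0 ≤ b) (hq : 0 ≤ q) :
    ∃ g, IsTail ε b g ∧ (∀ t, t < b * Real.exp (-q / ε) / 2 → g t = q + 2 * ε) ∧
      ∀ t, b * Real.exp (-q / ε) / 2 ≤ t → g t ≤ q := by
  rcases hb.eq_or_lt with rfl | hb
  -- For `b = 0` the tail conditions are void on negative arguments; the step makes the value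
  -- clauses true there as well.
  · refine ⟨step (q + 2 * ε) 0, ⟨isProfile_step (by linarith) le_rfl, by simp, by simp,
      fun d h1 h2 => by linarith⟩, fun t ht => step_of_lt (by simpa using ht), fun t ht => ?_⟩
    rw [step_of_le (by simpa using ht)]
    exact hq
  · have hτ : 0 < b * Real.exp (-q / ε) := by positivity
    have hτb : b * Real.exp (-q / ε) ≤ b := by
      refine mul_le_of_le_one_right hb.le (Real.exp_le_one_iff.2 ?_)
      exact div_nonpos_of_nonpos_of_nonneg (by linarith) hε.le
    have hlog : ε * Real.log (b / (b * Real.exp (-q / ε))) = q := by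
      rw [div_mul_eq_div_div, div_self hb.ne', one_div, Real.log_inv, Real.log_exp]
      field_simp
    have htail := isTail_jumpLog hε hτ hτb
    refine ⟨_, htail, fun t ht => ?_, fun t ht => ?_⟩
    · rw [jumpLog_of_le (by linarith), hlog, step_of_lt ht]
      ring
    · refine (htail.anti ht).trans (le_of_eq ?_)
      rw [jumpLog_of_le (by linarith), hlog, step_of_le le_rfl, zero_add]

/-! ### The two-step tail -/

/-- The tail with values `2 * lam`, `lam`, `0`. -/
lemma exists_two_step_tail {ε lam α : ℝ} (hε : 0 < ε) (hl : ε < lam) (hl2 : lam ≤ 2 * ε)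
    (hα : 0 ≤ α) : ∃ g, IsTail ε α g ∧
      (∀ t, t < α * ((2 * ε ^ 2 - ε * lam) / (2 * lam ^ 2)) → g t = 2 * lam) ∧
      ∀ t, α * ((3 * ε * lam - 2 * ε ^ 2) / (2 * lam ^ 2)) ≤ t → g t = 0 := by
  have hlam : 0 < lam := hε.trans hl
  -- The breakpoints `p`, `r` solve the moment equations `lam * (p + r) = ε * α` and `lam ^ 2 * (3 *
  -- p + r) = 2 * ε ^ 2 * α`.
  generalize hp : α * ((2 * ε ^ 2 - ε * lam) / (2 * lam ^ 2)) = p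
  generalize hr : α * ((3 * ε * lam - 2 * ε ^ 2) / (2 * lam ^ 2)) = r
  have hp0 : 0 ≤ p := by
    rw [← hp]
    exact mul_nonneg hα (div_nonneg (by nlinarith) (by positivity))
  have hpr : p ≤ r := by
    rw [← hp, ← hr]
    gcongr α * (?_ / _)
    nlinarith
  have hrα : r ≤ α := by
    rw [← hr]
    refine mul_le_of_le_one_right hα ((div_le_one (by positivity)).2 ?_)
    nlinarith [sq_nonneg (4 * lam - 3 * ε)]
  have hr0 := hp0.trans hpr
  have i1 : ∀ h p d : ℝ, 0 ≤ h → IntervalIntegrable (step h p) volume 0 d := fun h p d hh =>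
    (step_antitone hh p).intervalIntegrable
  have e1 : ∀ d, r ≤ d → ∫ t in (0 : ℝ)..d, (step lam p t + step lam r t) = ε * α := by
    intro d hd
    rw [intervalIntegral.integral_add (i1 _ _ _ hlam.le) (i1 _ _ _ hlam.le),
      integral_step hlam.le hp0 hp0 (hpr.trans hd), integral_step hlam.le hr0 hr0 hd, ← hp, ← hr]
    field_simp
    ring
  have e2 : ∀ d, r ≤ d → ∫ t in (0 : ℝ)..d, (step lam p t + step lam r t) ^ 2
      = 2 * ε ^ 2 * α := by
    intro d hd
    have hsq : ∀ t, (step lam p t + step lam r t) ^ 2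
        = step (3 * lam ^ 2) p t + step (lam ^ 2) r t := by
      intro t
      unfold step
      split_ifs <;> first | (exfalso; linarith) | ring
    simp_rw [hsq]
    rw [intervalIntegral.integral_add (i1 _ _ _ (by positivity)) (i1 _ _ _ (by positivity)),
      integral_step (by positivity) hp0 hp0 (hpr.trans hd),
      integral_step (by positivity) hr0 hr0 hd, ← hp, ← hr]
    field_simp
    ring
  refine ⟨fun t => step lam p t + step lam r t, ⟨⟨hα,
    (step_antitone hlam.le p).add (step_antitone hlam.le r), fun t ht => ?_⟩, e1 α hrα, e2 α hrα,
    fun d hd hdα => ?_⟩, fun t ht => ?_, fun t ht => ?_⟩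
  · rw [step_of_le (by linarith), step_of_le (by linarith), zero_add]
  · rcases le_or_gt r d with h | h
    · rw [show step lam p d + step lam r d = 0 by
        rw [step_of_le (by linarith), step_of_le h, zero_add]]
      simp only [sub_zero]
      rw [e1 d h, e2 d h]
      exact le_of_eq (by ring)
    · rw [← intervalIntegral.integral_const_mul]
      have j1 : IntervalIntegrable (fun t => step lam p t + step lam r t
          - (step lam p d + step lam r d)) volume 0 d :=
        ((i1 _ _ _ hlam.le).add (i1 _ _ _ hlam.le)).sub intervalIntegrable_const
      -- A truncation at `d < r` takes only the values `0` and `lam`, and `lam ≤ 2 * ε`.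
      have hval : ∀ t, t ≤ d → step lam p t + step lam r t - (step lam p d + step lam r d) = 0 ∨
          step lam p t + step lam r t - (step lam p d + step lam r d) = lam := by
        intro t ht
        rw [step_of_lt h, step_of_lt (ht.trans_lt h)]
        unfold step
        split_ifs with h1 h2 <;> first
          | (exfalso; linarith) | (left; ring1) | (right; ring1)
      have hsq : ∀ t, t ≤ d → (step lam p t + step lam r t - (step lam p d + step lam r d)) ^ 2 =
          lam * (step lam p t + step lam r t - (step lam p d + step lam r d)) := by
        intro t ht
        rcases hval t ht with e | e <;> rw [e] <;> ring
      rw [intervalIntegral.integral_congr (g := fun t => lam * (step lam p t + step lam r t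
        - (step lam p d + step lam r d))) fun t ht => hsq t (by
          rw [uIcc_of_le hd.le] at ht; exact ht.2)]
      refine intervalIntegral.integral_mono_on hd.le (j1.const_mul _) (j1.const_mul _) ?_
      intro t ht
      rcases hval t ht.2 with e | e <;> rw [e]
      · simp
      · exact mul_le_mul_of_nonneg_right hl2 hlam.le
  · simp only
    rw [step_of_lt ht, step_of_lt (ht.trans_le hpr)]
    ring
  · simp only
    rw [step_of_le (hpr.trans ht), step_of_le ht, zero_add]

/-! ### Variance of three-valued functions -/

section ThreeLevels

/-- Removing a part on which the function is constant and differs from its mean by at least `ε`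
does not violate the bound on the variance. -/
lemma variance_le_of_remove {ε T X1 X2 μ : ℝ} (hT : 0 < T) (hμ : 0 ≤ μ) (hμT : μ ≤ T)
    (hε : 0 ≤ ε) (h1 : ε * T ≤ X1) (h : T * X2 - X1 ^ 2 ≤ ε ^ 2 * T ^ 2) :
    (T - μ) * X2 - X1 ^ 2 ≤ ε ^ 2 * (T - μ) ^ 2 := by
  have hX : (ε * T) ^ 2 ≤ X1 ^ 2 := pow_le_pow_left₀ (by positivity) h1 2
  refine le_of_mul_le_mul_left ?_ hT
  have e1 := mul_le_mul_of_nonneg_left h (sub_nonneg.2 hμT)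
  have e2 := mul_le_mul_of_nonneg_left hX hμ
  have e3 : 0 ≤ ε ^ 2 * T * μ ^ 2 := by positivity
  nlinarith

/-- `A`, `M`, `B` are the lengths at the levels `-lam`, `0`, `lam`; a subinterval keeps `a`, `M`,
`b`. Shortening the left block is harmless, as `A ≤ B` keeps the mean at distance at least `ε` from
`-lam`. Shortening the right block is harmless if the mean for `(a, M, B)` is at most `lam - ε`. -/
lemma three_levels_variance {ε lam A B M a b : ℝ} (hε : 0 < ε) (hl : ε ≤ lam)
    (ha : 0 ≤ a) (haA : a ≤ A) (hbB : b ≤ B) (hAB : A ≤ B) (hM : 0 ≤ M)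
    (hT : 0 < M + a + b)
    (hV : (M + A + B) * (lam ^ 2 * (A + B)) - (lam * (B - A)) ^ 2 ≤ ε ^ 2 * (M + A + B) ^ 2)
    (hcond : 4 * A * (lam - ε) ≤ (2 * ε - lam) * M ∨
      lam * (B - A) ≤ (lam - ε) * (M + A + B)) :
    (M + a + b) * (lam ^ 2 * (a + b)) - (lam * (b - a)) ^ 2 ≤ ε ^ 2 * (M + a + b) ^ 2 := by
  have hlam : 0 < lam := hε.trans_le hl
  have left : ∀ a', 0 ≤ a' → a' ≤ A → (M + a' + B) * (lam ^ 2 * (a' + B)) - (lam * (B - a')) ^ 2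
      ≤ ε ^ 2 * (M + a' + B) ^ 2 := by
    intro a' h0 h1
    have := variance_le_of_remove (ε := ε) (T := M + A + B) (X1 := lam * (M + 2 * B))
      (X2 := lam ^ 2 * (M + 4 * B)) (μ := A - a') (by linarith) (by linarith) (by linarith) hε.le
      (by nlinarith [mul_le_mul_of_nonneg_right hl (show 0 ≤ M + 2 * B by linarith)])
      (by nlinarith)
    nlinarith
  -- This condition is the moment criterion `∫ (lam - φ) ^ 2 ≤ 2 * ε * ∫ (lam - φ)`, in which `b`
  -- plays no role.
  by_cases hstar : 4 * a * (lam - ε) ≤ (2 * ε - lam) * M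
  · have := variance_le_of_sq_le (ε := ε) (T := M + a + b) (D1 := lam * (2 * a + M))
      (D2 := lam ^ 2 * (4 * a + M)) hT.le (by
        rw [abs_of_nonneg (by positivity)]
        have := mul_le_mul_of_nonneg_left hstar hlam.le
        nlinarith)
    nlinarith
  · push Not at hstar
    have hfail : ∀ a', a ≤ a' → (2 * ε - lam) * M < 4 * a' * (lam - ε) := fun a' h =>
      hstar.trans_le (by nlinarith)
    have hmean : lam * (B - a) ≤ (lam - ε) * (M + a + B) := by
      by_contra! hlt
      have hA := hcond.resolve_left (hfail A haA).not_ge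
      have hk : 0 < 2 * lam - ε := by linarith
      -- At `a'` the mean for `(a', M, B)` is exactly `lam - ε`. There failure of the moment
      -- criterion means variance above `ε ^ 2`, contradicting `left`.
      obtain ⟨a', ha'⟩ : ∃ a', a' * (2 * lam - ε) = lam * B - (lam - ε) * (M + B) :=
        ⟨_, div_mul_cancel₀ _ hk.ne'⟩
      have h1 : a ≤ a' := by
        refine le_of_mul_le_mul_right ?_ hk
        rw [ha']; linarith
      have h2 : a' ≤ A := by
        refine le_of_mul_le_mul_right ?_ hk
        rw [ha']; linarith
      have hV' := left a' (ha.trans h1) h2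
      have hD1 : lam * (2 * a' + M) = ε * (M + a' + B) := by linarith
      have hT' : 0 < M + a' + B := by linarith
      have hfa := hfail a' h1
      have hD2 : 2 * ε * (lam * (2 * a' + M)) < lam ^ 2 * (4 * a' + M) := by
        have := mul_lt_mul_of_pos_left hfa hlam
        nlinarith
      rw [hD1] at hD2
      have hid : (M + a' + B) * (lam ^ 2 * (a' + B)) - (lam * (B - a')) ^ 2 =
        (M + a' + B) * (lam ^ 2 * (4 * a' + M)) - (lam * (2 * a' + M)) ^ 2 := by ring
      rw [hid, hD1] at hV'
      have := mul_lt_mul_of_pos_left hD2 hT'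
      nlinarith
    have := variance_le_of_remove (ε := ε) (T := M + a + B) (X1 := lam * (2 * a + M))
      (X2 := lam ^ 2 * (4 * a + M)) (μ := B - b) (by linarith) (by linarith) (by linarith) hε.le
      (by linarith) (by have := left a ha haA; nlinarith)
    nlinarith

end ThreeLevels

/-! ### Affine change of variable and reflection -/

section Transport

lemma average_comp_affine {k : ℝ} (hk : k ≠ 0) (f : ℝ → ℝ) (e c d : ℝ) :
    (⨍ s in c..d, f (s / k - e)) = ⨍ s in (c / k - e)..(d / k - e), f s := by
  simp only [interval_average_eq_div]
  rw [intervalIntegral.integral_comp_div_sub f hk, smul_eq_mul,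
    show d / k - e - (c / k - e) = (d - c) / k by field_simp; ring]
  field_simp

lemma intervalIntegrable_comp_affine {k : ℝ} (hk : k ≠ 0) {f : ℝ → ℝ} {e c d : ℝ}
    (hf : IntervalIntegrable f volume (c / k - e) (d / k - e)) :
    IntervalIntegrable (fun s => f (s / k - e)) volume c d := by
  have h1 := (hf.comp_sub_right e).comp_mul_left (c := k⁻¹)
  simp only [sub_add_cancel, div_inv_eq_mul, div_mul_cancel₀ _ hk] at h1
  simpa [div_eq_inv_mul] using h1

lemma testFunctions_comp_affine {a b ε : ℝ} (hab : a < b) {x : ℝ × ℝ} {φ : ℝ → ℝ}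
    (h : φ ∈ testFunctions 0 1 ε x) :
    (fun s => φ (s / (b - a) - a / (b - a))) ∈ testFunctions a b ε x := by
  have hk : 0 < b - a := sub_pos.2 hab
  have ha : a / (b - a) - a / (b - a) = 0 := sub_self _
  have hb : b / (b - a) - a / (b - a) = 1 := by rw [← sub_div, div_self hk.ne']
  have mono : ∀ {c d : ℝ}, c ≤ d → c / (b - a) - a / (b - a) ≤ d / (b - a) - a / (b - a) :=
    fun h => sub_le_sub_right (div_le_div_of_nonneg_right h hk.le) _
  refine ⟨⟨intervalIntegrable_comp_affine hk.ne' (by rw [ha, hb]; exact h.1.1),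
    fun c d hac hcd hdb => ?_⟩, ?_, ?_⟩
  · have hcd' : c / (b - a) - a / (b - a) < d / (b - a) - a / (b - a) :=
      sub_lt_sub_right (div_lt_div_of_pos_right hcd hk) _
    obtain ⟨e1, e2⟩ := h.1.2 _ _ (ha ▸ mono hac) hcd' (hb ▸ mono hdb)
    unfold meanSqOsc at *
    rw [average_comp_affine hk.ne']
    refine ⟨intervalIntegrable_comp_affine hk.ne' e1, ?_⟩
    rwa [average_comp_affine hk.ne' (fun s => |φ s - ⨍ t in (c / (b - a) - a / (b - a))..
      (d / (b - a) - a / (b - a)), φ t| ^ 2)]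
  · rw [average_comp_affine hk.ne', ha, hb]
    exact h.2.1
  · rw [average_comp_affine hk.ne' (fun s => φ s ^ 2), ha, hb]
    exact h.2.2

lemma measure_superlevel_comp_affine {a b : ℝ} (hab : a < b) (φ : ℝ → ℝ) (lam : ℝ) :
    volume.real {s : ℝ | s ∈ Icc a b ∧ lam ≤ |φ (s / (b - a) - a / (b - a))|} =
      (b - a) * volume.real {s : ℝ | s ∈ Icc (0 : ℝ) 1 ∧ lam ≤ |φ s|} := by
  have hk : 0 < b - a := sub_pos.2 hab
  have hset : {s : ℝ | s ∈ Icc a b ∧ lam ≤ |φ (s / (b - a) - a / (b - a))|} =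
      (fun s => s * (b - a)⁻¹) ⁻¹' ((fun s => s + -(a / (b - a))) ⁻¹'
        {s : ℝ | s ∈ Icc (0 : ℝ) 1 ∧ lam ≤ |φ s|}) := by
    ext s
    simp only [mem_preimage, mem_ofPred_eq, mem_Icc, ← sub_eq_add_neg, ← div_eq_mul_inv]
    have e1 : 0 ≤ s / (b - a) - a / (b - a) ↔ a ≤ s := by
      rw [← sub_div, le_div_iff₀ hk, zero_mul, sub_nonneg]
    have e2 : s / (b - a) - a / (b - a) ≤ 1 ↔ s ≤ b := by
      rw [← sub_div, div_le_one hk, sub_le_sub_iff_right]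
    rw [e1, e2]
  rw [hset, measureReal_def, Real.volume_preimage_mul_right (inv_ne_zero hk.ne'), inv_inv,
    abs_of_pos hk, ENNReal.toReal_mul, ENNReal.toReal_ofReal hk.le, measure_preimage_add_right]
  rfl

lemma neg_mem_testFunctions {ε : ℝ} {x : ℝ × ℝ} {φ : ℝ → ℝ} {a b : ℝ}
    (h : φ ∈ testFunctions a b ε x) : (fun s => -φ s) ∈ testFunctions a b ε (-x.1, x.2) := by
  have havg : ∀ c d : ℝ, (⨍ t in c..d, -φ t) = -⨍ t in c..d, φ t := fun c d => by
    simp only [interval_average_eq_div, intervalIntegral.integral_neg, neg_div]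
  have habs : ∀ c d s : ℝ, |-φ s - ⨍ t in c..d, -φ t| = |φ s - ⨍ t in c..d, φ t| :=
    fun c d s => by rw [havg, ← abs_neg]; congr 1; ring
  refine ⟨⟨h.1.1.neg, fun c d hac hcd hdb => ?_⟩, ?_, ?_⟩
  · unfold meanSqOsc
    simp_rw [habs]
    exact h.1.2 c d hac hcd hdb
  · rw [havg, h.2.1]
  · simpa using h.2.2

end Transport

/-! ### Lower bounds: extremal functions on the unit interval -/

/-- There is a test function on `[0, 1]` whose superlevel set has measure at least `B`. -/
def Attains (ε lam : ℝ) (x : ℝ × ℝ) (B : ℝ) : Prop :=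
  ∃ φ ∈ testFunctions 0 1 ε x, B ≤ volume.real {s : ℝ | s ∈ Icc (0 : ℝ) 1 ∧ lam ≤ |φ s|}

lemma Attains.of_abs {ε lam B : ℝ} {x : ℝ × ℝ} (h : Attains ε lam (|x.1|, x.2) B) :
    Attains ε lam x B := by
  rcases abs_cases x.1 with ⟨e, -⟩ | ⟨e, -⟩ <;> rw [e] at h
  · exact h
  · obtain ⟨φ, hφ, hB⟩ := h
    refine ⟨fun s => -φ s, ?_, ?_⟩
    · simpa using neg_mem_testFunctions hφ
    · simpa using hB

lemma bellman_eq {a b ε lam B : ℝ} (hab : a < b) {x : ℝ × ℝ}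
    (hup : ∀ φ ∈ testFunctions a b ε x,
      volume.real {s : ℝ | s ∈ Icc a b ∧ lam ≤ |φ s|} ≤ (b - a) * B)
    (hlow : Attains ε lam (|x.1|, x.2) B) : bellman a b x lam ε = B := by
  have hk : 0 < b - a := sub_pos.2 hab
  obtain ⟨φ, hφ, hB⟩ := hlow.of_abs
  have hmem : ∃ φ ∈ testFunctions a b ε x,
      (b - a) * B ≤ volume.real {s : ℝ | s ∈ Icc a b ∧ lam ≤ |φ s|} := by
    refine ⟨_, testFunctions_comp_affine hab hφ, ?_⟩
    rw [measure_superlevel_comp_affine hab]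
    exact mul_le_mul_of_nonneg_left hB hk.le
  obtain ⟨ψ, hψ, hψB⟩ := hmem
  have hub : ∀ m ∈ {m : ℝ | ∃ φ ∈ testFunctions a b ε x,
      m = volume.real {s : ℝ | s ∈ Icc a b ∧ lam ≤ |φ s|}}, m ≤ (b - a) * B := by
    rintro m ⟨φ, hφ, rfl⟩
    exact hup φ hφ
  have hsup : sSup {m : ℝ | ∃ φ ∈ testFunctions a b ε x,
      m = volume.real {s : ℝ | s ∈ Icc a b ∧ lam ≤ |φ s|}} = (b - a) * B :=
    le_antisymm (csSup_le ⟨_, ψ, hψ, rfl⟩ hub) (hψB.trans (le_csSup ⟨_, hub⟩ ⟨ψ, hψ, rfl⟩))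
  rw [bellman, hsup]
  field_simp

lemma le_measure_superlevel {φ : ℝ → ℝ} {lam p q : ℝ} (hp : 0 ≤ p) (hq : 0 ≤ q) (hpq : p + q ≤ 1)
    (h1 : ∀ s, 0 ≤ s → s < p → lam ≤ |φ s|) (h2 : ∀ s, 1 - q < s → s ≤ 1 → lam ≤ |φ s|) :
    p + q ≤ volume.real {s : ℝ | s ∈ Icc (0 : ℝ) 1 ∧ lam ≤ |φ s|} := by
  have hsub : Ico 0 p ∪ Ioc (1 - q) 1 ⊆ {s : ℝ | s ∈ Icc (0 : ℝ) 1 ∧ lam ≤ |φ s|} := by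
    rintro s (⟨e1, e2⟩ | ⟨e1, e2⟩)
    · exact ⟨⟨e1, by linarith⟩, h1 s e1 e2⟩
    · exact ⟨⟨by linarith, e2⟩, h2 s e1 e2⟩
  have hdisj : Disjoint (Ico 0 p) (Ioc (1 - q) 1) := by
    rw [Set.disjoint_left]
    rintro s ⟨-, e2⟩ ⟨e3, -⟩
    linarith
  have hm := measureReal_mono (μ := volume) hsub
    ((measure_mono fun s hs => hs.1).trans_lt (by simp : volume (Icc (0 : ℝ) 1) < ⊤)).ne
  rw [measureReal_union hdisj measurableSet_Ioc (by simp) (by simp), Real.volume_real_Ico_of_le hp,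
    Real.volume_real_Ioc_of_le (by linarith)] at hm
  linarith

section TwoLevels

variable {ε lam u h p : ℝ}

lemma two_level_mem (hε : 0 ≤ ε) (hh : 0 ≤ h) (hh2 : h ≤ 2 * ε) (hp : 0 ≤ p) (hp1 : p ≤ 1) {x : ℝ × ℝ}
    (h1 : x.1 = u + h * p) (h2 : x.2 = u ^ 2 + (2 * u + h) * (h * p)) :
    twoSided u (fun _ => 0) (step h p) ∈ testFunctions 0 1 ε x := by
  have pL : IsProfile 0 fun _ : ℝ => (0 : ℝ) := (isTail_zero 1).toIsProfile
  have pR := isProfile_step hh hp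
  refine twoSided_mem_testFunctions pL pR (by linarith) ?_ ?_ fun c d hc hcd hd => ⟨u,
    variance_le_of_range hcd.le hε (intervalIntegrable_twoSided pL pR c d)
      (intervalIntegrable_twoSided_sq pL pR (by linarith) c d) fun s _ => ?_⟩
  · rw [integral_step_self hp, h1]
    simp
  · rw [integral_step_sq hp hp le_rfl, h1, h2]
    simp
    ring
  · unfold twoSided step
    split_ifs <;> constructor <;> linarith

lemma attains_two_level (hε : 0 ≤ ε) (hh : 0 ≤ h) (hh2 : h ≤ 2 * ε) (hp : 0 ≤ p) (hp1 : p ≤ 1)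
    {x : ℝ × ℝ} (h1 : x.1 = u + h * p) (h2 : x.2 = u ^ 2 + (2 * u + h) * (h * p))
    (hl : lam ≤ |u + h|) : Attains ε lam x p := by
  refine ⟨_, two_level_mem hε hh hh2 hp hp1 h1 h2, ?_⟩
  have := le_measure_superlevel (φ := twoSided u (fun _ => 0) (step h p)) (lam := lam) le_rfl hp
    (by linarith) (fun s e1 e2 => by linarith) fun s e1 e2 => by
      unfold twoSided
      rwa [step_of_lt (by linarith), sub_zero]
  linarith

lemma attains_one_of_forall {x : ℝ × ℝ} {φ : ℝ → ℝ} (hφ : φ ∈ testFunctions 0 1 ε x)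
    (hl : ∀ s, lam ≤ |φ s|) : Attains ε lam x 1 := by
  refine ⟨φ, hφ, ?_⟩
  have := le_measure_superlevel (φ := φ) (lam := lam) zero_le_one le_rfl (by norm_num)
    (fun s _ _ => hl s) fun s _ _ => hl s
  linarith

lemma attains_one_two_level (hε : 0 ≤ ε) (hh : 0 ≤ h) (hh2 : h ≤ 2 * ε) (hp : 0 ≤ p) (hp1 : p ≤ 1)
    {x : ℝ × ℝ} (h1 : x.1 = u + h * p) (h2 : x.2 = u ^ 2 + (2 * u + h) * (h * p))
    (hl : lam ≤ |u + h|) (hl' : lam ≤ |u|) : Attains ε lam x 1 := by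
  refine attains_one_of_forall (two_level_mem hε hh hh2 hp hp1 h1 h2) fun s => ?_
  unfold twoSided step
  split_ifs <;> simpa

end TwoLevels

lemma testFunctions_nonempty_unit {ε : ℝ} (hε : 0 ≤ ε) {x : ℝ × ℝ} (hx : x ∈ strip ε) :
    (testFunctions 0 1 ε x).Nonempty := by
  have h0 : 0 ≤ x.2 - x.1 ^ 2 := by linarith [hx.1]
  have hsq := Real.sq_sqrt h0
  -- The values are mean plus and minus standard deviation, each on half the interval.
  refine ⟨_, two_level_mem (u := x.1 - √(x.2 - x.1 ^ 2)) (h := 2 * √(x.2 - x.1 ^ 2)) (p := 1 / 2)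
    hε (by positivity) ?_ (by norm_num) (by norm_num) (by ring) ?_⟩
  · have : √(x.2 - x.1 ^ 2) ≤ ε := Real.sqrt_le_iff.2 ⟨hε, by linarith [hx.2]⟩
    linarith
  · linear_combination -hsq

section ThreeLevels

variable {ε lam A B : ℝ}

lemma attains_three_level (hlam : 0 < lam) (hA : 0 ≤ A) (hB : 0 ≤ B) (hAB : A + B ≤ 1)
    (h : ∀ c d, 0 ≤ c → c < d → d ≤ 1 → ∃ w,
      (d - c) * (∫ s in c..d, (twoSided 0 (step lam A) (step lam B) s - w) ^ 2)
        - (∫ s in c..d, (twoSided 0 (step lam A) (step lam B) s - w)) ^ 2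
        ≤ ε ^ 2 * (d - c) ^ 2) :
    Attains ε lam (lam * (B - A), lam ^ 2 * (A + B)) (A + B) := by
  refine ⟨_, twoSided_mem_testFunctions (isProfile_step hlam.le hA) (isProfile_step hlam.le hB)
    hAB ?_ ?_ h, le_measure_superlevel hA hB hAB ?_ ?_⟩
  · rw [integral_step_self hA, integral_step_self hB]
    ring
  · rw [integral_step_sq hA hA le_rfl, integral_step_sq hB hB le_rfl]
    ring
  · intro s h1 h2
    unfold twoSided
    rw [step_of_lt h2, step_of_le (by linarith), zero_sub, add_zero, abs_neg, abs_of_pos hlam]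
  · intro s h1 h2
    unfold twoSided
    rw [step_of_le (by linarith), step_of_lt (by linarith), sub_zero, zero_add, abs_of_pos hlam]

lemma attains_three_level_of_le (hlam : 0 < lam) (hl : lam ≤ ε) (hA : 0 ≤ A) (hB : 0 ≤ B)
    (hAB : A + B ≤ 1) : Attains ε lam (lam * (B - A), lam ^ 2 * (A + B)) (A + B) := by
  have pL := isProfile_step hlam.le hA
  have pR := isProfile_step hlam.le hB
  refine attains_three_level hlam hA hB hAB fun c d hc hcd hd => ⟨-lam,
    variance_le_of_range hcd.le (by linarith) (intervalIntegrable_twoSided pL pR c d)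
      (intervalIntegrable_twoSided_sq pL pR hAB c d) fun s _ => ?_⟩
  unfold twoSided step
  split_ifs <;> constructor <;> linarith

lemma attains_three_level_of_ge (hε : 0 < ε) (hl : ε ≤ lam) (hl2 : lam ≤ 2 * ε) (hA : 0 ≤ A)
    (hAB' : A ≤ B) (hAB : A + B ≤ 1)
    (hV : lam ^ 2 * (A + B) - (lam * (B - A)) ^ 2 ≤ ε ^ 2)
    (hcond : 4 * A * (lam - ε) ≤ (2 * ε - lam) * (1 - A - B) ∨ lam * (B - A) ≤ lam - ε) :
    Attains ε lam (lam * (B - A), lam ^ 2 * (A + B)) (A + B) := by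
  have hlam : 0 < lam := hε.trans_le hl
  have hB := hA.trans hAB'
  have pL := isProfile_step hlam.le hA
  have pR := isProfile_step hlam.le hB
  refine attains_three_level hlam hA hB hAB fun c d hc hcd hd => ?_
  rcases le_or_gt A c with h1 | h1
  · refine ⟨0, variance_le_of_range hcd.le (by linarith) (intervalIntegrable_twoSided pL pR c d)
      (intervalIntegrable_twoSided_sq pL pR hAB c d) fun s hs => ?_⟩
    unfold twoSided
    rw [step_of_le (h1.trans hs.1)]
    unfold step
    split_ifs <;> constructor <;> linarith
  rcases le_or_gt d (1 - B) with h2 | h2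
  · refine ⟨-lam, variance_le_of_range hcd.le (by linarith) (intervalIntegrable_twoSided pL pR c d)
      (intervalIntegrable_twoSided_sq pL pR hAB c d) fun s hs => ?_⟩
    unfold twoSided
    rw [step_of_le (show B ≤ 1 - s by linarith [hs.2])]
    unfold step
    split_ifs <;> constructor <;> linarith
  refine ⟨0, ?_⟩
  rw [integral_twoSided pL pR, integral_twoSided_sq pL pR hAB,
    integral_step hlam.le hA h1.le (by linarith), integral_step_sq hA h1.le (by linarith),
    integral_step hlam.le hB (by linarith) (by linarith),
    integral_step_sq hB (by linarith) (by linarith)]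
  have := three_levels_variance (A := A) (B := B) (M := 1 - A - B) (a := A - c)
    (b := B - (1 - d)) hε hl (by linarith) (by linarith) (by linarith) hAB' (by linarith)
    (by linarith) (by rw [show 1 - A - B + A + B = 1 by ring]; linarith)
    (by rwa [show 1 - A - B + A + B = 1 by ring, mul_one])
  have e : 1 - A - B + (A - c) + (B - (1 - d)) = d - c := by ring
  rw [e] at this
  refine le_trans (le_of_eq ?_) this
  ring

end ThreeLevels

section Regions

variable {ε lam : ℝ} {x : ℝ × ℝ}

lemma snd_eq_sub_radius_sq (hx : x ∈ strip ε) : x.2 = x.1 ^ 2 + ε ^ 2 - radius ε x ^ 2 := by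
  linear_combination radius_sq hx

/-- `x` lies on the chord of the lower boundary from abscissa `u = (lam * x.1 - x.2) / (lam - x.1)`
to `lam`; the function takes these two values, and `hle` says `lam - u ≤ 2 * ε`. -/
lemma attains_chord (h0 : x.1 ^ 2 ≤ x.2) (hlt : x.1 < lam) (hε : 0 ≤ ε)
    (hle : lam ^ 2 - 2 * lam * x.1 + x.2 ≤ 2 * ε * (lam - x.1)) :
    Attains ε lam x ((x.2 - x.1 ^ 2) / (x.2 + lam ^ 2 - 2 * lam * x.1)) := by
  have hD : 0 < lam - x.1 := sub_pos.2 hlt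
  have hW : 0 < x.2 + lam ^ 2 - 2 * lam * x.1 := by nlinarith
  have hp : (x.2 + lam ^ 2 - 2 * lam * x.1) / (lam - x.1) *
      ((x.2 - x.1 ^ 2) / (x.2 + lam ^ 2 - 2 * lam * x.1)) = (x.2 - x.1 ^ 2) / (lam - x.1) := by
    rw [div_mul_div_comm, mul_comm (lam - x.1), mul_div_mul_left _ _ hW.ne']
  refine attains_two_level (u := (lam * x.1 - x.2) / (lam - x.1))
    (h := (x.2 + lam ^ 2 - 2 * lam * x.1) / (lam - x.1)) hε (by positivity) ?_
    (div_nonneg (by linarith) hW.le) ((div_le_one hW).2 (by nlinarith)) ?_ ?_ ?_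
  · rw [div_le_iff₀ hD]; linarith
  · rw [hp]; field_simp; ring
  · rw [hp]; field_simp; ring
  · have : (lam * x.1 - x.2) / (lam - x.1) + (x.2 + lam ^ 2 - 2 * lam * x.1) / (lam - x.1) = lam := by
      field_simp; ring
    rw [this]
    exact le_abs_self lam

/-- `x` lies on the chord between the abscissae `s - ε` and `s + ε`, which touches the upper
boundary at `s`; both values are at least `lam`. -/
lemma attains_one_of_right (hε : 0 < ε) (hx : x ∈ strip ε)
    (hs : lam + ε ≤ x.1 + radius ε x) : Attains ε lam x 1 := by
  have hr := radius_nonneg ε x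
  have hr' := radius_le hε.le hx
  have hp : 2 * ε * ((ε - radius ε x) / (2 * ε)) = ε - radius ε x := by field_simp
  refine attains_one_two_level (u := x.1 + radius ε x - ε) (h := 2 * ε)
    (p := (ε - radius ε x) / (2 * ε)) hε.le (by linarith) le_rfl
    (div_nonneg (by linarith) (by linarith)) ((div_le_one (by linarith)).2 (by linarith)) ?_ ?_ ?_ ?_
  · rw [hp]; ring
  · rw [hp, snd_eq_sub_radius_sq hx]; ring
  · exact le_trans (by linarith) (le_abs_self _)
  · exact le_trans (by linarith) (le_abs_self _)

lemma attains_one_of_sq_le_of_le (hε : 0 < ε) (hx : x ∈ strip ε)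
    (hx2 : lam ^ 2 ≤ x.2) (hle : x.2 ≤ ε ^ 2) : Attains ε lam x 1 := by
  have h0 : 0 ≤ x.2 := (sq_nonneg _).trans hx.1
  have hsq := Real.sq_sqrt h0
  have hσ := Real.sqrt_nonneg x.2
  have hσε : √x.2 ≤ ε := Real.sqrt_le_iff.2 ⟨hε.le, hle⟩
  have hlσ : lam ≤ √x.2 := Real.le_sqrt_of_sq_le hx2
  have hx1 : |x.1| ≤ √x.2 := Real.abs_le_sqrt hx.1
  obtain ⟨e1, e2⟩ := abs_le.1 hx1
  have hp : 2 * √x.2 * ((x.1 + √x.2) / (2 * √x.2)) = x.1 + √x.2 := by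
    rcases hσ.eq_or_lt with h | h
    · rw [← h] at e1 e2 ⊢
      have : x.1 = 0 := by linarith
      simp [this]
    · field_simp
  refine attains_one_two_level (u := -√x.2) (h := 2 * √x.2)
    (p := (x.1 + √x.2) / (2 * √x.2)) hε.le (by linarith) (by linarith)
    (div_nonneg (by linarith) (by linarith)) (div_le_one_of_le₀ (by linarith) (by linarith)) ?_ ?_ ?_ ?_
  · rw [hp]; ring
  · rw [hp]; linear_combination -hsq
  · refine le_trans ?_ (le_abs_self _)
    linarith
  · rwa [abs_neg, abs_of_nonneg hσ]

/-- The left tail descends from `p + ε` to no lower than `ε` and then jumps to `-ε`, so `|φ|` never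
falls below `ε`. -/
lemma attains_one_of_le_sq (hε : 0 < ε) (hl : lam ≤ ε) (hx : x ∈ strip ε) (hx1 : 0 ≤ x.1)
    (hle : ε ^ 2 ≤ x.2) : Attains ε lam x 1 := by
  have hr := radius_nonneg ε x
  have hr' := radius_le hε.le hx
  have hsnd := snd_eq_sub_radius_sq hx
  have hw : 0 ≤ x.1 - radius ε x := by
    have : radius ε x ^ 2 ≤ x.1 ^ 2 := by linarith
    linarith [(sq_le_sq₀ hr hx1).1 this]
  have hα : 0 ≤ 1 - radius ε x / ε := sub_nonneg.2 ((div_le_one hε).2 hr')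
  have hα1 : 1 - radius ε x / ε ≤ 1 := by
    have := div_nonneg hr hε.le
    linarith
  obtain ⟨g, hg, hg1, hg2⟩ := exists_jump_tail hε hα hw
  have hmem := twoSided_tail_mem (v := x.1 - radius ε x + ε) hε hg (isTail_zero ε)
    (by simpa using hα1) (by simpa using sq_nonneg _)
  have hxe : (x.1 - radius ε x + ε + ε * (0 - (1 - radius ε x / ε)),
      (x.1 - radius ε x + ε) ^ 2 + 2 * (x.1 - radius ε x + ε) * ε * (0 - (1 - radius ε x / ε))
        + 2 * ε ^ 2 * (1 - radius ε x / ε + 0)) = x := by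
    refine Prod.ext ?_ ?_ <;> simp only
    · field_simp; ring
    · rw [hsnd]; field_simp; ring
  rw [hxe] at hmem
  refine attains_one_of_forall hmem fun s => ?_
  unfold twoSided
  rcases lt_or_ge s ((1 - radius ε x / ε) * Real.exp (-(x.1 - radius ε x) / ε) / 2) with h | h
  · rw [hg1 s h, show x.1 - radius ε x + ε - (x.1 - radius ε x + 2 * ε) + 0 = -ε by ring, abs_neg,
      abs_of_pos hε]
    exact hl
  · have := hg2 s h
    exact le_trans (by linarith) (le_abs_self _)

/-- The right tail starts from the level `s - ε`; its weight `1 - radius ε x / ε` records the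
position of `x` on the tangent segment. It climbs to `lam - 2 * ε` and jumps to `lam`. -/
lemma attains_tangent (hε : 0 < ε) (hx : x ∈ strip ε)
    (hs : x.1 + radius ε x ≤ lam - ε) :
    Attains ε lam x ((1 - radius ε x / ε) *
      Real.exp (-(lam - ε - (x.1 + radius ε x)) / ε) / 2) := by
  have hr := radius_nonneg ε x
  have hr' := radius_le hε.le hx
  have hsnd := snd_eq_sub_radius_sq hx
  have hα : 0 ≤ 1 - radius ε x / ε := sub_nonneg.2 ((div_le_one hε).2 hr')
  have hα1 : 1 - radius ε x / ε ≤ 1 := by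
    have := div_nonneg hr hε.le
    linarith
  have hq : 0 ≤ lam - ε - (x.1 + radius ε x) := by linarith
  obtain ⟨g, hg, hg1, -⟩ := exists_jump_tail hε hα hq
  have hmem := twoSided_tail_mem (v := x.1 + radius ε x - ε) hε (isTail_zero ε) hg
    (by simpa using hα1) (by simpa using sq_nonneg _)
  have hxe : (x.1 + radius ε x - ε + ε * ((1 - radius ε x / ε) - 0),
      (x.1 + radius ε x - ε) ^ 2 + 2 * (x.1 + radius ε x - ε) * ε * ((1 - radius ε x / ε) - 0)
        + 2 * ε ^ 2 * (0 + (1 - radius ε x / ε))) = x := by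
    refine Prod.ext ?_ ?_ <;> simp only
    · field_simp; ring
    · rw [hsnd]; field_simp; ring
  rw [hxe] at hmem
  have hexp : Real.exp (-(lam - ε - (x.1 + radius ε x)) / ε) ≤ 1 :=
    Real.exp_le_one_iff.2 (div_nonpos_of_nonpos_of_nonneg (by linarith) hε.le)
  have hmass : (1 - radius ε x / ε) * Real.exp (-(lam - ε - (x.1 + radius ε x)) / ε) ≤ 1 :=
    mul_le_one₀ hα1 (Real.exp_pos _).le hexp
  have hmass0 : 0 ≤ (1 - radius ε x / ε) * Real.exp (-(lam - ε - (x.1 + radius ε x)) / ε) / 2 := by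
    positivity
  refine ⟨_, hmem, ?_⟩
  refine le_trans (by rw [zero_add]) (le_measure_superlevel le_rfl hmass0 (by linarith)
    (fun s e1 e2 => by linarith) fun s e1 e2 => ?_)
  unfold twoSided
  rw [hg1 (1 - s) (by linarith)]
  exact le_trans (by linarith) (le_abs_self _)

/-- Since `(1 - α - β) ^ 2 - 4 * α * β = 1 - 2 * (α + β) + (β - α) ^ 2`, the gluing condition says
that the point is below the upper boundary. -/
lemma four_mul_le_of_variance {ε α β y y2 : ℝ} (hε : 0 < ε) (hα : 2 * ε ^ 2 * (α + β) = y2)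
    (hβ : ε * (β - α) = y) (h : y2 - y ^ 2 ≤ ε ^ 2) : 4 * α * β ≤ (1 - α - β) ^ 2 := by
  rw [← hα, ← hβ] at h
  have : ε ^ 2 * (2 * (α + β) - (β - α) ^ 2) ≤ ε ^ 2 * 1 := by linarith
  have := le_of_mul_le_mul_left this (by positivity)
  linarith

/-- Tails on both sides of the level `0` reach `-lam` and `lam` by their final jumps; the two
moments of `x` determine their weights. -/
lemma attains_angle_zero (hε : 0 < ε) (hlam : 2 * ε ≤ lam) (hx : x ∈ strip ε) (hx1 : 0 ≤ x.1)
    (hx1' : x.1 ≤ ε) (hx2 : 2 * ε * x.1 ≤ x.2) :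
    Attains ε lam x (x.2 / (4 * ε ^ 2) * Real.exp (2 - lam / ε)) := by
  obtain ⟨α, hα⟩ : ∃ α, α = (x.2 / (2 * ε ^ 2) - x.1 / ε) / 2 := ⟨_, rfl⟩
  obtain ⟨β, hβ⟩ : ∃ β, β = (x.2 / (2 * ε ^ 2) + x.1 / ε) / 2 := ⟨_, rfl⟩
  have e1 : 2 * ε ^ 2 * (α + β) = x.2 := by rw [hα, hβ]; field_simp; ring
  have e2 : ε * (β - α) = x.1 := by rw [hα, hβ]; field_simp; ring
  have hα0 : 0 ≤ α := by
    have : 0 ≤ 4 * ε ^ 2 * α := by nlinarith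
    exact nonneg_of_mul_nonneg_right this (by positivity)
  have hβ0 : 0 ≤ β := by nlinarith
  have hαβ : α + β ≤ 1 := by
    have : 2 * ε ^ 2 * (α + β) ≤ 2 * ε ^ 2 * 1 := by
      rw [e1]; nlinarith [hx.2]
    exact le_of_mul_le_mul_left this (by positivity)
  have hq : 0 ≤ lam - 2 * ε := by linarith
  obtain ⟨gL, hgL, hL, -⟩ := exists_jump_tail hε hα0 hq
  obtain ⟨gR, hgR, hR, -⟩ := exists_jump_tail hε hβ0 hq
  have hmem := twoSided_tail_mem (v := 0) hε hgL hgR hαβ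
    (four_mul_le_of_variance hε e1 e2 (by linarith [hx.2]))
  have hxe : ((0 : ℝ) + ε * (β - α), (0 : ℝ) ^ 2 + 2 * 0 * ε * (β - α) + 2 * ε ^ 2 * (α + β)) = x := by
    refine Prod.ext ?_ ?_ <;> simp only
    · rw [e2]; ring
    · rw [e1]; ring
  rw [hxe] at hmem
  have hexp : Real.exp (-(lam - 2 * ε) / ε) = Real.exp (2 - lam / ε) := by
    congr 1; field_simp; ring
  have hexp1 : Real.exp (-(lam - 2 * ε) / ε) ≤ 1 :=
    Real.exp_le_one_iff.2 (div_nonpos_of_nonpos_of_nonneg (by linarith) hε.le)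
  have hpos := (Real.exp_pos (-(lam - 2 * ε) / ε)).le
  have hA := mul_le_of_le_one_right hα0 hexp1
  have hB := mul_le_of_le_one_right hβ0 hexp1
  have hA0 := mul_nonneg hα0 hpos
  have hB0 := mul_nonneg hβ0 hpos
  refine ⟨_, hmem, le_trans (le_of_eq ?_) (le_measure_superlevel
    (p := α * Real.exp (-(lam - 2 * ε) / ε) / 2) (q := β * Real.exp (-(lam - 2 * ε) / ε) / 2)
    (by linarith) (by linarith) (by linarith) (fun s s1 s2 => ?_) fun s s1 s2 => ?_)⟩
  · rw [← e1, hexp]; field_simp; ring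
  · unfold twoSided
    rw [hL s s2, hgR.zero (1 - s) (by linarith)]
    rw [show 0 - (lam - 2 * ε + 2 * ε) + 0 = -lam by ring, abs_neg]
    exact le_abs_self _
  · unfold twoSided
    rw [hR (1 - s) (by linarith), hgL.zero s (by linarith)]
    exact le_trans (by linarith) (le_abs_self _)

/-- The weights of the two tails joined at `lam`. -/
lemma exists_angle_weights (hε : 0 < ε) (hx : x ∈ strip ε) (hx1 : lam - ε ≤ x.1)
    (hx1' : x.1 ≤ lam + ε)
    (h1 : 2 * lam * x.1 - lam ^ 2 + 2 * ε * (x.1 - lam) ≤ x.2)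
    (h2 : 2 * lam * x.1 - lam ^ 2 - 2 * ε * (x.1 - lam) ≤ x.2) :
    ∃ α β, 0 ≤ α ∧ 0 ≤ β ∧ α + β ≤ 1 ∧ 4 * α * β ≤ (1 - α - β) ^ 2 ∧
      2 * ε ^ 2 * (α + β) = x.2 - 2 * lam * x.1 + lam ^ 2 ∧ ε * (β - α) = x.1 - lam := by
  obtain ⟨α, hα⟩ : ∃ α, α = ((x.2 - 2 * lam * x.1 + lam ^ 2) / (2 * ε ^ 2) - (x.1 - lam) / ε) / 2 :=
    ⟨_, rfl⟩
  obtain ⟨β, hβ⟩ : ∃ β, β = ((x.2 - 2 * lam * x.1 + lam ^ 2) / (2 * ε ^ 2) + (x.1 - lam) / ε) / 2 :=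
    ⟨_, rfl⟩
  have e1 : 2 * ε ^ 2 * (α + β) = x.2 - 2 * lam * x.1 + lam ^ 2 := by
    rw [hα, hβ]; field_simp; ring
  have e2 : ε * (β - α) = x.1 - lam := by rw [hα, hβ]; field_simp; ring
  refine ⟨α, β, ?_, ?_, ?_, four_mul_le_of_variance hε e1 e2 (by linarith [hx.2]), e1, e2⟩
  · have : 0 ≤ 4 * ε ^ 2 * α := by nlinarith
    exact nonneg_of_mul_nonneg_right this (by positivity)
  · have : 0 ≤ 4 * ε ^ 2 * β := by nlinarith
    exact nonneg_of_mul_nonneg_right this (by positivity)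
  · have : 2 * ε ^ 2 * (α + β) ≤ 2 * ε ^ 2 * 1 := by
      rw [e1]; nlinarith [hx.2]
    exact le_of_mul_le_mul_left this (by positivity)

/-- With `q = 0` the tails at the level `lam` are single jumps of `2 * ε`; only the downward jump,
of length `α / 2`, is discarded. -/
lemma attains_angle_of_ge (hε : 0 < ε) (hx : x ∈ strip ε) (hx1 : lam - ε ≤ x.1)
    (hx1' : x.1 ≤ lam + ε)
    (h1 : 2 * lam * x.1 - lam ^ 2 + 2 * ε * (x.1 - lam) ≤ x.2)
    (h2 : 2 * lam * x.1 - lam ^ 2 - 2 * ε * (x.1 - lam) ≤ x.2) :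
    Attains ε lam x (1 - (x.2 - 2 * (lam + ε) * x.1 + lam ^ 2 + 2 * ε * lam) / (8 * ε ^ 2)) := by
  obtain ⟨α, β, hα, hβ, hαβ, hs, e1, e2⟩ := exists_angle_weights hε hx hx1 hx1' h1 h2
  obtain ⟨gL, hgL, hL, hL'⟩ := exists_jump_tail hε hα le_rfl
  obtain ⟨gR, hgR, hR, -⟩ := exists_jump_tail hε hβ le_rfl
  simp only [neg_zero, zero_div, Real.exp_zero, mul_one] at hL hL' hR
  have hmem := twoSided_tail_mem (v := lam) hε hgL hgR hαβ hs
  have hxe : (lam + ε * (β - α), lam ^ 2 + 2 * lam * ε * (β - α) + 2 * ε ^ 2 * (α + β)) = x := by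
    refine Prod.ext ?_ ?_ <;> simp only
    · rw [e2]; ring
    · rw [e1]; linear_combination 2 * lam * e2
  rw [hxe] at hmem
  refine ⟨_, hmem, le_trans (le_of_eq ?_) (le_measure_superlevel (p := 0) (q := 1 - α / 2)
    le_rfl (by linarith) (by linarith) (fun s s1 s2 => by linarith) fun s s1 s2 => ?_)⟩
  · have : x.2 - 2 * (lam + ε) * x.1 + lam ^ 2 + 2 * ε * lam = 4 * ε ^ 2 * α := by
      linear_combination -e1 + 2 * ε * e2
    rw [this]; field_simp; ring
  · unfold twoSided
    have a1 := hL' s (by linarith)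
    have a2 := hgR.toIsProfile.apply_nonneg (1 - s)
    exact le_trans (by linarith) (le_abs_self _)

/-- Here a left tail with depths `2 * lam` and `lam` yields the values `-lam` and `0`; the part at
`-lam` counts again, and only the part at `0` is lost. -/
lemma attains_angle_of_le (hε : 0 < ε) (hl : ε < lam) (hl2 : lam ≤ 2 * ε) (hx : x ∈ strip ε)
    (hx1 : lam - ε ≤ x.1) (hx1' : x.1 ≤ lam + ε)
    (h1 : 2 * lam * x.1 - lam ^ 2 + 2 * ε * (x.1 - lam) ≤ x.2)
    (h2 : 2 * lam * x.1 - lam ^ 2 - 2 * ε * (x.1 - lam) ≤ x.2) :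
    Attains ε lam x ((2 * (lam ^ 2 - ε ^ 2) * x.1 - (lam - ε) * x.2
      + lam * (2 * ε ^ 2 + ε * lam - lam ^ 2)) / (2 * ε * lam ^ 2)) := by
  have hlam : 0 < lam := hε.trans hl
  obtain ⟨α, β, hα, hβ, hαβ, hs, e1, e2⟩ := exists_angle_weights hε hx hx1 hx1' h1 h2
  obtain ⟨gL, hgL, hL, hL'⟩ := exists_two_step_tail hε hl hl2 hα
  obtain ⟨gR, hgR, hR, -⟩ := exists_jump_tail hε hβ le_rfl
  have hmem := twoSided_tail_mem (v := lam) hε hgL hgR hαβ hs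
  have hxe : (lam + ε * (β - α), lam ^ 2 + 2 * lam * ε * (β - α) + 2 * ε ^ 2 * (α + β)) = x := by
    refine Prod.ext ?_ ?_ <;> simp only
    · rw [e2]; ring
    · rw [e1]; linear_combination 2 * lam * e2
  rw [hxe] at hmem
  have hp0 : 0 ≤ (2 * ε ^ 2 - ε * lam) / (2 * lam ^ 2) := div_nonneg (by nlinarith) (by positivity)
  have hpr : (2 * ε ^ 2 - ε * lam) / (2 * lam ^ 2) ≤
      (3 * ε * lam - 2 * ε ^ 2) / (2 * lam ^ 2) := by
    gcongr ?_ / _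
    nlinarith
  have hr1 : (3 * ε * lam - 2 * ε ^ 2) / (2 * lam ^ 2) ≤ 1 :=
    (div_le_one (by positivity)).2 (by nlinarith [sq_nonneg (4 * lam - 3 * ε)])
  have hval : α * ((2 * ε ^ 2 - ε * lam) / (2 * lam ^ 2))
      + (1 - α * ((3 * ε * lam - 2 * ε ^ 2) / (2 * lam ^ 2))) =
      (2 * (lam ^ 2 - ε ^ 2) * x.1 - (lam - ε) * x.2
        + lam * (2 * ε ^ 2 + ε * lam - lam ^ 2)) / (2 * ε * lam ^ 2) := by
    have ex1 : x.1 = lam + ε * (β - α) := by linarith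
    have ex2 : x.2 = lam ^ 2 + 2 * lam * ε * (β - α) + 2 * ε ^ 2 * (α + β) := by
      linear_combination -e1 - 2 * lam * e2
    rw [ex1, ex2]
    field_simp
    ring
  generalize (2 * ε ^ 2 - ε * lam) / (2 * lam ^ 2) = P at *
  generalize (3 * ε * lam - 2 * ε ^ 2) / (2 * lam ^ 2) = R at *
  have b1 : 0 ≤ α * P := mul_nonneg hα hp0
  have b2 : α * P ≤ α * R := mul_le_mul_of_nonneg_left hpr hα
  have b3 : α * R ≤ α := mul_le_of_le_one_right hα hr1
  refine ⟨_, hmem, le_trans hval.ge (le_measure_superlevel b1 (by linarith) (by linarith)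
    (fun s s1 s2 => ?_) fun s s1 s2 => ?_)⟩
  · unfold twoSided
    rw [hL s s2, hgR.zero (1 - s) (by linarith), show lam - 2 * lam + 0 = -lam by ring, abs_neg]
    exact le_abs_self _
  · unfold twoSided
    rw [hL' s (by linarith)]
    have a2 := hgR.toIsProfile.apply_nonneg (1 - s)
    exact le_trans (by linarith) (le_abs_self _)

lemma attains_chebyshev_of_le (hlam : 0 < lam) (hl : lam ≤ ε) (hx1 : lam * x.1 ≤ x.2)
    (hx2 : x.2 ≤ lam ^ 2) (hx0 : 0 ≤ x.1) : Attains ε lam x (x.2 / lam ^ 2) := by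
  obtain ⟨A, hA⟩ : ∃ A, A = (x.2 / lam ^ 2 - x.1 / lam) / 2 := ⟨_, rfl⟩
  obtain ⟨B, hB⟩ : ∃ B, B = (x.2 / lam ^ 2 + x.1 / lam) / 2 := ⟨_, rfl⟩
  have e1 : lam ^ 2 * (A + B) = x.2 := by rw [hA, hB]; field_simp; ring
  have e2 : lam * (B - A) = x.1 := by rw [hA, hB]; field_simp; ring
  have hA0 : 0 ≤ A := by
    have : 0 ≤ 2 * lam ^ 2 * A := by nlinarith
    exact nonneg_of_mul_nonneg_right this (by positivity)
  have hB0 : 0 ≤ B := by nlinarith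
  have hAB : A + B ≤ 1 :=
    le_of_mul_le_mul_left (show lam ^ 2 * (A + B) ≤ lam ^ 2 * 1 by linarith) (by positivity)
  have := attains_three_level_of_le hlam hl hA0 hB0 hAB
  rwa [e1, e2, show A + B = x.2 / lam ^ 2 by rw [← e1]; field_simp] at this

lemma attains_chebyshev_of_ge (hε : 0 < ε) (hl : ε < lam) (hl2 : lam ≤ 2 * ε) (hx : x ∈ strip ε)
    (hx0 : 0 ≤ x.1) (hx1 : lam * x.1 ≤ x.2)
    (hcond : lam - ε < x.1 → x.2 ≤ 2 * (lam - ε) * x.1 - lam ^ 2 + 2 * ε * lam) :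
    Attains ε lam x (x.2 / lam ^ 2) := by
  have hlam : 0 < lam := hε.trans hl
  obtain ⟨A, hA⟩ : ∃ A, A = (x.2 / lam ^ 2 - x.1 / lam) / 2 := ⟨_, rfl⟩
  obtain ⟨B, hB⟩ : ∃ B, B = (x.2 / lam ^ 2 + x.1 / lam) / 2 := ⟨_, rfl⟩
  have e1 : lam ^ 2 * (A + B) = x.2 := by rw [hA, hB]; field_simp; ring
  have e2 : lam * (B - A) = x.1 := by rw [hA, hB]; field_simp; ring
  have hA0 : 0 ≤ A := by
    have : 0 ≤ 2 * lam ^ 2 * A := by nlinarith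
    exact nonneg_of_mul_nonneg_right this (by positivity)
  have hAB' : A ≤ B := by nlinarith
  have hx2 : x.2 ≤ lam ^ 2 := by
    rcases le_or_gt x.1 (lam - ε) with h | h
    · nlinarith [hx.2]
    · have h' := hcond h
      have h0 := hx.1
      have hxl : x.1 ≤ lam := by
        by_contra! hgt
        nlinarith
      nlinarith
  have hAB : A + B ≤ 1 :=
    le_of_mul_le_mul_left (show lam ^ 2 * (A + B) ≤ lam ^ 2 * 1 by linarith) (by positivity)
  -- The alternatives of `three_levels_variance` are the two parts of the region: mean at most `lam
  -- - ε`, or `x` on or below the tangent at abscissa `lam - ε`.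
  have := attains_three_level_of_ge hε hl.le hl2 hA0 hAB' hAB (by rw [e1, e2]; linarith [hx.2]) (by
    rcases le_or_gt x.1 (lam - ε) with h | h
    · right; rw [e2]; exact h
    · left
      have h' := hcond h
      rw [← e1, ← e2] at h'
      refine le_of_mul_le_mul_left ?_ hlam
      linarith)
  rwa [e1, e2, show A + B = x.2 / lam ^ 2 by rw [← e1]; field_simp] at this

end Regions

/-! ### Matching bounds region by region, and the covering of the strip -/

section Regions

variable {a b ε lam : ℝ} {x : ℝ × ℝ}

lemma abs_fst_mem_strip (hx : x ∈ strip ε) : (|x.1|, x.2) ∈ strip ε := by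
  simpa [strip] using hx

lemma radius_abs_fst (ε : ℝ) (x : ℝ × ℝ) : radius ε (|x.1|, x.2) = radius ε x := by
  simp [radius]

/-- The sign of `(s - w) * (p - w)` tells on which side of the tangent at abscissa `w` the point
lies. This and the next two lemmas turn the inequalities that define the regions into bounds on `s`
and `p`. -/
lemma add_radius_le (hx : x ∈ strip ε) {w : ℝ} (hw : x.1 ≤ w)
    (h : 0 ≤ x.2 - 2 * w * x.1 + w ^ 2 - ε ^ 2) : x.1 + radius ε x ≤ w := by
  rw [snd_sub_tangent hx] at h
  by_contra! hlt
  have := nonneg_of_mul_nonneg_right h (sub_pos.2 hlt)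
  have := radius_nonneg ε x
  linarith

lemma le_sub_radius (hx : x ∈ strip ε) {w : ℝ} (hw : w ≤ x.1)
    (h : 0 ≤ x.2 - 2 * w * x.1 + w ^ 2 - ε ^ 2) : w ≤ x.1 - radius ε x := by
  rw [snd_sub_tangent hx] at h
  by_contra! hlt
  have := nonpos_of_mul_nonneg_left h (sub_neg.2 hlt)
  have := radius_nonneg ε x
  linarith

lemma le_add_radius (hx : x ∈ strip ε) {w : ℝ}
    (h : x.1 < w → x.2 - 2 * w * x.1 + w ^ 2 - ε ^ 2 ≤ 0) : w ≤ x.1 + radius ε x := by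
  have hr := radius_nonneg ε x
  by_contra! hlt
  have h' := h (by linarith)
  rw [snd_sub_tangent hx] at h'
  nlinarith [mul_pos (sub_pos.2 hlt) (show 0 < w - (x.1 - radius ε x) by linarith)]

/-- On the edges the perturbation argument is unavailable, but there the middle piece coincides with
the quadratic bound or with `1`. -/
lemma measure_superlevel_le_middle_of_le (hab : a < b) (hε : 0 < ε) (hl : ε < lam)
    {φ : ℝ → ℝ} (h : φ ∈ testFunctions a b ε x) {c : ℝ} (hc : c = max 0 (lam - 2 * ε))
    (hp : lam - ε ≤ |x.1| - radius ε x) (hs : |x.1| + radius ε x ≤ lam + ε) :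
    volume.real {s : ℝ | s ∈ Icc a b ∧ lam ≤ |φ s|} ≤
      (b - a) * (1 - (lam - c - ε) / (2 * ε * (lam - c) ^ 2) *
        (x.2 - 2 * (lam + ε) * |x.1| + lam ^ 2 + 2 * ε * lam)) := by
  have hx := mem_strip_of_mem_testFunctions hab h
  rcases hs.lt_or_eq with hs' | hs'
  · rcases hp.lt_or_eq with hp' | hp'
    · exact measure_superlevel_le_middle hab hε hl h hc hp' hs'
    · have hadm : Admissible ε lam c := hc ▸ admissible_max hε hl
      have e := snd_sub_tangent (abs_fst_mem_strip hx) (lam - ε)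
      rw [radius_abs_fst, ← hp', sub_self, mul_zero] at e
      rw [hadm.middle_eq_sub, e, mul_zero, sub_zero]
      exact measure_superlevel_le_quadratic hab h (hc ▸ le_max_left _ _)
        (by linarith [hadm.lt_sub, hadm.pos])
  · rw [middle_eq' hx, hs', sub_self, zero_mul, mul_zero, sub_zero, mul_one]
    exact measure_superlevel_le_one hab φ lam

/-- The quadratic bound with `c` the lower end of the chord is sharp, because the extremal function
takes only the values `c` and `lam`; `hlow` ensures `c ≥ 0`. -/
lemma bellman_eq_chord (hab : a < b) (hε : 0 ≤ ε) (hx : x ∈ strip ε) (hlt : |x.1| < lam)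
    (hlow : x.2 ≤ lam * |x.1|) (hle : lam ^ 2 - 2 * lam * |x.1| + x.2 ≤ 2 * ε * (lam - |x.1|)) :
    bellman a b x lam ε = (x.2 - x.1 ^ 2) / (x.2 + lam ^ 2 - 2 * lam * |x.1|) := by
  have h0 : |x.1| ^ 2 ≤ x.2 := (abs_fst_mem_strip hx).1
  have hD : 0 < lam - |x.1| := sub_pos.2 hlt
  have hW : 0 < x.2 + lam ^ 2 - 2 * lam * |x.1| := by nlinarith
  rw [← sq_abs x.1]
  refine bellman_eq hab (fun φ hφ => ?_) (attains_chord (x := (|x.1|, x.2)) h0 hlt hε hle)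
  have hc : lam - (lam * |x.1| - x.2) / (lam - |x.1|) =
      (x.2 + lam ^ 2 - 2 * lam * |x.1|) / (lam - |x.1|) := by
    field_simp; ring
  have := measure_superlevel_le_quadratic (lam := lam) hab hφ
    (c := (lam * |x.1| - x.2) / (lam - |x.1|)) (div_nonneg (by linarith) hD.le)
    (by rw [← sub_pos, hc]; positivity)
  refine this.trans_eq ?_
  rw [hc]
  congr 1
  have e : x.2 - 2 * ((lam * |x.1| - x.2) / (lam - |x.1|)) * |x.1| +
      ((lam * |x.1| - x.2) / (lam - |x.1|)) ^ 2 =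
      (x.2 - |x.1| ^ 2) * (x.2 + lam ^ 2 - 2 * lam * |x.1|) / (lam - |x.1|) ^ 2 := by
    field_simp; ring
  rw [e]
  generalize x.2 + lam ^ 2 - 2 * lam * |x.1| = W at *
  field_simp

lemma bellman_eq_chord_of_lt (hab : a < b) (hε : 0 ≤ ε) (hl : lam ≤ 2 * ε) (hx : x ∈ strip ε)
    (h : x.2 < lam * |x.1|) :
    bellman a b x lam ε = (x.2 - x.1 ^ 2) / (x.2 + lam ^ 2 - 2 * lam * |x.1|) := by
  have h0 : |x.1| ^ 2 ≤ x.2 := (abs_fst_mem_strip hx).1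
  have hlt : |x.1| < lam := by
    by_contra! hge
    nlinarith [abs_nonneg x.1]
  exact bellman_eq_chord hab hε hx hlt h.le (by nlinarith)

lemma bellman_eq_of_mem_large3 (hab : a < b) (hε : 0 < ε) (hl : 2 * ε < lam)
    (h : x ∈ large3 lam ε) :
    bellman a b x lam ε = (x.2 - x.1 ^ 2) / (x.2 + lam ^ 2 - 2 * lam * |x.1|) := by
  obtain ⟨hx, h⟩ := h
  have h0 : |x.1| ^ 2 ≤ x.2 := (abs_fst_mem_strip hx).1
  have hlt : |x.1| < lam := by
    by_contra! hge
    nlinarith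
  exact bellman_eq_chord hab hε.le hx hlt (by nlinarith) (by nlinarith)

lemma bellman_eq_one (hab : a < b) (hlow : Attains ε lam (|x.1|, x.2) 1) :
    bellman a b x lam ε = 1 :=
  bellman_eq hab (fun φ _ => by rw [mul_one]; exact measure_superlevel_le_one hab φ lam) hlow

lemma bellman_eq_of_mem_small1 (hab : a < b) (hε : 0 < ε) (hl : lam ≤ ε)
    (h : x ∈ small1 lam ε) : bellman a b x lam ε = 1 := by
  obtain ⟨hx, h⟩ := h
  have hx' := abs_fst_mem_strip hx
  refine bellman_eq_one hab ?_
  rcases le_total x.2 (ε ^ 2) with h' | h'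
  · exact attains_one_of_sq_le_of_le hε hx' h h'
  · exact attains_one_of_le_sq hε hl hx' (abs_nonneg _) h'

lemma bellman_eq_of_mem_outer1 (hab : a < b) (hε : 0 < ε)
    (h : x ∈ outer1 lam ε) : bellman a b x lam ε = 1 := by
  obtain ⟨hx, -, h⟩ := h
  exact bellman_eq_one hab (attains_one_of_right hε (abs_fst_mem_strip hx)
    (le_add_radius (abs_fst_mem_strip hx) fun hlt => by linarith [h hlt]))

lemma bellman_eq_chebyshev (hab : a < b) (hlam : 0 < lam)
    (hlow : Attains ε lam (|x.1|, x.2) (x.2 / lam ^ 2)) :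
    bellman a b x lam ε = x.2 / lam ^ 2 :=
  bellman_eq hab (fun φ hφ => by
    simpa using measure_superlevel_le_quadratic hab hφ le_rfl hlam) hlow

lemma bellman_eq_of_mem_small2 (hab : a < b) (hlam : 0 < lam) (hl : lam ≤ ε)
    (h : x ∈ small2 lam ε) : bellman a b x lam ε = x.2 / lam ^ 2 :=
  bellman_eq_chebyshev hab hlam
    (attains_chebyshev_of_le (x := (|x.1|, x.2)) hlam hl h.2.1 h.2.2 (abs_nonneg _))

lemma bellman_eq_of_mem_medium4 (hab : a < b) (hε : 0 < ε) (hl : ε < lam) (hl2 : lam ≤ 2 * ε)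
    (h : x ∈ medium4 lam ε) : bellman a b x lam ε = x.2 / lam ^ 2 :=
  bellman_eq_chebyshev hab (hε.trans hl) (attains_chebyshev_of_ge (x := (|x.1|, x.2)) hε hl hl2
    (abs_fst_mem_strip h.1) (abs_nonneg _) h.2.1 h.2.2)

lemma bellman_eq_of_mem_outer2 (hab : a < b) (hε : 0 < ε) (hl : ε < lam) {c B : ℝ}
    (hc : c = max 0 (lam - 2 * ε)) (h : x ∈ outer2 lam ε)
    (hB : 1 - (lam - c - ε) / (2 * ε * (lam - c) ^ 2) *
      (x.2 - 2 * (lam + ε) * |x.1| + lam ^ 2 + 2 * ε * lam) = B)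
    (hlow : Attains ε lam (|x.1|, x.2) B) : bellman a b x lam ε = B := by
  obtain ⟨hx, h1, h2, h3⟩ := h
  have hx' := abs_fst_mem_strip hx
  have h3' := (le_max_left _ _).trans h3
  have h3'' := (le_max_right _ _).trans h3
  refine bellman_eq hab (fun φ hφ => ?_) hlow
  rw [← hB]
  refine measure_superlevel_le_middle_of_le hab hε hl hφ hc ?_ ?_
  · exact radius_abs_fst ε x ▸ le_sub_radius hx' h1 (by linarith)
  · exact radius_abs_fst ε x ▸ add_radius_le hx' h2 (by linarith)

lemma bellman_eq_of_mem_outer2_of_le (hab : a < b) (hε : 0 < ε) (hl : ε < lam)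
    (hl2 : lam ≤ 2 * ε) (h : x ∈ outer2 lam ε) :
    bellman a b x lam ε = (2 * (lam ^ 2 - ε ^ 2) * |x.1| - (lam - ε) * x.2
      + lam * (2 * ε ^ 2 + ε * lam - lam ^ 2)) / (2 * ε * lam ^ 2) := by
  have hlam : 0 < lam := hε.trans hl
  refine bellman_eq_of_mem_outer2 hab hε hl (max_eq_left (by linarith)).symm h ?_
    (attains_angle_of_le (x := (|x.1|, x.2)) hε hl hl2 (abs_fst_mem_strip h.1) h.2.1 h.2.2.1
      ((le_max_left _ _).trans h.2.2.2) ((le_max_right _ _).trans h.2.2.2))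
  rw [sub_zero]
  field_simp
  ring

lemma bellman_eq_of_mem_outer2_of_gt (hab : a < b) (hε : 0 < ε) (hl : 2 * ε < lam)
    (h : x ∈ outer2 lam ε) :
    bellman a b x lam ε =
      1 - (x.2 - 2 * (lam + ε) * |x.1| + lam ^ 2 + 2 * ε * lam) / (8 * ε ^ 2) := by
  refine bellman_eq_of_mem_outer2 hab hε (by linarith) (max_eq_right (by linarith)).symm h ?_
    (attains_angle_of_ge (x := (|x.1|, x.2)) hε (abs_fst_mem_strip h.1) h.2.1 h.2.2.1
      ((le_max_left _ _).trans h.2.2.2) ((le_max_right _ _).trans h.2.2.2))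
  rw [sub_sub_cancel]
  field_simp
  ring

lemma bellman_eq_of_mem_large4 (hab : a < b) (hε : 0 < ε) (hl : 2 * ε < lam)
    (h : x ∈ large4 lam ε) :
    bellman a b x lam ε = Real.exp 1 / 2 * (1 - √(1 - (x.2 - x.1 ^ 2) / ε ^ 2)) *
      Real.exp ((|x.1| - lam) / ε + √(1 - (x.2 - x.1 ^ 2) / ε ^ 2)) := by
  obtain ⟨hx, h1, h2, h3⟩ := h
  have hx' := abs_fst_mem_strip hx
  have hs : |x.1| + radius ε x ≤ lam - ε :=
    radius_abs_fst ε x ▸ add_radius_le hx' h1 (by linarith)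
  have hs' : ε ≤ |x.1| + radius ε x :=
    radius_abs_fst ε x ▸ le_add_radius hx' fun hlt => by linarith [h3 hlt]
  have hsqrt : √(1 - (x.2 - x.1 ^ 2) / ε ^ 2) = radius ε x / ε := by
    rw [radius, show 1 - (x.2 - x.1 ^ 2) / ε ^ 2 = (ε ^ 2 - (x.2 - x.1 ^ 2)) / ε ^ 2 by field_simp,
      Real.sqrt_div' _ (sq_nonneg ε), Real.sqrt_sq hε.le]
  have hlow := attains_tangent hε hx' (by rw [radius_abs_fst]; exact hs)
  rw [radius_abs_fst] at hlow
  have hB : Real.exp 1 / 2 * (1 - √(1 - (x.2 - x.1 ^ 2) / ε ^ 2)) *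
      Real.exp ((|x.1| - lam) / ε + √(1 - (x.2 - x.1 ^ 2) / ε ^ 2)) =
      (1 - radius ε x / ε) * Real.exp (-(lam - ε - (|x.1| + radius ε x)) / ε) / 2 := by
    rw [hsqrt, show -(lam - ε - (|x.1| + radius ε x)) / ε =
      1 + ((|x.1| - lam) / ε + radius ε x / ε) by field_simp; ring, Real.exp_add 1]
    ring
  rw [hB]
  refine bellman_eq hab (fun φ hφ => ?_) hlow
  refine (measure_superlevel_le_left hab hε hl hφ).trans_eq ?_
  -- Here `ε ≤ s ≤ lam - ε`, so the clamp is inactive and `u = s - ε`.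
  rw [max_eq_left (by linarith), min_eq_left (by linarith), tangentFn]
  have e : x.2 - 2 * (|x.1| + radius ε x - ε) * |x.1| + (|x.1| + radius ε x - ε) ^ 2 =
      2 * ε * (ε - radius ε x) := by
    linear_combination snd_eq_sub_radius_sq hx - sq_abs x.1
  simp only [e]
  rw [show (|x.1| + radius ε x - ε - (lam - 2 * ε)) / ε =
    -(lam - ε - (|x.1| + radius ε x)) / ε by ring]
  field_simp

lemma bellman_eq_of_mem_large5 (hab : a < b) (hε : 0 < ε) (hl : 2 * ε < lam)
    (h : x ∈ large5 ε) :
    bellman a b x lam ε = x.2 / (4 * ε ^ 2) * Real.exp (2 - lam / ε) := by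
  obtain ⟨hx, h1, h2⟩ := h
  have hx' := abs_fst_mem_strip hx
  have hs : |x.1| + radius ε x ≤ ε :=
    radius_abs_fst ε x ▸ add_radius_le hx' h1 (by linarith)
  refine bellman_eq hab (fun φ hφ => ?_)
    (attains_angle_zero hε hl.le hx' (abs_nonneg _) h1 h2)
  refine (measure_superlevel_le_left hab hε hl hφ).trans_eq ?_
  -- Here `s ≤ ε`, so the clamp gives `u = 0`.
  rw [max_eq_right (by linarith), min_eq_left (by linarith), tangentFn,
    show (0 - (lam - 2 * ε)) / ε = 2 - lam / ε by field_simp; ring]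
  ring

lemma strip_eq_small (ε lam : ℝ) :
    strip ε = small1 lam ε ∪ small2 lam ε ∪ small3 lam ε := by
  refine Subset.antisymm (fun x hx => ?_)
    (union_subset (union_subset (sep_subset _ _) (sep_subset _ _)) (sep_subset _ _))
  rcases lt_or_ge x.2 (lam * |x.1|) with h | h
  · exact .inr ⟨hx, h⟩
  · rcases le_total (lam ^ 2) x.2 with h' | h'
    · exact .inl (.inl ⟨hx, h'⟩)
    · exact .inl (.inr ⟨hx, h, h'⟩)

/-- To the right of the tangent through `(lam - ε, lam ^ 2)` lie only the two outer regions. -/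
lemma mem_outer1_or_mem_outer2 (hε : 0 < ε) (hx : x ∈ strip ε) (h1 : lam - ε ≤ |x.1|)
    (h2 : 2 * (lam - ε) * |x.1| - lam ^ 2 + 2 * ε * lam ≤ x.2) :
    x ∈ outer1 lam ε ∨ x ∈ outer2 lam ε := by
  rcases le_or_gt |x.1| (lam + ε) with h3 | h3
  · rcases le_total (2 * (lam + ε) * |x.1| - lam ^ 2 - 2 * ε * lam) x.2 with h4 | h4
    · exact .inr ⟨hx, h1, h3, max_le (by linarith) (by linarith)⟩
    · refine .inl ⟨hx, ?_, fun _ => h4⟩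
      nlinarith
  · exact .inl ⟨hx, by linarith, fun h => absurd h h3.le.not_gt⟩

lemma strip_eq_medium (hε : 0 < ε) :
    strip ε = outer1 lam ε ∪ outer2 lam ε ∪ medium3 lam ε ∪ medium4 lam ε := by
  refine Subset.antisymm (fun x hx => ?_) (union_subset (union_subset (union_subset
    (sep_subset _ _) (sep_subset _ _)) (sep_subset _ _)) (sep_subset _ _))
  rcases lt_or_ge x.2 (lam * |x.1|) with h | h
  · exact .inl (.inr ⟨hx, h⟩)
  · by_cases h' : lam - ε < |x.1| ∧ 2 * (lam - ε) * |x.1| - lam ^ 2 + 2 * ε * lam < x.2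
    · exact .inl (.inl (mem_outer1_or_mem_outer2 hε hx h'.1.le h'.2.le))
    · exact .inr ⟨hx, h, fun h1 => not_lt.1 fun h2 => h' ⟨h1, h2⟩⟩

lemma strip_eq_large (hε : 0 < ε) :
    strip ε = outer1 lam ε ∪ outer2 lam ε ∪ large3 lam ε ∪ large4 lam ε ∪ large5 ε := by
  refine Subset.antisymm (fun x hx => ?_) (union_subset (union_subset (union_subset (union_subset
    (sep_subset _ _) (sep_subset _ _)) (sep_subset _ _)) (sep_subset _ _)) (sep_subset _ _))
  rcases lt_or_ge x.2 (2 * (lam - ε) * |x.1| - lam ^ 2 + 2 * ε * lam) with h | h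
  · exact .inl (.inl (.inr ⟨hx, h⟩))
  · rcases le_total (lam - ε) |x.1| with h1 | h1
    · exact .inl (.inl (.inl (mem_outer1_or_mem_outer2 hε hx h1 h)))
    · by_cases h' : |x.1| < ε ∧ 2 * ε * |x.1| < x.2
      · exact .inr ⟨hx, h'.1.le, h'.2.le⟩
      · exact .inl (.inr ⟨hx, h1, h, fun h2 => not_lt.1 fun h3 => h' ⟨h2, h3⟩⟩)

lemma testFunctions_nonempty (hab : a < b) (hε : 0 ≤ ε) (hx : x ∈ strip ε) :
    (testFunctions a b ε x).Nonempty :=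
  let ⟨_, hφ⟩ := testFunctions_nonempty_unit hε hx
  ⟨_, testFunctions_comp_affine hab hφ⟩

end Regions

end WeakJN

end

theorem theorem1 (a b ε lam : ℝ) (hab : a < b) (hε : 0 < ε) (hlam : 0 ≤ lam) :
    (∀ x ∈ WeakJN.strip ε, (WeakJN.testFunctions a b ε x).Nonempty) ∧
    (lam ≤ ε →
      WeakJN.strip ε = WeakJN.small1 lam ε ∪ WeakJN.small2 lam ε ∪ WeakJN.small3 lam ε ∧
      (∀ x ∈ WeakJN.small1 lam ε, WeakJN.bellman a b x lam ε = 1) ∧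
      (∀ x ∈ WeakJN.small2 lam ε, 0 < lam →
        WeakJN.bellman a b x lam ε = x.2 / lam ^ 2) ∧
      (∀ x ∈ WeakJN.small3 lam ε,
        WeakJN.bellman a b x lam ε =
          (x.2 - x.1 ^ 2) / (x.2 + lam ^ 2 - 2 * lam * |x.1|))) ∧
    (ε < lam → lam ≤ 2 * ε →
      WeakJN.strip ε = WeakJN.outer1 lam ε ∪ WeakJN.outer2 lam ε ∪
        WeakJN.medium3 lam ε ∪ WeakJN.medium4 lam ε ∧
      (∀ x ∈ WeakJN.outer1 lam ε, WeakJN.bellman a b x lam ε = 1) ∧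
      (∀ x ∈ WeakJN.outer2 lam ε,
        WeakJN.bellman a b x lam ε =
          (2 * (lam ^ 2 - ε ^ 2) * |x.1| - (lam - ε) * x.2
            + lam * (2 * ε ^ 2 + ε * lam - lam ^ 2)) / (2 * ε * lam ^ 2)) ∧
      (∀ x ∈ WeakJN.medium3 lam ε,
        WeakJN.bellman a b x lam ε =
          (x.2 - x.1 ^ 2) / (x.2 + lam ^ 2 - 2 * lam * |x.1|)) ∧
      (∀ x ∈ WeakJN.medium4 lam ε, WeakJN.bellman a b x lam ε = x.2 / lam ^ 2)) ∧
    (2 * ε < lam →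
      WeakJN.strip ε = WeakJN.outer1 lam ε ∪ WeakJN.outer2 lam ε ∪
        WeakJN.large3 lam ε ∪ WeakJN.large4 lam ε ∪ WeakJN.large5 ε ∧
      (∀ x ∈ WeakJN.outer1 lam ε, WeakJN.bellman a b x lam ε = 1) ∧
      (∀ x ∈ WeakJN.outer2 lam ε,
        WeakJN.bellman a b x lam ε =
          1 - (x.2 - 2 * (lam + ε) * |x.1| + lam ^ 2 + 2 * ε * lam) / (8 * ε ^ 2)) ∧
      (∀ x ∈ WeakJN.large3 lam ε,
        WeakJN.bellman a b x lam ε =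
          (x.2 - x.1 ^ 2) / (x.2 + lam ^ 2 - 2 * lam * |x.1|)) ∧
      (∀ x ∈ WeakJN.large4 lam ε,
        WeakJN.bellman a b x lam ε =
          Real.exp 1 / 2 * (1 - √(1 - (x.2 - x.1 ^ 2) / ε ^ 2)) *
            Real.exp ((|x.1| - lam) / ε + √(1 - (x.2 - x.1 ^ 2) / ε ^ 2))) ∧
      (∀ x ∈ WeakJN.large5 ε,
        WeakJN.bellman a b x lam ε =
          x.2 / (4 * ε ^ 2) * Real.exp (2 - lam / ε))) := by
  open WeakJN in
  exact ⟨fun x hx => testFunctions_nonempty hab hε.le hx,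
    fun hl => ⟨strip_eq_small ε lam, fun x hx => bellman_eq_of_mem_small1 hab hε hl hx,
      fun x hx hlam' => bellman_eq_of_mem_small2 hab hlam' hl hx,
      fun x hx => bellman_eq_chord_of_lt hab hε.le (by linarith) hx.1 hx.2⟩,
    fun hl hl2 => ⟨strip_eq_medium hε, fun x hx => bellman_eq_of_mem_outer1 hab hε hx,
      fun x hx => bellman_eq_of_mem_outer2_of_le hab hε hl hl2 hx,
      fun x hx => bellman_eq_chord_of_lt hab hε.le hl2 hx.1 hx.2,
      fun x hx => bellman_eq_of_mem_medium4 hab hε hl hl2 hx⟩,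
    fun hl => ⟨strip_eq_large hε, fun x hx => bellman_eq_of_mem_outer1 hab hε hx,
      fun x hx => bellman_eq_of_mem_outer2_of_gt hab hε hl hx,
      fun x hx => bellman_eq_of_mem_large3 hab hε hl hx,
      fun x hx => bellman_eq_of_mem_large4 hab hε hl hx,
      fun x hx => bellman_eq_of_mem_large5 hab hε hl hx⟩⟩
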